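/- Let $\mathbb K\in\{\mathbb R,\mathbb C\}$. A *Banach dual pair* $\langle X,Y\rangle$ consists of two Banach spaces over $\mathbb K$ and a bounded bilinear form $X\times Y\to\mathbb K$ for which the induced maps $X\to Y^*$ and $Y\to X^*$ are injective; $\sigma(X,Y)$ is the topology on $X$ generated by the functionals $\langle\cdot,y\rangle$, $y\in Y$. A *Banach function space* over a measure space $(B,\nu)$ is an ideal $E$ of $L^0(B)$ (the a.e. classes of measurable $\mathbb K$-valued functions) with a complete lattice norm; a *Köthe dual pair* $\langle F,G\rangle$ over $(B,\nu)$ is a pair of Banach function spaces with $F\cdot G\subset L^1(B)$ that is a Banach dual pair under $\langle f,g\rangle=\int_B fg\,d\nu$. For a Banach space $X$, $E(X)$ is the space of all $f\in L^0(B;X)$ (classes of strongly measurable functions) with $\|f\|_X\in E$, normed by $\|f\|=\|\,\|f\|_X\,\|_E$, and $E\tilde\otimes X$ is the closed linear span in $E(X)$ of the functions $e\otimes x=e(\cdot)x$ ($e\in E$, $x\in X$). For a Banach dual pair $\langle X,Y\rangle$, the spaces $F(X)$ and $G(Y)$ (and likewise $F\tilde\otimes X$ and $G(Y)$, or $L^1(A;X)$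 and $L^\infty(A;Y)$) are paired by the integral of $\langle f(\cdot),g(\cdot)\rangle$. A linear operator $T$ between Banach lattices is *regular* if it is a linear combination of positive operators; a positive operator $R$ *dominates* $T$ if $|Te|\le R|e|$ for all $e$. For $T$ having a dominant, $\|T\|_{M}$ is the infimum of $\|R\|$ over all positive operators $R$ dominating $T$; for regular $T$ this is also written $\|T\|_r$. Let $(A,\mu)$ be a semi-finite measure space, let $\langle F,G\rangle$ be a Köthe dual pair of Banach function spaces over a measure space $(B,\nu)$, and let $T:L^\infty(A)\to G$ be a $\sigma(L^\infty(A),L^1(A))$-to-$\sigma(G,F)$ continuous linear operator. Suppose that one of the following holds: (i) $G$ is Dedekind complete and has a strong order unit; (ii) the image of $G\to F^*$, $g\mapsto\langle\cdot,g\rangle$, is a band in $F^*$, and $F$ is lattice isomorphic to an AL-space. Then $T$ is regular (hence has a dominant), $T$ has an adjoint $S\in\mathcal L(F,L^1(A))$, i.e. $\langle Th,f\rangle=\langle h,Sf\rangle$ for all $h\in L^\infty(A)$, $f\in F$, and $S$ is regular. Moreover, for every Banach dual pair $\langle X,Y\rangle$: (a) $T\otimes I_Y$ has a unique extension to a $\sigma(L^\infty(A;Y),L^1(A;X))$-to-$\sigma(G(Y),F\tilde\otimes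 X)$ continuous linear operator $T_Y$, and $T_Y\in\mathcal L(L^\infty(A;Y),G(Y))$; (b) $\langle x,T_Ye\rangle=T\langle x,e\rangle$ in $G$ for all $e\in L^\infty(A;Y)$ and $x\in X$; (c) $T_Y$ has an adjoint $S_X\in\mathcal L(F\tilde\otimes X,L^1(A;X))$ with respect to these dualities, and $S_X$ is the unique bounded extension of $S\otimes I_X$; (d) $\|S_X\|\le\|S\|_r$ and $\|T_Y\|\le\|T\|_{M}$. -/

import Mathlib

open MeasureTheory Filter Topology
open scoped ENNReal ComplexOrder

noncomputable section

/-! ### Measure spaces and classes of functions -/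

/-- Semi-finite measures: every measurable set of positive measure contains a measurable subset of
positive finite measure. -/
def MeasureTheory.Measure.IsSemiFinite {A : Type*} [MeasurableSpace A] (μ : Measure A) : Prop :=
  ∀ s, MeasurableSet s → μ s ≠ 0 → ∃ t ⊆ s, MeasurableSet t ∧ μ t ≠ 0 ∧ μ t < ∞

namespace MeasureTheory.AEEqFun

variable {B : Type*} [MeasurableSpace B] {ν : Measure B}
variable (𝕜 : Type*) [RCLike 𝕜] {X : Type*} [NormedAddCommGroup X]

/-- The class of `b ↦ ‖f b‖`, as an element of `L⁰(B; 𝕜)`. -/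
def modulus (f : B →ₘ[ν] X) : B →ₘ[ν] 𝕜 :=
  comp (fun x : X => ((‖x‖ : ℝ) : 𝕜)) (RCLike.continuous_ofReal.comp continuous_norm) f

theorem coeFn_modulus (f : B →ₘ[ν] X) :
    ∀ᵐ b ∂ν, modulus 𝕜 f b = ((‖f b‖ : ℝ) : 𝕜) :=
  coeFn_comp _ _ f

variable {𝕜} [NormedSpace 𝕜 X]

/-- The class of `b ↦ f b • x`. -/
def tensor (f : B →ₘ[ν] 𝕜) (x : X) : B →ₘ[ν] X :=
  comp (fun c : 𝕜 => c • x) (continuous_id.smul continuous_const) f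

theorem coeFn_tensor (f : B →ₘ[ν] 𝕜) (x : X) : ∀ᵐ b ∂ν, tensor f x b = f b • x :=
  coeFn_comp _ _ f

end MeasureTheory.AEEqFun

/-- Spaces in which every element `f` has a modulus `|f|`. -/
class HasModulus (E : Type*) where
  /-- The modulus `|f|`. -/
  modulus : E → E

/-- The modulus on `Lᵖ`: the class of `a ↦ |f a|`. -/
instance {𝕜 : Type*} [RCLike 𝕜] {A : Type*} [MeasurableSpace A] {μ : Measure A} {p : ℝ≥0∞} :
    HasModulus (Lp 𝕜 p μ) where
  modulus f := ⟨(f : A →ₘ[μ] 𝕜).modulus 𝕜, by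
    rw [Lp.mem_Lp_iff_memLp]
    refine (Lp.memLp f).of_le (AEEqFun.aestronglyMeasurable _) ?_
    filter_upwards [AEEqFun.coeFn_modulus 𝕜 (f : A →ₘ[μ] 𝕜)] with a ha
    rw [ha]
    simp⟩

/-! ### Banach function spaces -/

/-- A Banach function space on `(B, ν)`: an ideal of `L⁰(B; 𝕜)` with a complete lattice norm. -/
structure BanachFunctionSpace (𝕜 : Type*) [RCLike 𝕜] {B : Type*} [MeasurableSpace B]
    (ν : Measure B) where
  toSubmodule : Submodule 𝕜 (B →ₘ[ν] 𝕜)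
  solid : ∀ f g : B →ₘ[ν] 𝕜, g ∈ toSubmodule → (∀ᵐ b ∂ν, ‖f b‖ ≤ ‖g b‖) → f ∈ toSubmodule
  norm : toSubmodule → ℝ
  norm_nonneg : ∀ f, 0 ≤ norm f
  norm_add_le : ∀ f g, norm (f + g) ≤ norm f + norm g
  norm_smul : ∀ (c : 𝕜) (f), norm (c • f) = ‖c‖ * norm f
  eq_zero_of_norm_eq_zero : ∀ f, norm f = 0 → f = 0
  norm_mono : ∀ f g : toSubmodule,
    (∀ᵐ b ∂ν, ‖(f : B →ₘ[ν] 𝕜) b‖ ≤ ‖(g : B →ₘ[ν] 𝕜) b‖) → norm f ≤ norm g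
  complete : ∀ u : ℕ → toSubmodule,
    (∀ ε > 0, ∃ N, ∀ m ≥ N, ∀ n ≥ N, norm (u m - u n) < ε) →
      ∃ f, Tendsto (fun n => norm (u n - f)) atTop (𝓝 0)

namespace BanachFunctionSpace

variable {𝕜 : Type*} [RCLike 𝕜] {B : Type*} [MeasurableSpace B] {ν : Measure B}

/-- The underlying vector space of a Banach function space. -/
def Elem (E : BanachFunctionSpace 𝕜 ν) : Type _ := E.toSubmodule

instance : CoeSort (BanachFunctionSpace 𝕜 ν) (Type _) := ⟨Elem⟩

variable (E : BanachFunctionSpace 𝕜 ν)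

instance : AddCommGroup E := inferInstanceAs (AddCommGroup E.toSubmodule)
instance : Module 𝕜 E := inferInstanceAs (Module 𝕜 E.toSubmodule)

/-- The order inherited from `L⁰(B; 𝕜)`: `f ≤ g` iff `g - f` is a.e. real and nonnegative. -/
instance : PartialOrder E := inferInstanceAs (PartialOrder E.toSubmodule)

variable {E}

/-- The class of functions underlying an element of `E`. -/
def Elem.val (f : E) : B →ₘ[ν] 𝕜 := Subtype.val (p := (· ∈ E.toSubmodule)) f

theorem Elem.val_mem (f : E) : f.val ∈ E.toSubmodule :=
  Subtype.property (p := (· ∈ E.toSubmodule)) f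

/-- An element of the ideal, viewed in the space `E`. -/
def ofMem (f : B →ₘ[ν] 𝕜) (hf : f ∈ E.toSubmodule) : E := (⟨f, hf⟩ : E.toSubmodule)

/-- The modulus on a Banach function space: the class of `b ↦ |f b|`. -/
instance : HasModulus E where
  modulus f := ofMem (f.val.modulus 𝕜) (by
    refine E.solid _ _ f.val_mem ?_
    filter_upwards [AEEqFun.coeFn_modulus 𝕜 f.val] with b hb
    rw [hb]
    simp)

instance : Norm E := ⟨E.norm⟩

theorem norm_le_norm_of_ae (f g : E) (h : ∀ᵐ b ∂ν, ‖f.val b‖ ≤ ‖g.val b‖) : ‖f‖ ≤ ‖g‖ :=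
  E.norm_mono f g h

variable (E)

theorem normCore : NormedSpace.Core 𝕜 E where
  norm_nonneg := E.norm_nonneg
  norm_smul := E.norm_smul
  norm_triangle := E.norm_add_le
  norm_eq_zero_iff f := ⟨E.eq_zero_of_norm_eq_zero f, fun h => by
    subst h
    have := E.norm_smul 0 0
    rw [zero_smul, norm_zero, zero_mul] at this
    exact this⟩

instance : NormedAddCommGroup E := NormedAddCommGroup.ofCore E.normCore
instance : NormedSpace 𝕜 E := NormedSpace.ofCore E.normCore

instance : CompleteSpace E := by
  refine Metric.complete_of_cauchySeq_tendsto fun u hu => ?_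
  obtain ⟨f, hf⟩ := E.complete u (fun ε hε => by
    obtain ⟨N, hN⟩ := Metric.cauchySeq_iff.1 hu ε hε
    exact ⟨N, fun m hm n hn => by
      have := hN m hm n hn
      rw [dist_eq_norm] at this
      exact this⟩)
  exact ⟨f, tendsto_iff_norm_sub_tendsto_zero.2 hf⟩

/-! ### Köthe–Bochner spaces -/

variable (X : Type*) [NormedAddCommGroup X] [NormedSpace 𝕜 X]

/-- The Köthe–Bochner space `E(X)` as a subspace of `L⁰(B; X)`: the classes `f` of strongly
measurable `X`-valued functions with `‖f‖_X ∈ E`. -/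
def bochnerSubmodule : Submodule 𝕜 (B →ₘ[ν] X) where
  carrier := {f | f.modulus 𝕜 ∈ E.toSubmodule}
  zero_mem' := by
    refine E.solid _ 0 E.toSubmodule.zero_mem ?_
    filter_upwards [AEEqFun.coeFn_modulus 𝕜 (0 : B →ₘ[ν] X),
      AEEqFun.coeFn_zero (μ := ν) (β := X)] with b h1 h2
    rw [h1, h2]
    simp
  add_mem' := by
    intro f g hf hg
    refine E.solid _ _ (E.toSubmodule.add_mem hf hg) ?_
    filter_upwards [AEEqFun.coeFn_modulus 𝕜 f, AEEqFun.coeFn_modulus 𝕜 g,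
      AEEqFun.coeFn_modulus 𝕜 (f + g), AEEqFun.coeFn_add f g,
      AEEqFun.coeFn_add (f.modulus 𝕜) (g.modulus 𝕜)] with b h1 h2 h3 h4 h5
    rw [h3, h4, h5, Pi.add_apply, Pi.add_apply, h1, h2, ← RCLike.ofReal_add]
    rw [RCLike.norm_ofReal, RCLike.norm_ofReal, abs_of_nonneg (by positivity),
      abs_of_nonneg (by positivity)]
    exact _root_.norm_add_le _ _
  smul_mem' := by
    intro c f hf
    refine E.solid _ _ (E.toSubmodule.smul_mem c hf) ?_
    filter_upwards [AEEqFun.coeFn_modulus 𝕜 f, AEEqFun.coeFn_modulus 𝕜 (c • f),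
      AEEqFun.coeFn_smul c f, AEEqFun.coeFn_smul c (f.modulus 𝕜)] with b h1 h2 h3 h4
    rw [h2, h3, h4, Pi.smul_apply, Pi.smul_apply, h1]
    simp [_root_.norm_smul]

/-- The Köthe–Bochner space `E(X)`. -/
def Bochner : Type _ := E.bochnerSubmodule X

instance : AddCommGroup (E.Bochner X) := inferInstanceAs (AddCommGroup (E.bochnerSubmodule X))
instance : Module 𝕜 (E.Bochner X) := inferInstanceAs (Module 𝕜 (E.bochnerSubmodule X))

variable {E X}

/-- The class of functions underlying an element of `E(X)`. -/
def Bochner.val (f : E.Bochner X) : B →ₘ[ν] X := Subtype.val (p := (· ∈ E.bochnerSubmodule X)) f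

/-- The element `‖f‖_X` of `E`. -/
def Bochner.pointwiseNorm (f : E.Bochner X) : E :=
  ofMem (f.val.modulus 𝕜) (Subtype.property (p := (· ∈ E.bochnerSubmodule X)) f)

theorem Bochner.coeFn_pointwiseNorm (f : E.Bochner X) :
    ∀ᵐ b ∂ν, f.pointwiseNorm.val b = ((‖f.val b‖ : ℝ) : 𝕜) :=
  AEEqFun.coeFn_modulus 𝕜 f.val

theorem Bochner.coeFn_add (f g : E.Bochner X) :
    ∀ᵐ b ∂ν, (f + g).val b = f.val b + g.val b :=
  AEEqFun.coeFn_add f.val g.val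

theorem Bochner.coeFn_smul (c : 𝕜) (f : E.Bochner X) :
    ∀ᵐ b ∂ν, (c • f).val b = c • f.val b :=
  AEEqFun.coeFn_smul c f.val

theorem Elem.coeFn_add (f g : E) : ∀ᵐ b ∂ν, (f + g).val b = f.val b + g.val b :=
  AEEqFun.coeFn_add f.val g.val

theorem Elem.coeFn_smul (c : 𝕜) (f : E) : ∀ᵐ b ∂ν, (c • f).val b = c • f.val b :=
  AEEqFun.coeFn_smul c f.val

variable (E X)

/-- The norm of `E(X)` is `‖f‖ = ‖ ‖f‖_X ‖_E`. -/
instance : Norm (E.Bochner X) := ⟨fun f => ‖f.pointwiseNorm‖⟩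

theorem bochnerNormCore : NormedSpace.Core 𝕜 (E.Bochner X) where
  norm_nonneg f := E.norm_nonneg _
  norm_smul c f := by
    refine Eq.trans ?_ (_root_.norm_smul c f.pointwiseNorm)
    apply le_antisymm <;> refine norm_le_norm_of_ae _ _ ?_ <;>
    filter_upwards [f.coeFn_pointwiseNorm, (c • f).coeFn_pointwiseNorm, f.coeFn_smul c,
      f.pointwiseNorm.coeFn_smul c] with b h1 h2 h3 h4 <;>
    rw [h2, h3, h4, h1] <;> simp [_root_.norm_smul]
  norm_triangle f g := by
    refine le_trans ?_ (_root_.norm_add_le f.pointwiseNorm g.pointwiseNorm)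
    refine norm_le_norm_of_ae _ _ ?_
    filter_upwards [f.coeFn_pointwiseNorm, g.coeFn_pointwiseNorm, (f + g).coeFn_pointwiseNorm,
      f.coeFn_add g, f.pointwiseNorm.coeFn_add g.pointwiseNorm] with b h1 h2 h3 h4 h5
    rw [h3, h4, h5, h1, h2, ← RCLike.ofReal_add, RCLike.norm_ofReal, RCLike.norm_ofReal,
      abs_of_nonneg (by positivity), abs_of_nonneg (by positivity)]
    exact _root_.norm_add_le _ _
  norm_eq_zero_iff f := by
    constructor
    · intro h
      have h0 : f.pointwiseNorm = 0 := E.eq_zero_of_norm_eq_zero _ h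
      have h1 : ∀ᵐ b ∂ν, f.pointwiseNorm.val b = 0 := by
        rw [h0]
        exact AEEqFun.coeFn_zero
      refine Subtype.ext (p := (· ∈ E.bochnerSubmodule X)) (AEEqFun.ext ?_)
      filter_upwards [h1, f.coeFn_pointwiseNorm,
        AEEqFun.coeFn_zero (μ := ν) (β := X)] with b h1 h2 h3
      rw [h1] at h2
      have : f.val b = 0 := by simpa using h2.symm
      exact this.trans h3.symm
    · intro h
      subst h
      refine le_antisymm ?_ (E.norm_nonneg _)
      refine le_trans (norm_le_norm_of_ae _ 0 ?_) (norm_zero (E := E)).le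
      filter_upwards [(0 : E.Bochner X).coeFn_pointwiseNorm,
        AEEqFun.coeFn_zero (μ := ν) (β := X)] with b h1 h2
      have h3 : (0 : E.Bochner X).val b = 0 := h2
      rw [h1, h3]
      simp

instance : NormedAddCommGroup (E.Bochner X) := NormedAddCommGroup.ofCore (E.bochnerNormCore X)
instance : NormedSpace 𝕜 (E.Bochner X) := NormedSpace.ofCore (E.bochnerNormCore X)

variable {E X}

/-- The elementary tensor `f ⊗ x ∈ E(X)`, i.e. the function `b ↦ f b • x`. -/
def tmul (f : E) (x : X) : E.Bochner X :=
  (⟨f.val.tensor x, by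
    refine E.solid _ _ (E.toSubmodule.smul_mem ((‖x‖ : ℝ) : 𝕜) f.val_mem) ?_
    filter_upwards [AEEqFun.coeFn_tensor f.val x, AEEqFun.coeFn_modulus 𝕜 (f.val.tensor x),
      AEEqFun.coeFn_smul ((‖x‖ : ℝ) : 𝕜) f.val] with b h1 h2 h3
    rw [h2, h1, h3]
    simp [_root_.norm_smul, mul_comm]⟩ : E.bochnerSubmodule X)

variable (E X)

/-- `E ⊗~ X`, the closure of the linear span of the elementary tensors in `E(X)`. -/
def tensorClosure : Submodule 𝕜 (E.Bochner X) :=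
  (Submodule.span 𝕜 {φ | ∃ (f : E) (x : X), φ = tmul f x}).topologicalClosure

variable {E X}

/-- The elementary tensor `f ⊗ x` as an element of `E ⊗~ X`. -/
def tmulClosure (f : E) (x : X) : E.tensorClosure X :=
  ⟨tmul f x, Submodule.le_topologicalClosure _ (Submodule.subset_span ⟨f, x, rfl⟩)⟩

end BanachFunctionSpace

/-! ### Dual pairs and weak topologies -/

section DualPairs

variable {𝕜 : Type*} [RCLike 𝕜]

/-- A bounded bilinear form is a Banach duality if both induced maps into the dual are injective. -/
structure IsBanachDualPair {X Y : Type*} [NormedAddCommGroup X] [NormedSpace 𝕜 X]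
    [NormedAddCommGroup Y] [NormedSpace 𝕜 Y] (β : X →L[𝕜] Y →L[𝕜] 𝕜) : Prop where
  injective_left : Function.Injective β
  injective_right : Function.Injective β.flip

/-- Continuity of `T : E₁ → E₂` for the weak topologies `σ(E₁, D₁)` and `σ(E₂, D₂)` generated by
two bilinear forms. -/
def IsWeaklyContinuous {E₁ D₁ E₂ D₂ : Type*} [AddCommGroup E₁] [Module 𝕜 E₁]
    [AddCommGroup D₁] [Module 𝕜 D₁] [AddCommGroup E₂] [Module 𝕜 E₂] [AddCommGroup D₂] [Module 𝕜 D₂]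
    (b₁ : E₁ →ₗ[𝕜] D₁ →ₗ[𝕜] 𝕜) (b₂ : E₂ →ₗ[𝕜] D₂ →ₗ[𝕜] 𝕜) (T : E₁ →ₗ[𝕜] E₂) : Prop :=
  Continuous (X := WeakBilin b₁) (Y := WeakBilin b₂) T

/-- `S : D₂ → D₁` is the adjoint of `T : E₁ → E₂` with respect to two bilinear forms. -/
def IsAdjoint {E₁ D₁ E₂ D₂ : Type*} [AddCommGroup E₁] [Module 𝕜 E₁]
    [AddCommGroup D₁] [Module 𝕜 D₁] [AddCommGroup E₂] [Module 𝕜 E₂] [AddCommGroup D₂] [Module 𝕜 D₂]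
    (b₁ : E₁ →ₗ[𝕜] D₁ →ₗ[𝕜] 𝕜) (b₂ : E₂ →ₗ[𝕜] D₂ →ₗ[𝕜] 𝕜) (T : E₁ →ₗ[𝕜] E₂) (S : D₂ →ₗ[𝕜] D₁) :
    Prop :=
  ∀ e d, b₂ (T e) d = b₁ e (S d)

/-- The pairing `⟨h, f⟩ = ∫ ⟨f a, h a⟩ dμ` of `L^∞(A; Y)` with `L¹(A; X)`. -/
def linftyPairing {A : Type*} [MeasurableSpace A] (μ : Measure A) {X Y : Type*}
    [NormedAddCommGroup X] [NormedSpace 𝕜 X] [NormedAddCommGroup Y] [NormedSpace 𝕜 Y]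
    (β : X →L[𝕜] Y →L[𝕜] 𝕜) : Lp Y ∞ μ →ₗ[𝕜] Lp X 1 μ →ₗ[𝕜] 𝕜 :=
  (β.flip.lpPairing μ ∞ 1).toLinearMap₁₂

/-- The elementary tensor `h ⊗ y ∈ Lᵖ(A; Y)`, i.e. the function `a ↦ h a • y`. -/
def lpTmul {A : Type*} [MeasurableSpace A] {μ : Measure A} {p : ℝ≥0∞} {Y : Type*}
    [NormedAddCommGroup Y] [NormedSpace 𝕜 Y] (h : Lp 𝕜 p μ) (y : Y) : Lp Y p μ :=
  (ContinuousLinearMap.toSpanSingleton 𝕜 y).compLp h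

variable {B : Type*} [MeasurableSpace B] {ν : Measure B}

/-- Two Banach function spaces `F`, `G` on `(B, ν)` form a Köthe dual pair if `F · G ⊆ L¹` and
`⟨f, g⟩ = ∫ f g dν` is a Banach duality between them. -/
structure IsKotheDualPair (F G : BanachFunctionSpace 𝕜 ν) : Prop where
  integrable : ∀ (f : F) (g : G), Integrable (fun b => f.val b * g.val b) ν
  bounded : ∃ C : ℝ, ∀ (f : F) (g : G), ‖∫ b, f.val b * g.val b ∂ν‖ ≤ C * ‖f‖ * ‖g‖
  separating_left : ∀ f : F, (∀ g : G, ∫ b, f.val b * g.val b ∂ν = 0) → f = 0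
  separating_right : ∀ g : G, (∀ f : F, ∫ b, f.val b * g.val b ∂ν = 0) → g = 0

namespace IsKotheDualPair

variable {F G : BanachFunctionSpace 𝕜 ν} (hFG : IsKotheDualPair F G)
variable {X Y : Type*} [NormedAddCommGroup X] [NormedSpace 𝕜 X]
  [NormedAddCommGroup Y] [NormedSpace 𝕜 Y]

theorem integrable_bochner {F G : BanachFunctionSpace 𝕜 ν} (hFG : IsKotheDualPair F G)
    (β : X →L[𝕜] Y →L[𝕜] 𝕜) (g : G.Bochner Y) (f : F.Bochner X) :
    Integrable (fun b => β (f.val b) (g.val b)) ν := by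
  refine ((hFG.integrable f.pointwiseNorm g.pointwiseNorm).norm.const_mul ‖β‖).mono'
    (β.aestronglyMeasurable_comp₂ (AEEqFun.aestronglyMeasurable _)
      (AEEqFun.aestronglyMeasurable _)) ?_
  filter_upwards [f.coeFn_pointwiseNorm, g.coeFn_pointwiseNorm] with b h1 h2
  rw [h1, h2]
  refine (β.le_opNorm₂ _ _).trans_eq ?_
  simp [mul_assoc]

/-- The pairing `⟨g, f⟩ = ∫ f g dν` of `G` with `F`. -/
def pairing : G →ₗ[𝕜] F →ₗ[𝕜] 𝕜 :=
  LinearMap.mk₂ 𝕜 (fun g f => ∫ b, f.val b * g.val b ∂ν)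
    (fun g₁ g₂ f => by
      rw [← integral_add (hFG.integrable f g₁) (hFG.integrable f g₂)]
      refine integral_congr_ae ?_
      filter_upwards [g₁.coeFn_add g₂] with b h
      rw [h, mul_add])
    (fun c g f => by
      rw [smul_eq_mul, ← integral_const_mul]
      refine integral_congr_ae ?_
      filter_upwards [g.coeFn_smul c] with b h
      rw [h, smul_eq_mul]
      ring)
    (fun g f₁ f₂ => by
      rw [← integral_add (hFG.integrable f₁ g) (hFG.integrable f₂ g)]
      refine integral_congr_ae ?_
      filter_upwards [f₁.coeFn_add f₂] with b h
      rw [h, add_mul])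
    (fun c g f => by
      rw [smul_eq_mul, ← integral_const_mul]
      refine integral_congr_ae ?_
      filter_upwards [f.coeFn_smul c] with b h
      rw [h, smul_eq_mul]
      ring)

/-- The map `g ↦ ⟨·, g⟩` from `G` into the norm dual `F*`. -/
def toDual : G →ₗ[𝕜] StrongDual 𝕜 F where
  toFun g := (hFG.pairing g).mkContinuousOfExistsBound (by
    obtain ⟨C, hC⟩ := hFG.bounded
    exact ⟨C * ‖g‖, fun f => (hC f g).trans_eq (by ring)⟩)
  map_add' g₁ g₂ := by
    ext f
    exact LinearMap.congr_fun (hFG.pairing.map_add g₁ g₂) f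
  map_smul' c g := by
    ext f
    exact LinearMap.congr_fun (hFG.pairing.map_smul c g) f

/-- The pairing `⟨g, f⟩ = ∫ ⟨f b, g b⟩ dν` of `G(Y)` with `F(X)`. -/
def bochnerPairing (β : X →L[𝕜] Y →L[𝕜] 𝕜) : G.Bochner Y →ₗ[𝕜] F.Bochner X →ₗ[𝕜] 𝕜 :=
  LinearMap.mk₂ 𝕜 (fun g f => ∫ b, β (f.val b) (g.val b) ∂ν)
    (fun g₁ g₂ f => by
      rw [← integral_add (hFG.integrable_bochner β g₁ f) (hFG.integrable_bochner β g₂ f)]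
      refine integral_congr_ae ?_
      filter_upwards [g₁.coeFn_add g₂] with b h
      rw [h, map_add])
    (fun c g f => by
      rw [smul_eq_mul, ← integral_const_mul]
      refine integral_congr_ae ?_
      filter_upwards [g.coeFn_smul c] with b h
      rw [h, map_smul, smul_eq_mul])
    (fun g f₁ f₂ => by
      rw [← integral_add (hFG.integrable_bochner β g f₁) (hFG.integrable_bochner β g f₂)]
      refine integral_congr_ae ?_
      filter_upwards [f₁.coeFn_add f₂] with b h
      rw [h, map_add, _root_.add_apply])
    (fun c g f => by
      rw [smul_eq_mul, ← integral_const_mul]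
      refine integral_congr_ae ?_
      filter_upwards [f.coeFn_smul c] with b h
      rw [h, map_smul, _root_.smul_apply, smul_eq_mul])

/-- The pairing of `G(Y)` with `F ⊗~ X`. -/
def tensorPairing (β : X →L[𝕜] Y →L[𝕜] 𝕜) : G.Bochner Y →ₗ[𝕜] F.tensorClosure X →ₗ[𝕜] 𝕜 :=
  (hFG.bochnerPairing β).compl₂ (F.tensorClosure X).subtype

end IsKotheDualPair

end DualPairs

/-! ### Regular and dominated operators -/

section Operators

variable {𝕜 : Type*} [RCLike 𝕜]

/-- Positivity of a linear operator. -/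
def IsPositiveOp {E F : Type*} [AddCommGroup E] [Module 𝕜 E] [PartialOrder E]
    [AddCommGroup F] [Module 𝕜 F] [PartialOrder F] (R : E →ₗ[𝕜] F) : Prop :=
  ∀ e, 0 ≤ e → 0 ≤ R e

/-- A linear operator is regular if it is a linear combination of positive operators. -/
def IsRegularOp {E F : Type*} [AddCommGroup E] [Module 𝕜 E] [PartialOrder E]
    [AddCommGroup F] [Module 𝕜 F] [PartialOrder F] (T : E →ₗ[𝕜] F) : Prop :=
  T ∈ Submodule.span 𝕜 {R : E →ₗ[𝕜] F | IsPositiveOp R}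

/-- `R` is a positive operator that dominates `T`: `|T e| ≤ R |e|` for all `e`. -/
def Dominates {E F : Type*} [AddCommGroup E] [Module 𝕜 E] [PartialOrder E] [HasModulus E]
    [AddCommGroup F] [Module 𝕜 F] [PartialOrder F] [HasModulus F] (R T : E →ₗ[𝕜] F) : Prop :=
  IsPositiveOp R ∧ ∀ e, HasModulus.modulus (T e) ≤ R (HasModulus.modulus e)

/-- The norm `‖T‖_{M(E,F)}`, the infimum of the norms of the positive operators dominating `T`.
For regular `T` this is the regular norm `‖T‖_r`. (It is only used for operators with a dominant.) -/
def dominatedNorm {E F : Type*} [NormedAddCommGroup E] [NormedSpace 𝕜 E] [PartialOrder E]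
    [HasModulus E] [NormedAddCommGroup F] [NormedSpace 𝕜 F] [PartialOrder F] [HasModulus F]
    (T : E →ₗ[𝕜] F) : ℝ :=
  sInf {r | ∃ R : E →L[𝕜] F, Dominates (R : E →ₗ[𝕜] F) T ∧ r = ‖R‖}

end Operators

/-! ### Lattice properties of Banach function spaces -/

namespace BanachFunctionSpace

variable {𝕜 : Type*} [RCLike 𝕜] {B : Type*} [MeasurableSpace B] {ν : Measure B}

/-- Dedekind completeness: nonempty sets that are bounded above have a supremum.  (A nonempty set
with an upper bound is, up to translation, a set of real elements.) -/
def IsDedekindComplete (G : BanachFunctionSpace 𝕜 ν) : Prop :=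
  ∀ D : Set G, D.Nonempty → BddAbove D → ∃ g, IsLUB D g

/-- Existence of a strong order unit `e`: every `|g|` lies below a multiple of `e`. -/
def HasStrongOrderUnit (G : BanachFunctionSpace 𝕜 ν) : Prop :=
  ∃ e : G, 0 ≤ e ∧ ∀ g : G, ∃ c : ℝ, HasModulus.modulus g ≤ (c : 𝕜) • e

/-- The order of the dual `F*`: `φ ≤ ψ` iff `φ f ≤ ψ f` for all `f ≥ 0`. -/
def dualLE {F : BanachFunctionSpace 𝕜 ν} (φ ψ : StrongDual 𝕜 F) : Prop :=
  ∀ f : F, 0 ≤ f → φ f ≤ ψ f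

/-- The modulus of `φ ∈ F*` at `f ≥ 0`: `|φ|(f) = sup {|φ g| : |g| ≤ f}`. -/
def dualModulus {F : BanachFunctionSpace 𝕜 ν} (φ : StrongDual 𝕜 F) (f : F) : ℝ :=
  sSup {r | ∃ g : F, HasModulus.modulus g ≤ f ∧ r = ‖φ g‖}

/-- Bands in the dual `F*`: solid subspaces that contain the supremum in `F*` of each of their
upward directed sets of positive elements, if it exists. -/
structure IsDualBand {F : BanachFunctionSpace 𝕜 ν} (J : Submodule 𝕜 (StrongDual 𝕜 F)) :
    Prop where
  solid : ∀ φ ψ : StrongDual 𝕜 F, ψ ∈ J →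
    (∀ f : F, 0 ≤ f → dualModulus φ f ≤ dualModulus ψ f) → φ ∈ J
  sup_mem : ∀ D : Set (StrongDual 𝕜 F), D ⊆ J → D.Nonempty → DirectedOn dualLE D →
    (∀ φ ∈ D, dualLE 0 φ) → ∀ ψ : StrongDual 𝕜 F, (∀ φ ∈ D, dualLE φ ψ) →
      (∀ χ : StrongDual 𝕜 F, (∀ φ ∈ D, dualLE φ χ) → dualLE ψ χ) → ψ ∈ J

end BanachFunctionSpace

/-- AL-spaces: real Banach lattices whose norm is additive on the positive cone. -/
class ALSpace (L : Type*) extends NormedAddCommGroup L, NormedSpace ℝ L, Lattice L,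
    IsOrderedAddMonoid L, IsOrderedModule ℝ L, HasSolidNorm L, CompleteSpace L where
  norm_add_of_nonneg : ∀ x y : L, 0 ≤ x → 0 ≤ y → ‖x + y‖ = ‖x‖ + ‖y‖

universe u v

/-- `F` is lattice isomorphic to an AL-space: there is a real-linear, modulus preserving bijection
from a (real) AL-space onto the real part of `F`.  For complex scalars, `F` is then lattice
isomorphic to the complexification of that space. -/
def BanachFunctionSpace.IsLatticeIsomorphicToALSpace {𝕜 : Type u} [RCLike 𝕜] {B : Type v}
    [MeasurableSpace B] {ν : Measure B} (F : BanachFunctionSpace 𝕜 ν) : Prop :=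
  ∃ (L : Type (max u v)) (_ : ALSpace L) (Φ : L →+ F),
    (∀ (c : ℝ) (x : L), Φ (c • x) = (c : 𝕜) • Φ x) ∧
    (∀ x : L, Φ |x| = HasModulus.modulus (Φ x)) ∧
    Function.Injective Φ ∧
    Set.range Φ = {f : F | ∀ᵐ b ∂ν, RCLike.im (f.val b) = 0}

end

open scoped Pointwise

noncomputable section

/-! ### Ideals of measurable functions -/

/-! Weak continuity of `T` says that each functional h ↦ ⟨Th, f⟩ is integration against some Sf in
L¹(A). The closed graph theorem makes S bounded, and then `T` too (`exists_adjoint`,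
`continuous_of_isAdjoint`).

The main point is to find a positive operator R dominating `T`. By Riesz and Kantorovich
(`exists_dominates_of_isLUB`) it suffices that each set {Re Tk : |k| ≤ h}, h ≥ 0, has a supremum. In
case (i) this set is norm bounded, hence order bounded because of the order unit, and Dedekind
completeness applies. In case (ii) the set is made upward directed by patching finitely many of its
elements along measurable partitions (`glue`). Paired with f ≥ 0, a patched element gives Σ Re⟨kᵢ,
S(f1_{Bᵢ})⟩ ≤ const · Σ ‖f1_{Bᵢ}‖, and the AL norm bounds this by a multiple of ‖f‖. The directed
family therefore has a supremum in F*, and the band property places it in G.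

Patching also shows that S is dominated. In L¹ an upward directed set with bounded integrals has a
supremum, and for |kᵢ| ≤ f a patched element satisfies ∫ Σ 1_{Aᵢ} Re Skᵢ = Σ Re⟨T1_{Aᵢ}, kᵢ⟩ ≤ Σ
⟨R1_{Aᵢ}, f⟩ = ⟨R1, f⟩. Dominated operators are regular: split them into real and imaginary parts.

Domination gives the vector-valued extensions. For e = Σ 1_{Aₙ}yₙ with disjoint Aₙ, the series Σ
T1_{Aₙ} ⊗ yₙ converges a.e., with norm at most Σ ‖yₙ‖ R1_{Aₙ} ≤ ‖e‖ R1. A general e is a norm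
convergent series of such functions. The identity ⟨x, T_Y e⟩ = T⟨x, e⟩ survives the limits by
dominated convergence on both sides of the adjoint relation, and it determines T_Y e since X
separates Y. Similarly S_X is determined by φ∘S_X u = S(φ∘u) for φ ∈ X*, with ‖S_X u‖ ≤ Q‖u‖ a.e.
for every Q dominating S. The adjoint relation and uniqueness of T_Y reduce to testing on elementary
tensors f ⊗ x. -/

/-- A normed space realised as an ideal of `L⁰(A; 𝕜)`, with the order and modulus of `L⁰(A; 𝕜)`
and a monotone norm. -/
structure FunctionIdeal {𝕜 : Type*} [RCLike 𝕜] {A : Type*} [MeasurableSpace A] (μ : Measure A)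
    (E : Type*) [NormedAddCommGroup E] [NormedSpace 𝕜 E] [PartialOrder E] [HasModulus E] where
  val : E →ₗ[𝕜] (A →ₘ[μ] 𝕜)
  injective : Function.Injective val
  le_iff : ∀ e e', e ≤ e' ↔ val e ≤ val e'
  val_modulus : ∀ e, val (HasModulus.modulus e) = (val e).modulus 𝕜
  solid : ∀ (f : A →ₘ[μ] 𝕜) (e : E), (∀ᵐ a ∂μ, ‖f a‖ ≤ ‖val e a‖) → ∃ e', val e' = f
  norm_mono : ∀ e e', (∀ᵐ a ∂μ, ‖val e a‖ ≤ ‖val e' a‖) → ‖e‖ ≤ ‖e'‖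

/-- `Lᵖ` as an ideal of `L⁰`. -/
def FunctionIdeal.lp {𝕜 : Type*} [RCLike 𝕜] {A : Type*} [MeasurableSpace A] (μ : Measure A)
    (p : ℝ≥0∞) [Fact (1 ≤ p)] : FunctionIdeal (𝕜 := 𝕜) μ (Lp 𝕜 p μ) where
  val := (Lp.LpSubmodule 𝕜 𝕜 p μ).subtype
  injective := Subtype.val_injective
  le_iff _ _ := Iff.rfl
  val_modulus _ := rfl
  solid f e h := ⟨⟨f, Lp.mem_Lp_iff_memLp.2
    ((Lp.memLp e).of_le (AEEqFun.aestronglyMeasurable _) h)⟩, rfl⟩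
  norm_mono _ _ h := Lp.norm_le_norm_of_ae_le h

/-- A Banach function space as an ideal of `L⁰`. -/
def BanachFunctionSpace.ideal {𝕜 : Type*} [RCLike 𝕜] {B : Type*} [MeasurableSpace B]
    {ν : Measure B} (G : BanachFunctionSpace 𝕜 ν) : FunctionIdeal (𝕜 := 𝕜) ν G where
  val := G.toSubmodule.subtype
  injective := Subtype.val_injective
  le_iff _ _ := Iff.rfl
  val_modulus _ := rfl
  solid f e h := ⟨ofMem f (G.solid f _ e.val_mem h), rfl⟩
  norm_mono e e' h := norm_le_norm_of_ae e e' h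

namespace FunctionIdeal

variable {𝕜 : Type*} [RCLike 𝕜] {A : Type*} [MeasurableSpace A] {μ : Measure A}
  {E : Type*} [NormedAddCommGroup E] [NormedSpace 𝕜 E] [PartialOrder E] [HasModulus E]
  (J : FunctionIdeal (𝕜 := 𝕜) μ E)

theorem coeFn_add (e e' : E) : ∀ᵐ a ∂μ, J.val (e + e') a = J.val e a + J.val e' a := by
  rw [map_add]; exact AEEqFun.coeFn_add _ _

theorem coeFn_sub (e e' : E) : ∀ᵐ a ∂μ, J.val (e - e') a = J.val e a - J.val e' a := by
  rw [map_sub]; exact AEEqFun.coeFn_sub _ _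

theorem coeFn_smul (c : 𝕜) (e : E) : ∀ᵐ a ∂μ, J.val (c • e) a = c * J.val e a := by
  rw [map_smul]; exact AEEqFun.coeFn_smul _ _

theorem coeFn_zero : ∀ᵐ a ∂μ, J.val 0 a = 0 := by
  rw [map_zero]; exact AEEqFun.coeFn_zero

theorem coeFn_sum {ι : Type*} (s : Finset ι) (e : ι → E) :
    ∀ᵐ a ∂μ, J.val (∑ i ∈ s, e i) a = ∑ i ∈ s, J.val (e i) a := by
  classical
  induction s using Finset.induction_on with
  | empty => simpa using J.coeFn_zero
  | insert i s hi ih =>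
    simp only [Finset.sum_insert hi]
    filter_upwards [ih, J.coeFn_add (e i) (∑ i ∈ s, e i)] with a h1 h2
    rw [h2, h1]

theorem ext {e e' : E} (h : ∀ᵐ a ∂μ, J.val e a = J.val e' a) : e = e' :=
  J.injective (AEEqFun.ext h)

theorem le_iff_ae {e e' : E} : e ≤ e' ↔ ∀ᵐ a ∂μ, J.val e a ≤ J.val e' a := by
  rw [J.le_iff, ← AEEqFun.coeFn_le]; rfl

theorem nonneg_iff_ae {e : E} : 0 ≤ e ↔ ∀ᵐ a ∂μ, 0 ≤ J.val e a := by
  rw [J.le_iff_ae]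
  refine eventually_congr ?_
  filter_upwards [J.coeFn_zero] with a h
  rw [h]

theorem coeFn_modulus (e : E) :
    ∀ᵐ a ∂μ, J.val (HasModulus.modulus e) a = ((‖J.val e a‖ : ℝ) : 𝕜) := by
  rw [J.val_modulus]; exact AEEqFun.coeFn_modulus 𝕜 _

theorem isOrderedAddMonoid (J : FunctionIdeal (𝕜 := 𝕜) μ E) : IsOrderedAddMonoid E where
  add_le_add_left a b h c := by
    rw [J.le_iff_ae] at h ⊢
    filter_upwards [h, J.coeFn_add a c, J.coeFn_add b c] with x h h1 h2
    rw [h1, h2]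
    exact add_le_add_left h _

theorem exists_ae_eq (f : A → 𝕜) (hf : AEStronglyMeasurable f μ) (e : E)
    (h : ∀ᵐ a ∂μ, ‖f a‖ ≤ ‖J.val e a‖) : ∃ e', ∀ᵐ a ∂μ, J.val e' a = f a := by
  have hm := AEEqFun.coeFn_mk f hf
  obtain ⟨e', he'⟩ := J.solid (AEEqFun.mk f hf) e (by filter_upwards [h, hm] with a h hm; rwa [hm])
  exact ⟨e', by rw [he']; exact hm⟩

theorem exists_comp (φ : 𝕜 → 𝕜) (hφ : Continuous φ) (hn : ∀ z, ‖φ z‖ ≤ ‖z‖) (e : E) :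
    ∃ e', ∀ᵐ a ∂μ, J.val e' a = φ (J.val e a) :=
  J.exists_ae_eq _ (hφ.comp_aestronglyMeasurable (AEEqFun.aestronglyMeasurable _)) e
    (Eventually.of_forall fun _ => hn _)

/-- The class of `a ↦ re (e a)`. -/
def re (e : E) : E :=
  (J.exists_comp (fun z => ((RCLike.re z : ℝ) : 𝕜)) (by fun_prop)
    (fun z => by rw [RCLike.norm_ofReal]; exact RCLike.abs_re_le_norm z) e).choose

theorem coeFn_re (e : E) : ∀ᵐ a ∂μ, J.val (J.re e) a = ((RCLike.re (J.val e a) : ℝ) : 𝕜) :=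
  (J.exists_comp (fun z => ((RCLike.re z : ℝ) : 𝕜)) (by fun_prop)
    (fun z => by rw [RCLike.norm_ofReal]; exact RCLike.abs_re_le_norm z) e).choose_spec

theorem re_add (e e' : E) : J.re (e + e') = J.re e + J.re e' := by
  refine J.ext ?_
  filter_upwards [J.coeFn_re e, J.coeFn_re e', J.coeFn_re (e + e'), J.coeFn_add e e',
    J.coeFn_add (J.re e) (J.re e')] with a h1 h2 h3 h4 h5
  rw [h3, h5, h4, h1, h2]; simp

theorem re_smul (c : ℝ) (e : E) : J.re ((c : 𝕜) • e) = (c : 𝕜) • J.re e := by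
  refine J.ext ?_
  filter_upwards [J.coeFn_re e, J.coeFn_re ((c : 𝕜) • e), J.coeFn_smul (c : 𝕜) e,
    J.coeFn_smul (c : 𝕜) (J.re e)] with a h1 h2 h3 h4
  rw [h2, h4, h3, h1]; simp

theorem smul_nonneg (J : FunctionIdeal (𝕜 := 𝕜) μ E) {c : ℝ} (hc : 0 ≤ c) {e : E} (he : 0 ≤ e) : 0 ≤ (c : 𝕜) • e := by
  rw [J.nonneg_iff_ae] at he ⊢
  filter_upwards [he, J.coeFn_smul (c : 𝕜) e] with a h1 h2
  rw [h2]
  exact mul_nonneg (RCLike.ofReal_nonneg.2 hc) h1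

theorem smul_le_smul (J : FunctionIdeal (𝕜 := 𝕜) μ E) {c : ℝ} (hc : 0 ≤ c) {e e' : E} (he : e ≤ e') :
    (c : 𝕜) • e ≤ (c : 𝕜) • e' := by
  have := J.isOrderedAddMonoid
  rw [← sub_nonneg, ← smul_sub]
  exact J.smul_nonneg hc (sub_nonneg.2 he)

theorem modulus_nonneg (J : FunctionIdeal (𝕜 := 𝕜) μ E) (e : E) : 0 ≤ HasModulus.modulus e := by
  rw [J.nonneg_iff_ae]
  filter_upwards [J.coeFn_modulus e] with a h
  rw [h]; exact RCLike.ofReal_nonneg.2 (norm_nonneg _)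

theorem norm_modulus (J : FunctionIdeal (𝕜 := 𝕜) μ E) (e : E) : ‖(HasModulus.modulus e : E)‖ = ‖e‖ := by
  apply le_antisymm <;> refine J.norm_mono _ _ ?_ <;>
  filter_upwards [J.coeFn_modulus e] with a h <;> rw [h] <;> simp

theorem modulus_le_iff {e h : E} (hh : 0 ≤ h) :
    HasModulus.modulus e ≤ h ↔ ∀ᵐ a ∂μ, ‖J.val e a‖ ≤ ‖J.val h a‖ := by
  rw [J.le_iff_ae]
  rw [J.nonneg_iff_ae] at hh
  refine eventually_congr ?_
  filter_upwards [hh, J.coeFn_modulus e] with a h1 h2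
  rw [h2]
  conv_lhs => rw [← RCLike.norm_of_nonneg' h1]
  exact RCLike.ofReal_le_ofReal

theorem norm_mono_of_le (J : FunctionIdeal (𝕜 := 𝕜) μ E) {e e' : E} (h0 : 0 ≤ e) (h : e ≤ e') : ‖e‖ ≤ ‖e'‖ := by
  rw [J.nonneg_iff_ae] at h0
  rw [J.le_iff_ae] at h
  refine J.norm_mono _ _ ?_
  filter_upwards [h0, h] with a h0 h
  have h1 := h
  rw [← RCLike.norm_of_nonneg' h0, ← RCLike.norm_of_nonneg' (h0.trans h)] at h1
  exact RCLike.ofReal_le_ofReal.1 h1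

/-- Elements of an ideal are linear combinations of positive ones. -/
theorem exists_decomposition (J : FunctionIdeal (𝕜 := 𝕜) μ E) (e : E) : ∃ a b c d : E, 0 ≤ a ∧ 0 ≤ b ∧ 0 ≤ c ∧ 0 ≤ d ∧
    e = a - b + (RCLike.I : 𝕜) • (c - d) ∧ ‖a‖ ≤ ‖e‖ ∧ ‖b‖ ≤ ‖e‖ ∧ ‖c‖ ≤ ‖e‖ ∧ ‖d‖ ≤ ‖e‖ := by
  have key : ∀ r : 𝕜 → ℝ, Continuous r → (∀ z, |r z| ≤ ‖z‖) → ∃ a : E, 0 ≤ a ∧ ‖a‖ ≤ ‖e‖ ∧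
      ∀ᵐ x ∂μ, J.val a x = ((max (r (J.val e x)) 0 : ℝ) : 𝕜) := by
    intro r hr hb
    have hb' : ∀ z : 𝕜, ‖((max (r z) 0 : ℝ) : 𝕜)‖ ≤ ‖z‖ := fun z => by
      rw [RCLike.norm_ofReal, abs_of_nonneg (le_max_right _ _)]
      exact max_le ((le_abs_self _).trans (hb z)) (norm_nonneg _)
    obtain ⟨a, ha⟩ := J.exists_comp (fun z => ((max (r z) 0 : ℝ) : 𝕜)) (by fun_prop) hb' e
    refine ⟨a, J.nonneg_iff_ae.2 ?_, J.norm_mono _ _ ?_, ha⟩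
    · filter_upwards [ha] with x h
      rw [h]; exact RCLike.ofReal_nonneg.2 (le_max_right _ _)
    · filter_upwards [ha] with x h
      rw [h]; exact hb' _
  obtain ⟨a, ha, ha', ha''⟩ := key RCLike.re (by fun_prop) RCLike.abs_re_le_norm
  obtain ⟨b, hb, hb', hb''⟩ := key (fun z => -RCLike.re z) (by fun_prop)
    (fun z => by rw [abs_neg]; exact RCLike.abs_re_le_norm z)
  obtain ⟨c, hc, hc', hc''⟩ := key RCLike.im (by fun_prop) RCLike.abs_im_le_norm
  obtain ⟨d, hd, hd', hd''⟩ := key (fun z => -RCLike.im z) (by fun_prop)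
    (fun z => by rw [abs_neg]; exact RCLike.abs_im_le_norm z)
  refine ⟨a, b, c, d, ha, hb, hc, hd, J.ext ?_, ha', hb', hc', hd'⟩
  filter_upwards [ha'', hb'', hc'', hd'', J.coeFn_sub a b, J.coeFn_sub c d,
    J.coeFn_smul (RCLike.I : 𝕜) (c - d), J.coeFn_add (a - b) ((RCLike.I : 𝕜) • (c - d))]
    with x h1 h2 h3 h4 h5 h6 h7 h8
  rw [h8, h5, h7, h6, h1, h2, h3, h4, ← RCLike.ofReal_sub, ← RCLike.ofReal_sub]
  have hm : ∀ r : ℝ, max r 0 - max (-r) 0 = r := fun r => by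
    rcases le_total r 0 with h | h
    · rw [max_eq_right h, max_eq_left (by linarith)]; ring
    · rw [max_eq_left h, max_eq_right (by linarith)]; ring
  rw [hm, hm, mul_comm, RCLike.re_add_im]

/-- The positive cone of an ideal is closed. -/
theorem isClosed_nonneg (J : FunctionIdeal (𝕜 := 𝕜) μ E) : IsClosed {e : E | 0 ≤ e} := by
  refine IsSeqClosed.isClosed fun u e hu he => ?_
  obtain ⟨p, hp⟩ := J.exists_comp (fun z => ((max (RCLike.re z) 0 : ℝ) : 𝕜)) (by fun_prop)
    (fun z => by
      rw [RCLike.norm_ofReal, abs_of_nonneg (le_max_right _ _)]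
      exact max_le (RCLike.re_le_norm z) (norm_nonneg _)) e
  -- Pointwise, max(Re e, 0) is the nonnegative real number nearest to e, so `p` is at least as
  -- close to `e` as any positive element.
  have hle : ∀ n, ‖e - p‖ ≤ ‖e - u n‖ := fun n => by
    refine J.norm_mono _ _ ?_
    filter_upwards [hp, J.coeFn_sub e p, J.coeFn_sub e (u n), J.nonneg_iff_ae.1 (hu n)]
      with a h1 h2 h3 h4
    rw [h2, h3, h1]
    set z := J.val e a
    set w := J.val (u n) a
    rw [RCLike.nonneg_iff] at h4
    refine abs_le_of_sq_le_sq' ?_ (norm_nonneg _) |>.2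
    rw [RCLike.norm_sq_eq_def, RCLike.norm_sq_eq_def]
    simp only [map_sub, RCLike.ofReal_re, RCLike.ofReal_im, h4.2, sub_zero]
    gcongr ?_ + _
    rcases le_total (RCLike.re z) 0 with h | h
    · rw [max_eq_right h]; nlinarith
    · rw [max_eq_left h]; nlinarith [mul_self_nonneg (RCLike.re z - RCLike.re w)]
  have h0 : ‖e - p‖ ≤ 0 := by
    have : Tendsto (fun n => ‖e - u n‖) atTop (𝓝 0) := by
      simpa using (tendsto_const_nhds (x := e)).sub he |>.norm
    exact ge_of_tendsto' this hle
  have : e = p := sub_eq_zero.1 (norm_le_zero_iff.1 h0)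
  show 0 ≤ e
  rw [this, J.nonneg_iff_ae]
  filter_upwards [hp] with a h
  rw [h]; exact RCLike.ofReal_nonneg.2 (le_max_right _ _)

end FunctionIdeal

/-! ### Automatic boundedness on cones -/

/-- A monotone, positively homogeneous real function on a closed convex cone of a Banach space is
bounded by a multiple of the norm. -/
theorem exists_bound_of_monotone_homogeneous {𝕜 : Type*} [RCLike 𝕜] {E : Type*}
    [NormedAddCommGroup E] [NormedSpace 𝕜 E] [CompleteSpace E] (P : Set E) (hP : IsClosed P)
    (hadd : ∀ x ∈ P, ∀ y ∈ P, x + y ∈ P)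
    (hsmul : ∀ c : ℝ, 0 ≤ c → ∀ x ∈ P, (c : 𝕜) • x ∈ P) (p : E → ℝ)
    (hp : ∀ c : ℝ, 0 ≤ c → ∀ x ∈ P, p ((c : 𝕜) • x) = c * p x)
    (hmono : ∀ x ∈ P, ∀ y ∈ P, p x ≤ p (x + y)) :
    ∃ C, 0 ≤ C ∧ ∀ x ∈ P, p x ≤ C * ‖x‖ := by
  by_contra! hcon
  -- Gliding hump: x n is rescaled to norm 2⁻ⁿ, so p is still at least 4ⁿ/2ⁿ = 2ⁿ there. The sum of
  -- the series lies in P and, by monotonicity, its p-value exceeds every 2ⁿ.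
  choose x hxP hx using fun n : ℕ => hcon ((4 : ℝ) ^ n) (by positivity)
  have hx0 : ∀ n, 0 < ‖x n‖ := fun n => by
    rcases (norm_nonneg (x n)).eq_or_lt with h | h
    · exfalso
      have h0 : x n = 0 := norm_eq_zero.1 h.symm
      have h1 := hp 0 le_rfl (x n) (hxP n)
      have h2 := hx n
      rw [RCLike.ofReal_zero, zero_smul, zero_mul] at h1
      rw [h0, h1, norm_zero, mul_zero] at h2
      exact lt_irrefl _ h2
    · exact h
  have h0P : (0 : E) ∈ P := by simpa using hsmul 0 le_rfl _ (hxP 0)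
  set c : ℕ → ℝ := fun n => ((2 : ℝ) ^ n * ‖x n‖)⁻¹ with hc
  have hc0 : ∀ n, 0 ≤ c n := fun n => by positivity
  set y : ℕ → E := fun n => (c n : 𝕜) • x n with hy
  have hyP : ∀ n, y n ∈ P := fun n => hsmul _ (hc0 n) _ (hxP n)
  have hyn : ∀ n, ‖y n‖ = (1 / 2 : ℝ) ^ n := fun n => by
    have := hx0 n
    rw [hy, norm_smul, RCLike.norm_ofReal, abs_of_nonneg (hc0 n), hc]
    field_simp
    rw [← mul_pow]; norm_num
  have hsum : Summable y := Summable.of_norm (by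
    simp_rw [hyn]; exact summable_geometric_of_lt_one (by norm_num) (by norm_num))
  have htsum : ∀ z : ℕ → E, (∀ n, z n ∈ P) → Summable z → ∑' n, z n ∈ P := fun z hz hs =>
    hP.mem_of_tendsto hs.hasSum (Eventually.of_forall fun s => by
      induction s using Finset.induction_on with
      | empty => simpa using h0P
      | insert i s hi ih => rw [Finset.sum_insert hi]; exact hadd _ (hz i) _ ih)
  have hbig : ∀ n : ℕ, (2 : ℝ) ^ n ≤ p (∑' n, y n) := fun n => by
    rw [hsum.tsum_eq_add_tsum_ite n]
    refine le_trans ?_ (hmono _ (hyP n) _ (htsum _ (fun m => ?_) ?_))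
    · rw [hy, hp _ (hc0 n) _ (hxP n)]
      have h1 := hx n
      have h2 := hx0 n
      rw [hc]
      simp only
      rw [inv_mul_eq_div, le_div_iff₀ (by positivity), ← mul_assoc, ← mul_pow]
      norm_num
      exact h1.le
    · split_ifs
      exacts [h0P, hyP m]
    · refine Summable.of_norm_bounded (g := fun m => ‖y m‖) ?_ fun m => ?_
      · simp_rw [hyn]; exact summable_geometric_of_lt_one (by norm_num) (by norm_num)
      · split_ifs
        exacts [norm_zero.trans_le (norm_nonneg _), le_rfl]
  obtain ⟨n, hn⟩ := pow_unbounded_of_one_lt (p (∑' n, y n)) (one_lt_two : (1 : ℝ) < 2)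
  exact absurd (hbig n) (not_le.2 hn)

theorem div_mul_self_le {x : ℝ} (hx : 0 ≤ x) (y : ℝ) : x / y * y ≤ x := by
  rcases eq_or_ne y 0 with rfl | h
  · simpa using hx
  · rw [div_mul_cancel₀ _ h]

/-! ### The Riesz–Kantorovich theorem for function ideals -/

namespace FunctionIdeal

variable {𝕜 : Type*} [RCLike 𝕜] {A : Type*} [MeasurableSpace A] {μ : Measure A}
  {E : Type*} [NormedAddCommGroup E] [NormedSpace 𝕜 E] [PartialOrder E] [HasModulus E]
  (J : FunctionIdeal (𝕜 := 𝕜) μ E)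
  {B : Type*} [MeasurableSpace B] {ν : Measure B}
  {H : Type*} [NormedAddCommGroup H] [NormedSpace 𝕜 H] [PartialOrder H] [HasModulus H]
  (K : FunctionIdeal (𝕜 := 𝕜) ν H)

/-- An additive, positively homogeneous map on the positive cone extends to a linear map. -/
theorem exists_linearMap_of_additive_on_cone (J : FunctionIdeal (𝕜 := 𝕜) μ E)
    {M : Type*} [AddCommGroup M] [Module 𝕜 M] (p : E → M)
    (hadd : ∀ x y, 0 ≤ x → 0 ≤ y → p (x + y) = p x + p y)
    (hsmul : ∀ (c : ℝ) x, 0 ≤ c → 0 ≤ x → p ((c : 𝕜) • x) = (c : 𝕜) • p x) :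
    ∃ R : E →ₗ[𝕜] M, ∀ x, 0 ≤ x → R x = p x := by
  have hord := J.isOrderedAddMonoid
  have hp0 : p 0 = 0 := by simpa using hadd 0 0 le_rfl le_rfl
  -- The extension is built as a relation over all decompositions into positive elements, so that
  -- linearity needs no canonical choice. Single-valuedness reduces to `r0`: real parts of the
  -- decomposition of 0 give a = b, and then c = d unless `RCLike.I` is 0, in which case the second
  -- term disappears.
  let rel : E → M → Prop := fun e w => ∃ a b c d : E, 0 ≤ a ∧ 0 ≤ b ∧ 0 ≤ c ∧ 0 ≤ d ∧
    e = a - b + (RCLike.I : 𝕜) • (c - d) ∧ w = p a - p b + (RCLike.I : 𝕜) • (p c - p d)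
  have radd : ∀ e w e' w', rel e w → rel e' w' → rel (e + e') (w + w') := by
    rintro e w e' w' ⟨a, b, c, d, ha, hb, hc, hd, rfl, rfl⟩
      ⟨a', b', c', d', ha', hb', hc', hd', rfl, rfl⟩
    refine ⟨a + a', b + b', c + c', d + d', add_nonneg ha ha', add_nonneg hb hb',
      add_nonneg hc hc', add_nonneg hd hd', by module, ?_⟩
    rw [hadd _ _ ha ha', hadd _ _ hb hb', hadd _ _ hc hc', hadd _ _ hd hd']
    module
  have rneg : ∀ e w, rel e w → rel (-e) (-w) := by
    rintro e w ⟨a, b, c, d, ha, hb, hc, hd, rfl, rfl⟩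
    exact ⟨b, a, d, c, hb, ha, hd, hc, by module, by module⟩
  have rpos : ∀ (r : ℝ) e w, 0 ≤ r → rel e w → rel ((r : 𝕜) • e) ((r : 𝕜) • w) := by
    rintro r e w hr ⟨a, b, c, d, ha, hb, hc, hd, rfl, rfl⟩
    refine ⟨(r : 𝕜) • a, (r : 𝕜) • b, (r : 𝕜) • c, (r : 𝕜) • d, J.smul_nonneg hr ha,
      J.smul_nonneg hr hb, J.smul_nonneg hr hc, J.smul_nonneg hr hd, by module, ?_⟩
    rw [hsmul _ _ hr ha, hsmul _ _ hr hb, hsmul _ _ hr hc, hsmul _ _ hr hd]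
    module
  have rreal : ∀ (r : ℝ) e w, rel e w → rel ((r : 𝕜) • e) ((r : 𝕜) • w) := by
    intro r e w h
    rcases le_total 0 r with hr | hr
    · exact rpos r e w hr h
    · have := rneg _ _ (rpos (-r) e w (by linarith) h)
      simpa using this
  have rI : ∀ e w, rel e w → rel ((RCLike.I : 𝕜) • e) ((RCLike.I : 𝕜) • w) := by
    rintro e w ⟨a, b, c, d, ha, hb, hc, hd, rfl, rfl⟩
    rcases RCLike.I_mul_I_ax (K := 𝕜) with h | h
    · refine ⟨0, 0, 0, 0, le_rfl, le_rfl, le_rfl, le_rfl, ?_, ?_⟩ <;> rw [h] <;> simp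
    · refine ⟨d, c, a, b, hd, hc, ha, hb, ?_, ?_⟩ <;>
      · rw [smul_add, smul_smul, h]; module
  have rsmul : ∀ (z : 𝕜) e w, rel e w → rel (z • e) (z • w) := by
    intro z e w h
    have := radd _ _ _ _ (rreal (RCLike.re z) _ _ h) (rreal (RCLike.im z) _ _ (rI _ _ h))
    rwa [smul_smul, ← add_smul, smul_smul, ← add_smul, RCLike.re_add_im] at this
  have r0 : ∀ w, rel 0 w → w = 0 := by
    rintro w ⟨a, b, c, d, ha, hb, hc, hd, h0, rfl⟩
    have hab : a = b := J.ext (by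
      filter_upwards [J.nonneg_iff_ae.1 ha, J.nonneg_iff_ae.1 hb, J.nonneg_iff_ae.1 hc,
        J.nonneg_iff_ae.1 hd, J.coeFn_sub a b, J.coeFn_sub c d,
        J.coeFn_smul (RCLike.I : 𝕜) (c - d), J.coeFn_add (a - b) ((RCLike.I : 𝕜) • (c - d)),
        J.coeFn_zero] with x h1 h2 h3 h4 h5 h6 h7 h8 h9
      rw [← h0, h9, h5, h7, h6] at h8
      rw [RCLike.nonneg_iff] at h1 h2 h3 h4
      have := congrArg RCLike.re h8
      simp [h3.2, h4.2] at this
      apply RCLike.ext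
      · linarith
      · rw [h1.2, h2.2])
    subst hab
    rw [sub_self, zero_add, eq_comm, smul_eq_zero] at h0
    rcases h0 with h0 | h0
    · rw [h0]; simp
    · rw [sub_eq_zero.1 h0]; simp
  have rex : ∀ e, ∃ w, rel e w := fun e => by
    obtain ⟨a, b, c, d, ha, hb, hc, hd, he, -⟩ := J.exists_decomposition e
    exact ⟨_, a, b, c, d, ha, hb, hc, hd, he, rfl⟩
  have runique : ∀ e w w', rel e w → rel e w' → w = w' := fun e w w' h h' => by
    have := radd _ _ _ _ h (rneg _ _ h')
    rw [add_neg_cancel] at this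
    exact sub_eq_zero.1 (by rw [sub_eq_add_neg]; exact r0 _ this)
  choose R hR using rex
  refine ⟨{ toFun := R
            map_add' := fun e e' => runique _ _ _ (hR _) (radd _ _ _ _ (hR e) (hR e'))
            map_smul' := fun z e => runique _ _ _ (hR _) (rsmul z _ _ (hR e)) }, fun x hx => ?_⟩
  exact runique _ _ _ (hR x) ⟨x, 0, 0, 0, hx, le_rfl, le_rfl, le_rfl, by simp, by simp [hp0]⟩

/-- The Riesz decomposition property. -/
theorem exists_riesz_decomposition (J : FunctionIdeal (𝕜 := 𝕜) μ E)
    {k h₁ h₂ : E} (h₁0 : 0 ≤ h₁) (h₂0 : 0 ≤ h₂)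
    (hk : HasModulus.modulus k ≤ h₁ + h₂) : ∃ k₁ k₂, k = k₁ + k₂ ∧
      HasModulus.modulus k₁ ≤ h₁ ∧ HasModulus.modulus k₂ ≤ h₂ := by
  have hord := J.isOrderedAddMonoid
  rw [J.modulus_le_iff (add_nonneg h₁0 h₂0)] at hk
  have hn : ∀ᵐ a ∂μ, ‖J.val k a‖ ≤ ‖J.val h₁ a‖ + ‖J.val h₂ a‖ := by
    filter_upwards [hk, J.coeFn_add h₁ h₂] with a h1 h2
    rw [h2] at h1
    exact h1.trans (norm_add_le _ _)
  have hm : ∀ {e : E}, AEMeasurable (fun a => ‖J.val e a‖) μ := fun {e} =>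
    (AEEqFun.aestronglyMeasurable (J.val e)).norm.aemeasurable
  have hw0 : ∀ a, 0 ≤ ‖J.val h₁ a‖ / (‖J.val h₁ a‖ + ‖J.val h₂ a‖) := fun a => by positivity
  have hw1 : ∀ a, ‖J.val h₁ a‖ / (‖J.val h₁ a‖ + ‖J.val h₂ a‖) ≤ 1 := fun a =>
    div_le_one_of_le₀ (by linarith [norm_nonneg (J.val h₂ a)]) (by positivity)
  -- k₁ is the share h₁/(h₁ + h₂) of k. Where the denominator vanishes, Lean's quotient is 0, and k
  -- vanishes there as well.
  obtain ⟨k₁, hk₁⟩ := J.exists_ae_eq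
    (fun a => ((‖J.val h₁ a‖ / (‖J.val h₁ a‖ + ‖J.val h₂ a‖) : ℝ) : 𝕜) * J.val k a)
    ((RCLike.continuous_ofReal.comp_aestronglyMeasurable
      (hm.div (hm.add hm)).aestronglyMeasurable).mul (AEEqFun.aestronglyMeasurable _)) k
    (Eventually.of_forall fun a => by
      rw [norm_mul, RCLike.norm_ofReal, abs_of_nonneg (hw0 a)]
      exact mul_le_of_le_one_left (norm_nonneg _) (hw1 a))
  refine ⟨k₁, k - k₁, by abel, ?_, ?_⟩
  · rw [J.modulus_le_iff h₁0]
    filter_upwards [hk₁, hn] with a h1 h2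
    rw [h1, norm_mul, RCLike.norm_ofReal, abs_of_nonneg (hw0 a)]
    calc _ ≤ ‖J.val h₁ a‖ / (‖J.val h₁ a‖ + ‖J.val h₂ a‖) * (‖J.val h₁ a‖ + ‖J.val h₂ a‖) := by
          gcongr
      _ ≤ _ := div_mul_self_le (norm_nonneg _) _
  · rw [J.modulus_le_iff h₂0]
    filter_upwards [hk₁, hn, J.coeFn_sub k k₁] with a h1 h2 h3
    have : J.val k a - J.val k₁ a =
        ((1 - ‖J.val h₁ a‖ / (‖J.val h₁ a‖ + ‖J.val h₂ a‖) : ℝ) : 𝕜) * J.val k a := by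
      rw [h1]; push_cast; ring
    rw [h3, this, norm_mul, RCLike.norm_ofReal, abs_of_nonneg (by linarith [hw1 a])]
    rcases eq_or_ne (‖J.val h₁ a‖ + ‖J.val h₂ a‖) 0 with h0 | h0
    · have : ‖J.val k a‖ = 0 := le_antisymm (h2.trans h0.le) (norm_nonneg _)
      rw [this, mul_zero]; exact norm_nonneg _
    · rw [one_sub_div h0, add_sub_cancel_left]
      calc _ ≤ ‖J.val h₂ a‖ / (‖J.val h₁ a‖ + ‖J.val h₂ a‖) *
            (‖J.val h₁ a‖ + ‖J.val h₂ a‖) := by gcongr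
        _ ≤ _ := div_mul_self_le (norm_nonneg _) _

/-- By density the inequality holds for all multipliers, and the multiplier conj z gives ‖z‖² ≤ ‖z‖
r. Only countably many multipliers are assumed because each of the inequalities will be known only
almost everywhere. -/
theorem norm_le_of_re_mul_le {z : 𝕜} {r : ℝ} (hr : 0 ≤ r)
    (h : ∀ n : ℕ, RCLike.re (TopologicalSpace.denseSeq 𝕜 n * z) ≤
      ‖TopologicalSpace.denseSeq 𝕜 n‖ * r) : ‖z‖ ≤ r := by
  have key : ∀ c : 𝕜, RCLike.re (c * z) ≤ ‖c‖ * r := fun c => by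
    have hcl : IsClosed {c : 𝕜 | RCLike.re (c * z) ≤ ‖c‖ * r} :=
      isClosed_le (by fun_prop) (by fun_prop)
    refine hcl.closure_subset_iff.2 ?_ ((TopologicalSpace.denseRange_denseSeq 𝕜) c)
    rintro _ ⟨n, rfl⟩
    exact h n
  have h1 := key (starRingEnd 𝕜 z)
  rw [RCLike.conj_mul, RCLike.norm_conj, ← RCLike.ofReal_pow, RCLike.ofReal_re, sq] at h1
  rcases (norm_nonneg z).eq_or_lt with h0 | h0
  · rw [← h0]; exact hr
  · exact le_of_mul_le_mul_left h1 h0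

/-- The Riesz–Kantorovich theorem: if all the sets `{re (T k) : |k| ≤ h}` have suprema then `T` is
dominated. -/
theorem exists_dominates_of_isLUB (J : FunctionIdeal (𝕜 := 𝕜) μ E)
    (K : FunctionIdeal (𝕜 := 𝕜) ν H) (T : E →ₗ[𝕜] H)
    (hT : ∀ h : E, 0 ≤ h → ∃ g, IsLUB {g' | ∃ k, HasModulus.modulus k ≤ h ∧ g' = K.re (T k)} g) :
    ∃ R : E →ₗ[𝕜] H, Dominates R T := by
  classical
  have hordE := J.isOrderedAddMonoid
  have hordH := K.isOrderedAddMonoid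
  have hex : ∀ h : E, ∃ g, 0 ≤ h →
      IsLUB {g' | ∃ k, HasModulus.modulus k ≤ h ∧ g' = K.re (T k)} g := fun h => by
    by_cases h0 : 0 ≤ h
    · exact (hT h h0).imp fun g hg _ => hg
    · exact ⟨0, fun h' => absurd h' h0⟩
  choose p hp using hex
  have mod_smul : ∀ (c : 𝕜) {k h : E}, 0 ≤ h → HasModulus.modulus k ≤ h →
      HasModulus.modulus (c • k) ≤ ((‖c‖ : ℝ) : 𝕜) • h := fun c k h h0 hk => by
    rw [J.modulus_le_iff h0] at hk
    rw [J.modulus_le_iff (J.smul_nonneg (norm_nonneg c) h0)]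
    filter_upwards [hk, J.coeFn_smul c k, J.coeFn_smul ((‖c‖ : ℝ) : 𝕜) h] with a h1 h2 h3
    rw [h2, h3, norm_mul, norm_mul, RCLike.norm_ofReal, abs_of_nonneg (norm_nonneg c)]
    gcongr
  have hsmul_le : ∀ (c : ℝ) x, 0 < c → 0 ≤ x → p ((c : 𝕜) • x) ≤ (c : 𝕜) • p x := by
    intro c x hc hx
    refine (hp _ (J.smul_nonneg hc.le hx)).2 ?_
    rintro _ ⟨k, hk, rfl⟩
    have hk' := mod_smul ((c⁻¹ : ℝ) : 𝕜) (J.smul_nonneg hc.le hx) hk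
    rw [RCLike.norm_ofReal, abs_of_pos (inv_pos.2 hc), smul_smul, ← RCLike.ofReal_mul,
      inv_mul_cancel₀ hc.ne', RCLike.ofReal_one, one_smul] at hk'
    have := K.smul_le_smul hc.le ((hp x hx).1 ⟨_, hk', rfl⟩)
    rwa [map_smul, K.re_smul, smul_smul, ← RCLike.ofReal_mul, mul_inv_cancel₀ hc.ne',
      RCLike.ofReal_one, one_smul] at this
  have hre0 : K.re (T 0) = 0 := by
    have := K.re_smul 0 (T 0)
    simpa using this
  have hmod0 : ∀ {h : E}, 0 ≤ h → HasModulus.modulus (0 : E) ≤ h := fun {h} h0 => by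
    rw [J.modulus_le_iff h0]
    filter_upwards [J.coeFn_zero] with a h
    rw [h, norm_zero]; exact norm_nonneg _
  have hp_nonneg : ∀ x, 0 ≤ x → 0 ≤ p x := fun x hx =>
    (hp x hx).1 ⟨0, hmod0 hx, hre0.symm⟩
  -- Riesz decomposition of k gives ≤. For ≥, sums of admissible elements are admissible for x + y,
  -- and the two suprema are taken one after the other.
  have hadd : ∀ x y, 0 ≤ x → 0 ≤ y → p (x + y) = p x + p y := by
    intro x y hx hy
    apply le_antisymm
    · refine (hp _ (add_nonneg hx hy)).2 ?_
      rintro _ ⟨k, hk, rfl⟩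
      obtain ⟨k₁, k₂, rfl, h1, h2⟩ := J.exists_riesz_decomposition hx hy hk
      rw [map_add, K.re_add]
      exact add_le_add ((hp x hx).1 ⟨k₁, h1, rfl⟩) ((hp y hy).1 ⟨k₂, h2, rfl⟩)
    · have hsum : ∀ k₁ k₂, HasModulus.modulus k₁ ≤ x → HasModulus.modulus k₂ ≤ y →
          K.re (T k₁) + K.re (T k₂) ≤ p (x + y) := fun k₁ k₂ h1 h2 => by
        rw [← K.re_add, ← map_add]
        refine (hp _ (add_nonneg hx hy)).1 ⟨_, ?_, rfl⟩
        rw [J.modulus_le_iff hx] at h1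
        rw [J.modulus_le_iff hy] at h2
        rw [J.modulus_le_iff (add_nonneg hx hy)]
        filter_upwards [h1, h2, J.coeFn_add k₁ k₂, J.coeFn_add x y, J.nonneg_iff_ae.1 hx,
          J.nonneg_iff_ae.1 hy] with a h1 h2 h3 h4 h5 h6
        rw [h3, h4]
        refine (norm_add_le _ _).trans ((add_le_add h1 h2).trans_eq ?_)
        apply RCLike.ofReal_injective (K := 𝕜)
        rw [RCLike.ofReal_add, RCLike.norm_of_nonneg' h5, RCLike.norm_of_nonneg' h6,
          RCLike.norm_of_nonneg' (add_nonneg h5 h6)]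
      have h1 : ∀ k₂, HasModulus.modulus k₂ ≤ y → K.re (T k₂) ≤ p (x + y) - p x :=
        fun k₂ h2 => by
          rw [le_sub_comm]
          refine (hp x hx).2 ?_
          rintro _ ⟨k₁, h1, rfl⟩
          rw [le_sub_iff_add_le]
          exact hsum _ _ h1 h2
      rw [← le_sub_iff_add_le']
      refine (hp y hy).2 ?_
      rintro _ ⟨k₂, h2, rfl⟩
      exact h1 _ h2
  have hp0 : p 0 = 0 := by simpa using hadd 0 0 le_rfl le_rfl
  have hsmul : ∀ (c : ℝ) x, 0 ≤ c → 0 ≤ x → p ((c : 𝕜) • x) = (c : 𝕜) • p x := by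
    intro c x hc hx
    rcases hc.eq_or_lt with rfl | hc
    · simp [hp0]
    refine le_antisymm (hsmul_le c x hc hx) ?_
    have := K.smul_le_smul hc.le
      (hsmul_le c⁻¹ ((c : 𝕜) • x) (inv_pos.2 hc) (J.smul_nonneg hc.le hx))
    rwa [smul_smul, ← RCLike.ofReal_mul, inv_mul_cancel₀ hc.ne', smul_smul, ← RCLike.ofReal_mul,
      mul_inv_cancel₀ hc.ne', RCLike.ofReal_one, one_smul, one_smul] at this
  obtain ⟨R, hR⟩ := J.exists_linearMap_of_additive_on_cone p hadd hsmul
  refine ⟨R, fun e he => by rw [hR e he]; exact hp_nonneg e he, fun k => ?_⟩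
  have hm0 := J.modulus_nonneg k
  have hRk : 0 ≤ R (HasModulus.modulus k) := by rw [hR _ hm0]; exact hp_nonneg _ hm0
  -- Rotating k bounds every Re(c·Tk), not only Re Tk: c·k is admissible for |c|·|k|, at which the
  -- supremum is |c|·R|k|.
  have key : ∀ n : ℕ, ∀ᵐ b ∂ν, RCLike.re (TopologicalSpace.denseSeq 𝕜 n * K.val (T k) b) ≤
      ‖TopologicalSpace.denseSeq 𝕜 n‖ * ‖K.val (R (HasModulus.modulus k)) b‖ := fun n => by
    set c := TopologicalSpace.denseSeq 𝕜 n
    have h1 := (hp _ (J.smul_nonneg (norm_nonneg c) hm0)).1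
      ⟨c • k, mod_smul c hm0 le_rfl, rfl⟩
    rw [hsmul _ _ (norm_nonneg c) hm0, ← hR _ hm0, K.le_iff_ae] at h1
    filter_upwards [h1, K.coeFn_re (T (c • k)), K.coeFn_smul c (T k),
      K.coeFn_smul ((‖c‖ : ℝ) : 𝕜) (R (HasModulus.modulus k)), K.nonneg_iff_ae.1 hRk]
      with b h1 h2 h3 h4 h5
    rw [map_smul] at h2
    rw [map_smul, h2, h4, h3] at h1
    conv_rhs at h1 => rw [← RCLike.norm_of_nonneg' h5, ← RCLike.ofReal_mul]
    exact RCLike.ofReal_le_ofReal.1 h1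
  rw [K.modulus_le_iff hRk]
  filter_upwards [ae_all_iff.2 key] with b h
  exact norm_le_of_re_mul_le (norm_nonneg _) h

/-- Positive operators between Banach ideals are bounded. -/
theorem exists_continuousLinearMap_of_isPositiveOp [CompleteSpace E]
    (J : FunctionIdeal (𝕜 := 𝕜) μ E) (K : FunctionIdeal (𝕜 := 𝕜) ν H) (R : E →ₗ[𝕜] H)
    (hR : IsPositiveOp R) : ∃ R' : E →L[𝕜] H, (R' : E →ₗ[𝕜] H) = R := by
  have hordE := J.isOrderedAddMonoid
  have hordH := K.isOrderedAddMonoid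
  obtain ⟨C, hC, h⟩ := exists_bound_of_monotone_homogeneous (𝕜 := 𝕜) {e : E | 0 ≤ e}
    J.isClosed_nonneg (fun x hx y hy => add_nonneg hx hy) (fun c hc x hx => J.smul_nonneg hc hx)
    (fun e => ‖R e‖) (fun c hc x _ => by
      rw [map_smul, norm_smul, RCLike.norm_ofReal, abs_of_nonneg hc])
    (fun x hx y hy => K.norm_mono_of_le (hR x hx) (by
      rw [map_add]; exact le_add_of_nonneg_right (hR y hy)))
  -- One C for each of the four positive parts of e, all of norm at most ‖e‖.
  refine ⟨R.mkContinuous (4 * C) fun e => ?_, rfl⟩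
  obtain ⟨a, b, c, d, ha, hb, hc, hd, he, ha', hb', hc', hd'⟩ := J.exists_decomposition e
  have hx : ∀ x, 0 ≤ x → ‖x‖ ≤ ‖e‖ → ‖R x‖ ≤ C * ‖e‖ := fun x hx hx' =>
    (h x hx).trans (by gcongr)
  have hI : ‖(RCLike.I : 𝕜)‖ ≤ 1 := by
    rcases RCLike.I_mul_I_ax (K := 𝕜) with h | h
    · rw [h, norm_zero]; exact zero_le_one
    · have := congrArg norm h
      rw [norm_mul, norm_neg, norm_one] at this
      nlinarith [norm_nonneg (RCLike.I : 𝕜)]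
  have h1 : R e = R a - R b + (RCLike.I : 𝕜) • (R c - R d) := by
    conv_lhs => rw [he]
    simp
  rw [h1]
  calc _ ≤ ‖R a‖ + ‖R b‖ + 1 * (‖R c‖ + ‖R d‖) := by
        refine (norm_add_le _ _).trans (add_le_add (norm_sub_le _ _) ?_)
        rw [norm_smul]
        gcongr
        exact norm_sub_le _ _
    _ ≤ _ := by linarith [hx a ha ha', hx b hb hb', hx c hc hc', hx d hd hd']

/-! ### Conjugation, and regularity of dominated operators -/

/-- The class of `a ↦ conj (e a)`. -/
def conj (e : E) : E :=
  (J.exists_comp (starRingEnd 𝕜) RCLike.continuous_conj (fun z => (RCLike.norm_conj z).le) e).choose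

theorem coeFn_conj (e : E) : ∀ᵐ a ∂μ, J.val (J.conj e) a = starRingEnd 𝕜 (J.val e a) :=
  (J.exists_comp (starRingEnd 𝕜) RCLike.continuous_conj
    (fun z => (RCLike.norm_conj z).le) e).choose_spec

theorem conj_add (e e' : E) : J.conj (e + e') = J.conj e + J.conj e' := by
  refine J.ext ?_
  filter_upwards [J.coeFn_conj e, J.coeFn_conj e', J.coeFn_conj (e + e'), J.coeFn_add e e',
    J.coeFn_add (J.conj e) (J.conj e')] with a h1 h2 h3 h4 h5
  rw [h3, h5, h4, h1, h2, map_add]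

theorem conj_smul (c : 𝕜) (e : E) : J.conj (c • e) = (starRingEnd 𝕜 c) • J.conj e := by
  refine J.ext ?_
  filter_upwards [J.coeFn_conj e, J.coeFn_conj (c • e), J.coeFn_smul c e,
    J.coeFn_smul (starRingEnd 𝕜 c) (J.conj e)] with a h1 h2 h3 h4
  rw [h2, h4, h3, h1, map_mul]

theorem conj_of_nonneg {e : E} (he : 0 ≤ e) : J.conj e = e := by
  refine J.ext ?_
  filter_upwards [J.coeFn_conj e, J.nonneg_iff_ae.1 he] with a h1 h2
  rw [h1, RCLike.conj_eq_iff_im]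
  exact (RCLike.nonneg_iff.1 h2).2

/-- A real-valued Te with |Te| ≤ Re for e ≥ 0 makes R - T positive, so T = R - (R - T) is a
difference of positive operators. -/
theorem isRegularOp_of_dominates_of_im_eq_zero {V : Type*} [AddCommGroup V] [Module 𝕜 V]
    [PartialOrder V] (K : FunctionIdeal (𝕜 := 𝕜) ν H) (R T : V →ₗ[𝕜] H) (hR : IsPositiveOp R)
    (h : ∀ e, 0 ≤ e → ∀ᵐ b ∂ν, RCLike.im (K.val (T e) b) = 0 ∧
      ‖K.val (T e) b‖ ≤ ‖K.val (R e) b‖) : IsRegularOp T := by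
  have : T = R - (R - T) := by abel
  rw [this]
  refine Submodule.sub_mem _ (Submodule.subset_span hR) (Submodule.subset_span fun e he => ?_)
  rw [K.nonneg_iff_ae]
  filter_upwards [h e he, K.coeFn_sub (R e) (T e), K.nonneg_iff_ae.1 (hR e he)] with b h1 h2 h3
  rw [LinearMap.sub_apply, h2, RCLike.nonneg_iff]
  have h4 := (RCLike.re_le_norm (K.val (T e) b)).trans h1.2
  have h5 : ‖K.val (R e) b‖ = RCLike.re (K.val (R e) b) := by
    rw [← RCLike.ofReal_re (K := 𝕜) ‖K.val (R e) b‖, RCLike.norm_of_nonneg' h3]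
  simp only [map_sub, h1.1, (RCLike.nonneg_iff.1 h3).2, sub_zero, and_true]
  linarith

/-- Dominated operators between ideals are regular. -/
theorem isRegularOp_of_dominates (J : FunctionIdeal (𝕜 := 𝕜) μ E)
    (K : FunctionIdeal (𝕜 := 𝕜) ν H) (R T : E →ₗ[𝕜] H) (hR : Dominates R T) : IsRegularOp T := by
  -- T' is the conjugate operator. On e ≥ 0 the combinations `hreg1` and `hreg2` take the values
  -- Re(Te) and Im(Te), both real and bounded by Re. For real scalars `RCLike.I` is 0 and T' = T.
  let T' : E →ₗ[𝕜] H :=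
    { toFun := fun e => K.conj (T (J.conj e))
      map_add' := fun e e' => by rw [J.conj_add, map_add, K.conj_add]
      map_smul' := fun c e => by simp [J.conj_smul, K.conj_smul] }
  have hT' : ∀ e, 0 ≤ e → ∀ᵐ b ∂ν, K.val (T' e) b = starRingEnd 𝕜 (K.val (T e) b) :=
    fun e he => by
      filter_upwards [K.coeFn_conj (T (J.conj e))] with b h
      rw [J.conj_of_nonneg he] at h
      change K.val (K.conj (T (J.conj e))) b = _
      rw [J.conj_of_nonneg he, h]
  have hbd : ∀ e, 0 ≤ e → ∀ᵐ b ∂ν, ‖K.val (T e) b‖ ≤ ‖K.val (R e) b‖ := fun e he => by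
    have h1 := hR.2 e
    rw [K.modulus_le_iff (hR.1 _ (J.modulus_nonneg e))] at h1
    have h2 : HasModulus.modulus e = e := J.ext (by
      filter_upwards [J.coeFn_modulus e, J.nonneg_iff_ae.1 he] with a h1 h2
      rw [h1, RCLike.norm_of_nonneg' h2])
    rwa [h2] at h1
  have hreg1 : IsRegularOp ((2⁻¹ : 𝕜) • (T + T')) := by
    refine isRegularOp_of_dominates_of_im_eq_zero K R _ hR.1 fun e he => ?_
    filter_upwards [hT' e he, hbd e he, K.coeFn_smul (2⁻¹ : 𝕜) (T e + T' e),
      K.coeFn_add (T e) (T' e)] with b h1 h2 h3 h4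
    have h5 : K.val (((2⁻¹ : 𝕜) • (T + T')) e) b = ((RCLike.re (K.val (T e) b) : ℝ) : 𝕜) := by
      rw [LinearMap.smul_apply, LinearMap.add_apply, h3, h4, h1, RCLike.add_conj]
      field_simp
    rw [h5]
    refine ⟨RCLike.ofReal_im _, ?_⟩
    rw [RCLike.norm_ofReal]
    exact (RCLike.abs_re_le_norm _).trans h2
  have hreg2 : IsRegularOp ((-RCLike.I * 2⁻¹ : 𝕜) • (T - T')) := by
    refine isRegularOp_of_dominates_of_im_eq_zero K R _ hR.1 fun e he => ?_
    filter_upwards [hT' e he, hbd e he, K.coeFn_smul (-RCLike.I * 2⁻¹ : 𝕜) (T e - T' e),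
      K.coeFn_sub (T e) (T' e)] with b h1 h2 h3 h4
    have h5 : K.val (((-RCLike.I * 2⁻¹ : 𝕜) • (T - T')) e) b =
        ((RCLike.im (K.val (T e) b) : ℝ) : 𝕜) := by
      rw [LinearMap.smul_apply, LinearMap.sub_apply, h3, h4, h1, RCLike.sub_conj]
      rcases RCLike.I_mul_I_ax (K := 𝕜) with h | h
      · rw [h]
        have := RCLike.im_eq_zero h (K.val (T e) b)
        rw [this]; simp
      · calc _ = -((RCLike.I : 𝕜) * RCLike.I) * ((RCLike.im (K.val (T e) b) : ℝ) : 𝕜) := by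
              field_simp
          _ = _ := by rw [h]; ring
    rw [h5]
    refine ⟨RCLike.ofReal_im _, ?_⟩
    rw [RCLike.norm_ofReal]
    exact (RCLike.abs_im_le_norm _).trans h2
  have hsplit : T = (2⁻¹ : 𝕜) • (T + T') + (RCLike.I : 𝕜) • ((-RCLike.I * 2⁻¹ : 𝕜) • (T - T')) := by
    rcases RCLike.I_mul_I_ax (K := 𝕜) with h | h
    · have : T = T' := by
        refine LinearMap.ext fun e => K.ext ?_
        have : ∀ z : 𝕜, starRingEnd 𝕜 z = z := fun z => by
          rw [RCLike.conj_eq_iff_im]; exact RCLike.im_eq_zero h z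
        have he : J.conj e = e := J.ext (by
          filter_upwards [J.coeFn_conj e] with a h
          rw [h, this])
        filter_upwards [K.coeFn_conj (T (J.conj e))] with b h
        change _ = K.val (K.conj (T (J.conj e))) b
        rw [h, this, he]
      rw [← this]; simp [← two_smul 𝕜 T, smul_smul]
    · rw [smul_smul, ← mul_assoc, mul_neg, h]
      module
  rw [hsplit]
  exact Submodule.add_mem _ hreg1 (Submodule.smul_mem _ _ hreg2)

end FunctionIdeal

/-! ### Restriction, gluing, and suprema of directed sets -/

namespace FunctionIdeal

variable {𝕜 : Type*} [RCLike 𝕜] {A : Type*} [MeasurableSpace A] {μ : Measure A}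
  {E : Type*} [NormedAddCommGroup E] [NormedSpace 𝕜 E] [PartialOrder E] [HasModulus E]
  (J : FunctionIdeal (𝕜 := 𝕜) μ E)

theorem linearMap_ext_of_nonneg (J : FunctionIdeal (𝕜 := 𝕜) μ E) {M : Type*} [AddCommGroup M]
    [Module 𝕜 M] {L L' : E →ₗ[𝕜] M} (h : ∀ e, 0 ≤ e → L e = L' e) : L = L' := by
  ext e
  obtain ⟨a, b, c, d, ha, hb, hc, hd, rfl, -⟩ := J.exists_decomposition e
  simp [h a ha, h b hb, h c hc, h d hd]

/-- The class of the restriction of `e` to `s`, extended by zero. -/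
def restrict {s : Set A} (hs : MeasurableSet s) (e : E) : E :=
  (J.exists_ae_eq (s.indicator (J.val e)) ((AEEqFun.aestronglyMeasurable _).indicator hs) e
    (Eventually.of_forall fun a => norm_indicator_le_norm_self _ a)).choose

theorem coeFn_restrict {s : Set A} (hs : MeasurableSet s) (e : E) :
    ∀ᵐ a ∂μ, J.val (J.restrict hs e) a = s.indicator (J.val e) a :=
  (J.exists_ae_eq (s.indicator (J.val e)) ((AEEqFun.aestronglyMeasurable _).indicator hs) e
    (Eventually.of_forall fun a => norm_indicator_le_norm_self _ a)).choose_spec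

theorem restrict_nonneg {s : Set A} (hs : MeasurableSet s) {e : E} (he : 0 ≤ e) :
    0 ≤ J.restrict hs e := by
  rw [J.nonneg_iff_ae] at he ⊢
  filter_upwards [he, J.coeFn_restrict hs e] with a h1 h2
  rw [h2]
  exact Set.indicator_apply_nonneg fun _ => h1

theorem sum_restrict {ι : Type*} (s : SimpleFunc A ι) (e : E) :
    ∑ i ∈ s.range, J.restrict (s.measurableSet_fiber i) e = e := by
  refine J.ext ?_
  filter_upwards [J.coeFn_sum s.range fun i => J.restrict (s.measurableSet_fiber i) e,
    (s.range.eventually_all).2 fun i _ => J.coeFn_restrict (s.measurableSet_fiber i) e]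
    with a h1 h2
  rw [h1, Finset.sum_congr rfl h2, Finset.sum_eq_single (s a)]
  · simp
  · intro i _ hi
    exact Set.indicator_of_notMem (fun h => hi (by simpa using h.symm)) _
  · intro h
    exact absurd (s.mem_range_self a) h

/-- The class of `a ↦ re (v (s a) a)`. -/
def glue {ι : Type*} (v : ι → E) (s : SimpleFunc A ι) : E :=
  ∑ i ∈ s.range, J.re (J.restrict (s.measurableSet_fiber i) (v i))

theorem coeFn_glue {ι : Type*} (v : ι → E) (s : SimpleFunc A ι) :
    ∀ᵐ a ∂μ, J.val (J.glue v s) a = ((RCLike.re (J.val (v (s a)) a) : ℝ) : 𝕜) := by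
  filter_upwards [J.coeFn_sum s.range fun i => J.re (J.restrict (s.measurableSet_fiber i) (v i)),
    (s.range.eventually_all).2 fun i _ => J.coeFn_restrict (s.measurableSet_fiber i) (v i),
    (s.range.eventually_all).2 fun i _ =>
      J.coeFn_re (J.restrict (s.measurableSet_fiber i) (v i))] with a h1 h2 h3
  rw [glue, h1, Finset.sum_congr rfl h3, Finset.sum_eq_single (s a)]
  · rw [h2 _ (s.mem_range_self a), Set.indicator_of_mem (by simp)]
  · intro i hi hne
    rw [h2 i hi, Set.indicator_of_notMem (fun h => hne (by simpa using h.symm))]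
    simp
  · intro h
    exact absurd (s.mem_range_self a) h

theorem glue_const {ι : Type*} (v : ι → E) (i : ι) :
    J.glue v (SimpleFunc.const A i) = J.re (v i) := by
  refine J.ext ?_
  filter_upwards [J.coeFn_glue v (SimpleFunc.const A i), J.coeFn_re (v i)] with a h1 h2
  rw [h1, h2]; rfl

/-- Choosing at each point the index with the larger real part again gives a simple function.
Gluings thus replace finite suprema while remaining explicit finite sums, which can be paired term
by term. -/
theorem glue_directed {ι : Type*} (v : ι → E) (s t : SimpleFunc A ι) :
    ∃ r, J.glue v s ≤ J.glue v r ∧ J.glue v t ≤ J.glue v r := by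
  have hm : ∀ s : SimpleFunc A ι, Measurable fun a => RCLike.re (J.val (v (s a)) a) := fun s =>
    SimpleFunc.measurable_bind s (fun i a => RCLike.re (J.val (v i) a))
      fun i => RCLike.measurable_re.comp (AEEqFun.stronglyMeasurable (J.val (v i))).measurable
  classical
  refine ⟨SimpleFunc.piecewise _ (measurableSet_le (hm s) (hm t)) t s, ?_, ?_⟩ <;>
  · rw [J.le_iff_ae]
    filter_upwards [J.coeFn_glue v s, J.coeFn_glue v t, J.coeFn_glue v
      (SimpleFunc.piecewise _ (measurableSet_le (hm s) (hm t)) t s)] with a h1 h2 h3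
    simp only [h1, h2, h3, RCLike.ofReal_le_ofReal, SimpleFunc.piecewise_apply, Set.mem_ofPred_eq]
    split_ifs with h
    · first | exact h | exact le_rfl
    · first | exact le_rfl | exact (not_le.1 h).le

/-- Constant simple functions recover the original family, and a gluing uses only finitely many of
its members, so the upper bounds are the same. -/
theorem isLUB_range_glue_iff {ι : Type*} (v : ι → E) (g : E) :
    IsLUB (Set.range (J.glue v)) g ↔ IsLUB (Set.range fun i => J.re (v i)) g := by
  have : upperBounds (Set.range (J.glue v)) = upperBounds (Set.range fun i => J.re (v i)) := by
    ext g
    constructor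
    · rintro h _ ⟨i, rfl⟩
      exact h ⟨SimpleFunc.const A i, J.glue_const v i⟩
    · rintro h _ ⟨s, rfl⟩
      rw [J.le_iff_ae]
      filter_upwards [J.coeFn_glue v s, (s.range.eventually_all).2 fun i _ =>
        J.le_iff_ae.1 (h ⟨i, rfl⟩), (s.range.eventually_all).2 fun i _ => J.coeFn_re (v i)]
        with a h1 h2 h3
      have := h2 _ (s.mem_range_self a)
      rw [h3 _ (s.mem_range_self a)] at this
      rwa [h1]
  rw [IsLUB, IsLUB, this]

/-- In a Banach ideal with order-additive norm, norm bounded directed sets have suprema. -/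
theorem exists_isLUB_of_directedOn [CompleteSpace E] (J : FunctionIdeal (𝕜 := 𝕜) μ E) (ℓ : E → ℝ)
    (hℓ : ∀ x y, x ≤ y → ‖y - x‖ = ℓ y - ℓ x) (D : Set E) (hne : D.Nonempty)
    (hdir : DirectedOn (· ≤ ·) D) (hbdd : BddAbove (ℓ '' D)) : ∃ g, IsLUB D g := by
  have hord := J.isOrderedAddMonoid
  have hmono : ∀ x y, x ≤ y → ℓ x ≤ ℓ y := fun x y h => by
    have := hℓ x y h
    linarith [norm_nonneg (y - x)]
  have hclosed : ∀ {u : ℕ → E} {x y : E}, Tendsto u atTop (𝓝 x) → (∀ᶠ n in atTop, y ≤ u n) →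
      y ≤ x := fun {u x y} hu h => by
    have := J.isClosed_nonneg.mem_of_tendsto (hu.sub_const y)
      (h.mono fun n hn => sub_nonneg.2 hn)
    exact sub_nonneg.1 this
  set M := sSup (ℓ '' D)
  have hM : ∀ x ∈ D, ℓ x ≤ M := fun x hx => le_csSup hbdd ⟨x, hx, rfl⟩
  have hd : ∀ n : ℕ, ∃ d ∈ D, M - (1 / 2 : ℝ) ^ n < ℓ d := fun n => by
    obtain ⟨_, ⟨d, hd, rfl⟩, h⟩ := exists_lt_of_lt_csSup (hne.image ℓ)
      (show M - (1 / 2 : ℝ) ^ n < M by linarith [show (0 : ℝ) < (1 / 2) ^ n by positivity])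
    exact ⟨d, hd, h⟩
  choose d hdD hdM using hd
  choose! j hj using fun x (hx : x ∈ D) y (hy : y ∈ D) => hdir x hx y hy
  -- An increasing sequence in D with ℓ(u n) > sup ℓ - 2⁻ⁿ. Every element of D above u n is then
  -- within 2⁻ⁿ of it in norm.
  let u : ℕ → E := fun n => Nat.rec (d 0) (fun n x => j x (d (n + 1))) n
  have huD : ∀ n, u n ∈ D := fun n => by
    induction n with
    | zero => exact hdD 0
    | succ n ih => exact (hj _ ih _ (hdD (n + 1))).1
  have hu1 : ∀ n, u n ≤ u (n + 1) := fun n => (hj _ (huD n) _ (hdD (n + 1))).2.1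
  have hud : ∀ n, d n ≤ u n := fun n => by
    cases n with
    | zero => exact le_rfl
    | succ n => exact (hj _ (huD n) _ (hdD (n + 1))).2.2
  have humono : Monotone u := monotone_nat_of_le_succ hu1
  have hnorm : ∀ n, ∀ x ∈ D, u n ≤ x → ‖x - u n‖ ≤ (1 / 2 : ℝ) ^ n := fun n x hx h => by
    rw [hℓ _ _ h]
    linarith [hM x hx, hdM n, hmono _ _ (hud n)]
  have hcauchy : CauchySeq u := by
    refine cauchySeq_of_le_geometric (1 / 2) 1 (by norm_num) fun n => ?_
    rw [dist_comm, dist_eq_norm, one_mul]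
    exact hnorm n _ (huD (n + 1)) (hu1 n)
  obtain ⟨g, hg⟩ := cauchySeq_tendsto_of_complete hcauchy
  refine ⟨g, fun x hx => ?_, fun y hy => ?_⟩
  -- An element of D above both u n and x is within 2⁻ⁿ of u n, hence these elements also tend to g,
  -- and x ≤ g because the cone is closed.
  · have ht : Tendsto (fun n => j (u n) x) atTop (𝓝 g) := by
      have h0 : Tendsto (fun n => j (u n) x - u n) atTop (𝓝 0) :=
        squeeze_zero_norm (fun n => hnorm n _ (hj _ (huD n) _ hx).1 (hj _ (huD n) _ hx).2.1)
          (tendsto_pow_atTop_nhds_zero_of_lt_one (by norm_num) (by norm_num))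
      simpa using h0.add hg
    exact hclosed ht (Eventually.of_forall fun n => (hj _ (huD n) _ hx).2.2)
  · have := hclosed (hg.neg) (y := -y) (Eventually.of_forall fun n => neg_le_neg (hy (huD n)))
    exact neg_le_neg_iff.1 this

end FunctionIdeal

/-! ### Pairings and adjoints -/

section Adjoint

variable {𝕜 : Type*} [RCLike 𝕜]

/-- Pairing with d after T is continuous for the weak topology on the domain, and such functionals
are exactly those represented by elements of D₁. -/
theorem IsWeaklyContinuous.exists_eq {E₁ D₁ E₂ D₂ : Type*} [AddCommGroup E₁] [Module 𝕜 E₁]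
    [AddCommGroup D₁] [Module 𝕜 D₁] [AddCommGroup E₂] [Module 𝕜 E₂] [AddCommGroup D₂] [Module 𝕜 D₂]
    {b₁ : E₁ →ₗ[𝕜] D₁ →ₗ[𝕜] 𝕜} {b₂ : E₂ →ₗ[𝕜] D₂ →ₗ[𝕜] 𝕜} {T : E₁ →ₗ[𝕜] E₂}
    (hT : IsWeaklyContinuous b₁ b₂ T) (d : D₂) : ∃ d', ∀ e, b₂ (T e) d = b₁ e d' := by
  let φ : StrongDual 𝕜 (WeakBilin b₁) :=
    { toLinearMap := (b₂.flip d).comp T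
      cont := (WeakBilin.eval_continuous b₂ d).comp hT }
  obtain ⟨d', hd'⟩ := LinearMap.dualEmbedding_surjective b₁ φ
  exact ⟨d', fun e => (DFunLike.congr_fun hd' e).symm⟩

theorem IsAdjoint.isWeaklyContinuous {E₁ D₁ E₂ D₂ : Type*} [AddCommGroup E₁] [Module 𝕜 E₁]
    [AddCommGroup D₁] [Module 𝕜 D₁] [AddCommGroup E₂] [Module 𝕜 E₂] [AddCommGroup D₂] [Module 𝕜 D₂]
    {b₁ : E₁ →ₗ[𝕜] D₁ →ₗ[𝕜] 𝕜} {b₂ : E₂ →ₗ[𝕜] D₂ →ₗ[𝕜] 𝕜} {T : E₁ →ₗ[𝕜] E₂} {S : D₂ →ₗ[𝕜] D₁}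
    (h : IsAdjoint b₁ b₂ T S) : IsWeaklyContinuous b₁ b₂ T :=
  WeakBilin.continuous_of_continuous_eval _ fun d =>
    (WeakBilin.eval_continuous b₁ (S d)).congr fun e => (h e d).symm

variable {A : Type*} [MeasurableSpace A] {μ : Measure A}

theorem linftyPairing_apply {X Y : Type*} [NormedAddCommGroup X] [NormedSpace 𝕜 X]
    [NormedAddCommGroup Y] [NormedSpace 𝕜 Y] (β : X →L[𝕜] Y →L[𝕜] 𝕜) (h : Lp Y ∞ μ)
    (v : Lp X 1 μ) : linftyPairing μ β h v = ∫ a, β (v a) (h a) ∂μ :=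
  ContinuousLinearMap.lpPairing_eq_integral β.flip h v

theorem norm_linftyPairing_le {X Y : Type*} [NormedAddCommGroup X] [NormedSpace 𝕜 X]
    [NormedAddCommGroup Y] [NormedSpace 𝕜 Y] (β : X →L[𝕜] Y →L[𝕜] 𝕜) : ∃ C, 0 ≤ C ∧
    ∀ (h : Lp Y ∞ μ) (v : Lp X 1 μ), ‖linftyPairing μ β h v‖ ≤ C * ‖h‖ * ‖v‖ :=
  ⟨‖β.flip.lpPairing μ ∞ 1‖, ContinuousLinearMap.opNorm_nonneg _, (β.flip.lpPairing μ ∞ 1).le_opNorm₂⟩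

theorem linftyPairing_mul_apply (h : Lp 𝕜 ∞ μ) (u : Lp 𝕜 1 μ) :
    linftyPairing μ (ContinuousLinearMap.mul 𝕜 𝕜) h u = ∫ a, u a * h a ∂μ :=
  linftyPairing_apply _ h u

/-- The constant function `1` in `L^∞`. -/
def linftyOne (𝕜 : Type*) [RCLike 𝕜] {A : Type*} [MeasurableSpace A] (μ : Measure A) :
    Lp 𝕜 ∞ μ :=
  (memLp_top_of_bound aestronglyMeasurable_const (C := 1)
    (Eventually.of_forall fun _ => norm_one.le) : MemLp (fun _ => (1 : 𝕜)) ∞ μ).toLp _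

theorem coeFn_linftyOne : ∀ᵐ a ∂μ, linftyOne 𝕜 μ a = 1 :=
  MemLp.coeFn_toLp _

theorem linfty_norm_le_of_ae_bound {Y : Type*} [NormedAddCommGroup Y] {f : Lp Y ∞ μ} {C : ℝ}
    (hC : 0 ≤ C) (h : ∀ᵐ a ∂μ, ‖f a‖ ≤ C) : ‖f‖ ≤ C := by
  rw [Lp.norm_def, eLpNorm_exponent_top]
  exact ENNReal.toReal_le_of_le_ofReal hC (eLpNormEssSup_le_of_ae_bound h)

theorem linfty_ae_norm_le {Y : Type*} [NormedAddCommGroup Y] (f : Lp Y ∞ μ) :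
    ∀ᵐ a ∂μ, ‖f a‖ ≤ ‖f‖ := by
  filter_upwards [ae_le_eLpNormEssSup (f := f) (μ := μ)] with a h
  rw [← eLpNorm_exponent_top, ← Lp.enorm_def] at h
  exact enorm_le_iff_norm_le.1 h

theorem norm_linftyOne_le : ‖linftyOne 𝕜 μ‖ ≤ 1 :=
  linfty_norm_le_of_ae_bound zero_le_one (by
    filter_upwards [coeFn_linftyOne (𝕜 := 𝕜) (μ := μ)] with a h
    rw [h, norm_one])

/-- The indicator function of a measurable set in `L^∞`. -/
def linftyIndicator (𝕜 : Type*) [RCLike 𝕜] {A : Type*} [MeasurableSpace A] (μ : Measure A)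
    {s : Set A} (hs : MeasurableSet s) : Lp 𝕜 ∞ μ :=
  (FunctionIdeal.lp μ ∞).restrict hs (linftyOne 𝕜 μ)

theorem coeFn_linftyIndicator {s : Set A} (hs : MeasurableSet s) :
    ∀ᵐ a ∂μ, linftyIndicator 𝕜 μ hs a = s.indicator 1 a := by
  filter_upwards [(FunctionIdeal.lp μ ∞).coeFn_restrict hs (linftyOne 𝕜 μ),
    coeFn_linftyOne (𝕜 := 𝕜) (μ := μ)] with a h1 h2
  refine Eq.trans h1 ?_
  by_cases h : a ∈ s
  · rw [Set.indicator_of_mem h, Set.indicator_of_mem h]; exact h2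
  · rw [Set.indicator_of_notMem h, Set.indicator_of_notMem h]

/-- Indicators of all measurable sets belong to L^∞, and an integrable function whose set integrals
vanish is zero a.e. -/
theorem eq_zero_of_forall_linftyPairing_eq_zero (u : Lp 𝕜 1 μ)
    (h : ∀ e, linftyPairing μ (ContinuousLinearMap.mul 𝕜 𝕜) e u = 0) : u = 0 := by
  refine (Lp.eq_zero_iff_ae_eq_zero).2 ?_
  refine (L1.integrable_coeFn u).ae_eq_zero_of_forall_setIntegral_eq_zero fun s hs _ => ?_
  rw [← h (linftyIndicator 𝕜 μ hs), linftyPairing_mul_apply, ← integral_indicator hs]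
  refine integral_congr_ae ?_
  filter_upwards [coeFn_linftyIndicator (𝕜 := 𝕜) (μ := μ) hs] with a ha
  rw [ha]
  by_cases h : a ∈ s <;> simp [h]

variable {B : Type*} [MeasurableSpace B] {ν : Measure B} {F G : BanachFunctionSpace 𝕜 ν}
  (hFG : IsKotheDualPair F G)

theorem IsKotheDualPair.pairing_apply (g : G) (f : F) :
    hFG.pairing g f = ∫ b, f.val b * g.val b ∂ν := rfl

include hFG in
theorem IsKotheDualPair.exists_bound : ∃ C, 0 ≤ C ∧ ∀ (g : G) (f : F),
    ‖hFG.pairing g f‖ ≤ C * ‖g‖ * ‖f‖ := by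
  obtain ⟨C, hC⟩ := hFG.bounded
  refine ⟨max C 0, le_max_right _ _, fun g f => (hC f g).trans ?_⟩
  rw [mul_right_comm]
  gcongr
  exact le_max_left _ _

theorem IsKotheDualPair.ext_right {g g' : G} (h : ∀ f, hFG.pairing g f = hFG.pairing g' f) :
    g = g' := by
  rw [← sub_eq_zero]
  refine hFG.separating_right _ fun f => ?_
  rw [← hFG.pairing_apply, map_sub, LinearMap.sub_apply, h f, sub_self]

/-- A weakly continuous operator `L^∞ → G` has a bounded adjoint `F → L¹`. -/
theorem IsKotheDualPair.exists_adjoint {T : Lp 𝕜 ∞ μ →ₗ[𝕜] G}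
    (hT : IsWeaklyContinuous (linftyPairing μ (ContinuousLinearMap.mul 𝕜 𝕜)) hFG.pairing T) :
    ∃ S : F →L[𝕜] Lp 𝕜 1 μ, IsAdjoint (linftyPairing μ (ContinuousLinearMap.mul 𝕜 𝕜))
      hFG.pairing T (S : F →ₗ[𝕜] Lp 𝕜 1 μ) := by
  choose S hS using hT.exists_eq
  have huniq : ∀ u u' : Lp 𝕜 1 μ, (∀ e, linftyPairing μ (ContinuousLinearMap.mul 𝕜 𝕜) e u =
      linftyPairing μ (ContinuousLinearMap.mul 𝕜 𝕜) e u') → u = u' := fun u u' h =>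
    sub_eq_zero.1 (eq_zero_of_forall_linftyPairing_eq_zero _ fun e => by
      rw [map_sub, h e, sub_self])
  let S' : F →ₗ[𝕜] Lp 𝕜 1 μ :=
    { toFun := S
      map_add' := fun f f' => huniq _ _ fun e => by rw [map_add, ← hS, ← hS, ← hS, map_add]
      map_smul' := fun c f => huniq _ _ fun e => by
        rw [map_smul, ← hS, ← hS, map_smul, RingHom.id_apply] }
  obtain ⟨C, -, hC⟩ := hFG.exists_bound
  obtain ⟨C', -, hC'⟩ := norm_linftyPairing_le (𝕜 := 𝕜) (μ := μ) (ContinuousLinearMap.mul 𝕜 𝕜)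
  -- Closed graph theorem: both pairings are norm continuous, and L^∞ separates the points of L¹.
  have hcont : Continuous S' := by
    refine LinearMap.continuous_of_seq_closed_graph S' fun f x y hf hy => huniq _ _ fun e => ?_
    have h1 : Continuous fun u => linftyPairing μ (ContinuousLinearMap.mul 𝕜 𝕜) e u :=
      ((linftyPairing μ (ContinuousLinearMap.mul 𝕜 𝕜) e).mkContinuous (C' * ‖e‖) (hC' e)).continuous
    have h2 : Continuous fun f => hFG.pairing (T e) f :=
      ((hFG.pairing (T e)).mkContinuous (C * ‖T e‖) (hC _)).continuous
    refine tendsto_nhds_unique ((h1.tendsto y).comp hy) ?_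
    refine (((h2.tendsto x).comp hf).congr fun n => hS _ _).trans_eq ?_
    rw [hS]; rfl
  exact ⟨⟨S', hcont⟩, fun e d => hS d e⟩

/-- Closed graph again, now with F separating G. Norm boundedness of T is what makes the sets {Re Tk
: |k| ≤ h} norm bounded in case (i). -/
theorem IsKotheDualPair.continuous_of_isAdjoint {T : Lp 𝕜 ∞ μ →ₗ[𝕜] G} {S : F →ₗ[𝕜] Lp 𝕜 1 μ}
    (hS : IsAdjoint (linftyPairing μ (ContinuousLinearMap.mul 𝕜 𝕜)) hFG.pairing T S) :
    Continuous T := by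
  obtain ⟨C, -, hC⟩ := hFG.exists_bound
  obtain ⟨C', -, hC'⟩ := norm_linftyPairing_le (𝕜 := 𝕜) (μ := μ) (ContinuousLinearMap.mul 𝕜 𝕜)
  refine LinearMap.continuous_of_seq_closed_graph T fun f x y hf hy => hFG.ext_right fun e => ?_
  have h1 : Continuous fun h => linftyPairing μ (ContinuousLinearMap.mul 𝕜 𝕜) h (S e) :=
    (((linftyPairing μ (ContinuousLinearMap.mul 𝕜 𝕜)).flip (S e)).mkContinuous (C' * ‖S e‖)
      fun h => (hC' h (S e)).trans_eq (by ring)).continuous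
  have h2 : Continuous fun g => hFG.pairing g e :=
    ((hFG.pairing.flip e).mkContinuous (C * ‖e‖) fun g => (hC g e).trans_eq (by ring)).continuous
  refine tendsto_nhds_unique ((h2.tendsto y).comp hy) ?_
  refine (((h1.tendsto x).comp hf).congr fun n => (hS _ _).symm).trans_eq ?_
  rw [hS]

end Adjoint

/-! ### Existence of dominants -/

section Dominants

variable {𝕜 : Type*} [RCLike 𝕜] {A : Type*} [MeasurableSpace A] {μ : Measure A}
  {B : Type*} [MeasurableSpace B] {ν : Measure B} {F G : BanachFunctionSpace 𝕜 ν}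
  (hFG : IsKotheDualPair F G)

theorem IsKotheDualPair.pairing_nonneg {g : G} {f : F} (hg : 0 ≤ g) (hf : 0 ≤ f) :
    0 ≤ hFG.pairing g f := by
  rw [hFG.pairing_apply]
  have h : ∀ᵐ b ∂ν, 0 ≤ f.val b * g.val b := by
    filter_upwards [G.ideal.nonneg_iff_ae.1 hg, F.ideal.nonneg_iff_ae.1 hf] with b h1 h2
    exact mul_nonneg h2 h1
  exact integral_nonneg_of_ae h

theorem IsKotheDualPair.pairing_mono {g g' : G} {f : F} (hg : g ≤ g') (hf : 0 ≤ f) :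
    hFG.pairing g f ≤ hFG.pairing g' f := by
  have := G.ideal.isOrderedAddMonoid
  have h := hFG.pairing_nonneg (sub_nonneg.2 hg) hf
  rw [map_sub, LinearMap.sub_apply] at h
  exact sub_nonneg.1 h

theorem IsKotheDualPair.pairing_restrict {s : Set B} (hs : MeasurableSet s) (g : G) (f : F) :
    hFG.pairing (G.ideal.restrict hs g) f = hFG.pairing g (F.ideal.restrict hs f) := by
  rw [hFG.pairing_apply, hFG.pairing_apply]
  refine integral_congr_ae ?_
  filter_upwards [G.ideal.coeFn_restrict hs g, F.ideal.coeFn_restrict hs f] with b h1 h2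
  change f.val b * G.ideal.val _ b = F.ideal.val _ b * g.val b
  rw [h1, h2]
  by_cases h : b ∈ s
  · rw [Set.indicator_of_mem h, Set.indicator_of_mem h]; rfl
  · rw [Set.indicator_of_notMem h, Set.indicator_of_notMem h, mul_zero, zero_mul]

theorem IsKotheDualPair.pairing_re (g : G) {f : F} (hf : 0 ≤ f) :
    hFG.pairing (G.ideal.re g) f = ((RCLike.re (hFG.pairing g f) : ℝ) : 𝕜) := by
  rw [hFG.pairing_apply, hFG.pairing_apply,
    ← integral_re (hFG.integrable f g), ← integral_ofReal]
  refine integral_congr_ae ?_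
  filter_upwards [G.ideal.coeFn_re g, F.ideal.nonneg_iff_ae.1 hf] with b h1 h2
  change f.val b * G.ideal.val _ b = _
  rw [h1, RCLike.nonneg_iff] at *
  change 0 ≤ RCLike.re (f.val b) ∧ RCLike.im (f.val b) = 0 at h2
  change f.val b * ((RCLike.re (g.val b) : ℝ) : 𝕜) = _
  rw [RCLike.mul_re, h2.2, zero_mul, sub_zero, RCLike.ofReal_mul]
  congr 1
  apply RCLike.ext <;> simp [h2.2]

theorem IsKotheDualPair.re_pairing_glue {ι : Type*} (v : ι → G) (s : SimpleFunc B ι) {f : F}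
    (hf : 0 ≤ f) : RCLike.re (hFG.pairing (G.ideal.glue v s) f) = ∑ i ∈ s.range,
      RCLike.re (hFG.pairing (v i) (F.ideal.restrict (s.measurableSet_fiber i) f)) := by
  rw [FunctionIdeal.glue, map_sum, LinearMap.sum_apply, map_sum]
  refine Finset.sum_congr rfl fun i _ => ?_
  rw [hFG.pairing_re _ hf, hFG.pairing_restrict, RCLike.ofReal_re]

-- Testing on f ≥ 0 shows that g is real. Its restriction to {Re g < 0} is ≤ 0, while its pairings
-- with f ≥ 0 are also ≥ 0, since the restriction can be moved to f. So these pairings vanish, and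
-- separation makes the restriction zero.
include hFG in
theorem IsKotheDualPair.nonneg_of_pairing_nonneg {g : G}
    (h : ∀ f : F, 0 ≤ f → 0 ≤ hFG.pairing g f) : 0 ≤ g := by
  have hre : G.ideal.re g = g := hFG.ext_right fun f => by
    refine LinearMap.congr_fun (F.ideal.linearMap_ext_of_nonneg fun f hf => ?_) f
    have h1 := h f hf
    rw [hFG.pairing_re g hf]
    rw [RCLike.nonneg_iff] at h1
    apply RCLike.ext <;> simp [h1.2]
  have hreal : ∀ᵐ b ∂ν, ((RCLike.re (g.val b) : ℝ) : 𝕜) = g.val b := by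
    filter_upwards [G.ideal.coeFn_re g] with b hb
    rw [hre] at hb
    exact hb.symm
  have hs : MeasurableSet {b | RCLike.re (g.val b) < 0} :=
    measurableSet_lt (RCLike.measurable_re.comp (AEEqFun.stronglyMeasurable g.val).measurable)
      measurable_const
  have hord := G.ideal.isOrderedAddMonoid
  have hle : G.ideal.restrict hs g ≤ 0 := by
    rw [G.ideal.le_iff_ae]
    filter_upwards [G.ideal.coeFn_restrict hs g, G.ideal.coeFn_zero, hreal] with b h1 h2 h3
    rw [h1, h2]
    refine Set.indicator_apply_nonpos fun hb => ?_
    change g.val b ≤ 0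
    rw [← h3, ← RCLike.ofReal_zero, RCLike.ofReal_le_ofReal]
    exact le_of_lt hb
  have h0 : G.ideal.restrict hs g = 0 := hFG.ext_right fun f => by
    refine LinearMap.congr_fun (F.ideal.linearMap_ext_of_nonneg fun f hf => ?_) f
    refine le_antisymm (hFG.pairing_mono hle hf) ?_
    rw [hFG.pairing_restrict, map_zero]
    exact h _ (F.ideal.restrict_nonneg hs hf)
  rw [G.ideal.nonneg_iff_ae]
  filter_upwards [G.ideal.coeFn_restrict hs g, G.ideal.coeFn_zero, hreal] with b h1 h2 h3
  rw [h0, h2] at h1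
  change 0 ≤ g.val b
  by_contra hb
  rw [← h3, RCLike.ofReal_nonneg, not_le] at hb
  rw [Set.indicator_of_mem (show b ∈ {b | RCLike.re (g.val b) < 0} from hb)] at h1
  change 0 = g.val b at h1
  rw [← h1, map_zero] at hb
  exact lt_irrefl _ hb

/-- The form of the Riesz–Kantorovich criterion used when suprema are available only for directed
sets: gluings are directed and have the same upper bounds. -/
theorem FunctionIdeal.exists_dominates_of_isLUB_glue
    {E : Type*} [NormedAddCommGroup E] [NormedSpace 𝕜 E] [PartialOrder E] [HasModulus E]
    {H : Type*} [NormedAddCommGroup H] [NormedSpace 𝕜 H] [PartialOrder H] [HasModulus H]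
    (J : FunctionIdeal (𝕜 := 𝕜) μ E) (K : FunctionIdeal (𝕜 := 𝕜) ν H) (T : E →ₗ[𝕜] H)
    (hT : ∀ h : E, 0 ≤ h → ∃ g,
      IsLUB (Set.range (K.glue fun k : {k : E // HasModulus.modulus k ≤ h} => T k)) g) :
    ∃ R : E →ₗ[𝕜] H, Dominates R T := by
  refine J.exists_dominates_of_isLUB K T fun h hh => (hT h hh).imp fun g hg => ?_
  rw [K.isLUB_range_glue_iff] at hg
  convert hg using 1
  ext g'
  constructor
  · rintro ⟨k, hk, rfl⟩
    exact ⟨⟨k, hk⟩, rfl⟩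
  · rintro ⟨⟨k, hk⟩, rfl⟩
    exact ⟨k, hk, rfl⟩

theorem FunctionIdeal.norm_le_of_modulus_le
    {E : Type*} [NormedAddCommGroup E] [NormedSpace 𝕜 E] [PartialOrder E] [HasModulus E]
    (J : FunctionIdeal (𝕜 := 𝕜) μ E) {k h : E} (hk : HasModulus.modulus k ≤ h) : ‖k‖ ≤ ‖h‖ := by
  rw [← J.norm_modulus k]
  exact J.norm_mono_of_le (J.modulus_nonneg k) hk

theorem FunctionIdeal.modulus_zero_le
    {E : Type*} [NormedAddCommGroup E] [NormedSpace 𝕜 E] [PartialOrder E] [HasModulus E]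
    (J : FunctionIdeal (𝕜 := 𝕜) μ E) {h : E} (hh : 0 ≤ h) : HasModulus.modulus (0 : E) ≤ h := by
  rw [J.modulus_le_iff hh]
  filter_upwards [J.coeFn_zero] with a h
  rw [h, norm_zero]
  exact norm_nonneg _

theorem FunctionIdeal.re_zero
    {E : Type*} [NormedAddCommGroup E] [NormedSpace 𝕜 E] [PartialOrder E] [HasModulus E]
    (J : FunctionIdeal (𝕜 := 𝕜) μ E) : J.re 0 = 0 := by
  simpa using J.re_smul 0 0

/-- In a Banach function space with a strong order unit, norm bounded sets are order bounded. -/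
theorem BanachFunctionSpace.HasStrongOrderUnit.exists_modulus_le (hG : G.HasStrongOrderUnit)
    (r : ℝ) : ∃ e : G, ∀ g : G, ‖g‖ ≤ r → HasModulus.modulus g ≤ e := by
  obtain ⟨e, he, hu⟩ := hG
  have hord := G.ideal.isOrderedAddMonoid
  have hmod : ∀ g : G, 0 ≤ g → HasModulus.modulus g = g := fun g hg => G.ideal.ext (by
    filter_upwards [G.ideal.coeFn_modulus g, G.ideal.nonneg_iff_ae.1 hg] with b h1 h2
    rw [h1, RCLike.norm_of_nonneg' h2])
  have hmono : ∀ {c c' : ℝ}, c ≤ c' → (c : 𝕜) • e ≤ (c' : 𝕜) • e := fun {c c'} h => by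
    rw [← sub_nonneg, ← sub_smul, ← RCLike.ofReal_sub]
    exact G.ideal.smul_nonneg (sub_nonneg.2 h) he
  -- The infimum of U g is the gauge of g relative to the order unit. It is monotone and homogeneous
  -- on the cone, hence at most C‖g‖.
  let U : G → Set ℝ := fun g => {c | 0 ≤ c ∧ g ≤ (c : 𝕜) • e}
  have hU : ∀ g, 0 ≤ g → (U g).Nonempty := fun g hg => by
    obtain ⟨c, hc⟩ := hu g
    rw [hmod g hg] at hc
    exact ⟨max c 0, le_max_right _ _, hc.trans (hmono (le_max_left _ _))⟩
  have hUb : ∀ g, BddBelow (U g) := fun g => ⟨0, fun c hc => hc.1⟩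
  obtain ⟨C, hC, h⟩ := exists_bound_of_monotone_homogeneous (𝕜 := 𝕜) {g : G | 0 ≤ g}
    G.ideal.isClosed_nonneg (fun x hx y hy => (add_nonneg (α := G) hx hy : 0 ≤ x + y))
    (fun c hc x hx => G.ideal.smul_nonneg hc hx) (fun g => sInf (U g)) (fun c hc x hx => by
      rcases hc.eq_or_lt with rfl | hc
      · rw [RCLike.ofReal_zero, zero_smul, zero_mul]
        refine le_antisymm (csInf_le (hUb _) ⟨le_rfl, by simp⟩) (Real.sInf_nonneg fun c hc => hc.1)
      · have : U ((c : 𝕜) • x) = c • U x := by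
          ext d
          rw [Set.mem_smul_set_iff_inv_smul_mem₀ hc.ne']
          change (0 ≤ d ∧ (c : 𝕜) • x ≤ (d : 𝕜) • e) ↔
            (0 ≤ c⁻¹ * d ∧ x ≤ ((c⁻¹ * d : ℝ) : 𝕜) • e)
          refine and_congr ?_ ⟨fun h => ?_, fun h => ?_⟩
          · rw [mul_nonneg_iff_of_pos_left (inv_pos.2 hc)]
          · have := G.ideal.smul_le_smul (inv_pos.2 hc).le h
            rwa [smul_smul, smul_smul, ← RCLike.ofReal_mul, ← RCLike.ofReal_mul,
              inv_mul_cancel₀ hc.ne', RCLike.ofReal_one, one_smul] at this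
          · have := G.ideal.smul_le_smul hc.le h
            rwa [smul_smul, ← RCLike.ofReal_mul, mul_inv_cancel_left₀ hc.ne'] at this
        change sInf (U ((c : 𝕜) • x)) = c * sInf (U x)
        rw [this, Real.sInf_smul_of_nonneg hc.le, smul_eq_mul])
    (fun x hx y hy => csInf_le_csInf (hUb _) (hU _ (add_nonneg hx hy))
      fun c hc => ⟨hc.1, (le_add_of_nonneg_right hy).trans hc.2⟩)
  -- The summand 1 leaves room above the infimum, which need not be attained.
  refine ⟨((C * r + 1 : ℝ) : 𝕜) • e, fun g hg => ?_⟩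
  have h1 := h _ (G.ideal.modulus_nonneg g)
  rw [G.ideal.norm_modulus] at h1
  obtain ⟨c, hc, hc'⟩ := exists_lt_of_csInf_lt (hU _ (G.ideal.modulus_nonneg g))
    (show sInf (U (HasModulus.modulus g)) < C * r + 1 by
      have : C * ‖g‖ ≤ C * r := by gcongr
      linarith)
  exact hc.2.trans (hmono hc'.le)

/-- Bounded operators into a Dedekind complete space with strong order unit are dominated. -/
theorem exists_dominates_of_hasStrongOrderUnit (hG : G.IsDedekindComplete)
    (hG' : G.HasStrongOrderUnit) (T : Lp 𝕜 ∞ μ →L[𝕜] G) :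
    ∃ R : Lp 𝕜 ∞ μ →ₗ[𝕜] G, Dominates R (T : Lp 𝕜 ∞ μ →ₗ[𝕜] G) := by
  refine (FunctionIdeal.lp μ ∞).exists_dominates_of_isLUB G.ideal _ fun h hh => hG _ ?_ ?_
  · exact ⟨_, 0, (FunctionIdeal.lp μ ∞).modulus_zero_le hh, rfl⟩
  · obtain ⟨e, he⟩ := hG'.exists_modulus_le (‖T‖ * ‖h‖)
    refine ⟨e, ?_⟩
    rintro _ ⟨k, hk, rfl⟩
    refine le_trans ?_ (he (T k) ?_)
    · rw [G.ideal.le_iff_ae]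
      filter_upwards [G.ideal.coeFn_re (T k), G.ideal.coeFn_modulus (T k)] with b h1 h2
      change G.ideal.val (G.ideal.re (T k)) b ≤ _
      rw [h1, h2, RCLike.ofReal_le_ofReal]
      exact RCLike.re_le_norm _
    · have := (FunctionIdeal.lp μ ∞).norm_le_of_modulus_le hk
      exact (T.le_opNorm k).trans (by gcongr)

/-- In a Banach function space that is lattice isomorphic to an AL-space, the norm is
superadditive on positive elements up to a constant. -/
theorem BanachFunctionSpace.IsLatticeIsomorphicToALSpace.exists_sum_norm_le
    (hF : F.IsLatticeIsomorphicToALSpace) : ∃ C : ℝ, 0 ≤ C ∧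
      ∀ {ι : Type*} (t : Finset ι) (φ : ι → F) (f : F), (∀ i ∈ t, 0 ≤ φ i) →
        ∑ i ∈ t, φ i = f → ∑ i ∈ t, ‖φ i‖ ≤ C * ‖f‖ := by
  obtain ⟨L, iL, Φ, hΦs, hΦm, hΦi, hΦr⟩ := hF
  have hord := F.ideal.isOrderedAddMonoid
  have hpos : ∀ x : L, 0 ≤ x → 0 ≤ Φ x := fun x hx => by
    have := hΦm x
    rw [abs_of_nonneg hx] at this
    rw [this]; exact F.ideal.modulus_nonneg _
  have hmod : ∀ g : F, 0 ≤ g → HasModulus.modulus g = g := fun g hg => F.ideal.ext (by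
    filter_upwards [F.ideal.coeFn_modulus g, F.ideal.nonneg_iff_ae.1 hg] with b h1 h2
    rw [h1, RCLike.norm_of_nonneg' h2])
  have hex : ∀ f : F, ∃ x : L, 0 ≤ f → 0 ≤ x ∧ Φ x = f := fun f => by
    by_cases hf : 0 ≤ f
    · have : f ∈ Set.range Φ := by
        rw [hΦr]
        filter_upwards [F.ideal.nonneg_iff_ae.1 hf] with b hb
        exact (RCLike.nonneg_iff.1 hb).2
      obtain ⟨x, rfl⟩ := this
      refine ⟨x, fun _ => ⟨?_, rfl⟩⟩
      have : |x| = x := hΦi (by rw [hΦm, hmod _ hf])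
      rw [← this]; exact abs_nonneg x
    · exact ⟨0, fun h => absurd h hf⟩
  choose Ψ hΨ using hex
  have hΨadd : ∀ f g, 0 ≤ f → 0 ≤ g → Ψ (f + g) = Ψ f + Ψ g := fun f g hf hg => hΦi (by
    rw [map_add, (hΨ _ (add_nonneg hf hg)).2, (hΨ _ hf).2, (hΨ _ hg).2])
  -- Monotonicity alone bounds Φ and its inverse Ψ on the positive cones, so additivity of the norm
  -- of L passes to F up to the factor C₂C₁.
  obtain ⟨C₁, hC₁, h₁⟩ := exists_bound_of_monotone_homogeneous (𝕜 := 𝕜) {f : F | 0 ≤ f}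
    F.ideal.isClosed_nonneg (fun x hx y hy => (add_nonneg (α := F) hx hy : 0 ≤ x + y))
    (fun c hc x hx => F.ideal.smul_nonneg hc hx) (fun f => ‖Ψ f‖) (fun c hc x hx => by
      have : Ψ ((c : 𝕜) • x) = c • Ψ x := hΦi (by
        rw [(hΨ _ (F.ideal.smul_nonneg hc hx)).2, hΦs, (hΨ _ hx).2])
      rw [this, _root_.norm_smul, Real.norm_of_nonneg hc])
    (fun x hx y hy => by
      have hx' := (hΨ x hx).1
      have hy' := (hΨ y hy).1
      have := norm_le_norm_of_abs_le_abs (a := Ψ x) (b := Ψ x + Ψ y) (by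
        rw [abs_of_nonneg hx', abs_of_nonneg (add_nonneg hx' hy')]
        exact le_add_of_nonneg_right hy')
      rwa [hΨadd x y hx hy])
  obtain ⟨C₂, hC₂, h₂⟩ := exists_bound_of_monotone_homogeneous (𝕜 := ℝ) {x : L | 0 ≤ x}
    isClosed_nonneg (fun x hx y hy => add_nonneg hx hy)
    (fun c hc x hx => smul_nonneg hc hx) (fun x => ‖Φ x‖) (fun c hc x hx => by
      change ‖Φ (c • x)‖ = _
      rw [hΦs, _root_.norm_smul, RCLike.norm_ofReal, abs_of_nonneg hc])
    (fun x hx y hy => F.ideal.norm_mono_of_le (hpos x hx) (by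
      rw [map_add]; exact le_add_of_nonneg_right (hpos y hy)))
  refine ⟨C₂ * C₁, by positivity, fun {ι} t φ f hφ hf => ?_⟩
  have key : ∀ t : Finset ι, (∀ i ∈ t, 0 ≤ φ i) →
      ∑ i ∈ t, ‖Ψ (φ i)‖ = ‖Ψ (∑ i ∈ t, φ i)‖ := fun t => by
    classical
    induction t using Finset.induction_on with
    | empty =>
      intro _
      have : Ψ 0 = 0 := hΦi (by rw [(hΨ 0 le_rfl).2, map_zero])
      simp [this]
    | insert i t hi ih =>
      intro h
      have hi' := h i (Finset.mem_insert_self _ _)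
      have ht' : 0 ≤ ∑ i ∈ t, φ i :=
        Finset.sum_nonneg fun j hj => h j (Finset.mem_insert_of_mem hj)
      rw [Finset.sum_insert hi, Finset.sum_insert hi, hΨadd _ _ hi' ht',
        ALSpace.norm_add_of_nonneg _ _ (hΨ _ hi').1 (hΨ _ ht').1,
        ih fun j hj => h j (Finset.mem_insert_of_mem hj)]
  have hf0 : 0 ≤ f := hf ▸ Finset.sum_nonneg hφ
  calc ∑ i ∈ t, ‖φ i‖ ≤ ∑ i ∈ t, C₂ * ‖Ψ (φ i)‖ := Finset.sum_le_sum fun i hi => by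
        have := h₂ _ (hΨ _ (hφ i hi)).1
        rwa [(hΨ _ (hφ i hi)).2] at this
    _ = C₂ * ‖Ψ f‖ := by rw [← Finset.mul_sum, key t hφ, hf]
    _ ≤ C₂ * (C₁ * ‖f‖) := by gcongr; exact h₁ _ hf0
    _ = C₂ * C₁ * ‖f‖ := by ring

end Dominants

/-! ### Suprema in the dual, dominants in case (ii), and dominants of adjoints -/

section Dominants

variable {𝕜 : Type*} [RCLike 𝕜] {A : Type*} [MeasurableSpace A] {μ : Measure A}
  {B : Type*} [MeasurableSpace B] {ν : Measure B} {F G : BanachFunctionSpace 𝕜 ν}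
  (hFG : IsKotheDualPair F G)

/-- Bounded directed sets of positive functionals have suprema in the dual. -/
theorem FunctionIdeal.exists_isLUB_dual
    {E : Type*} [NormedAddCommGroup E] [NormedSpace 𝕜 E] [PartialOrder E] [HasModulus E]
    (J : FunctionIdeal (𝕜 := 𝕜) μ E) (D : Set (StrongDual 𝕜 E)) (hne : D.Nonempty)
    (hdir : ∀ φ ∈ D, ∀ ψ ∈ D, ∃ χ ∈ D, ∀ f, 0 ≤ f → φ f ≤ χ f ∧ ψ f ≤ χ f)
    (hpos : ∀ φ ∈ D, ∀ f, 0 ≤ f → 0 ≤ φ f) (M : ℝ)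
    (hM : ∀ φ ∈ D, ∀ f, 0 ≤ f → RCLike.re (φ f) ≤ M * ‖f‖) :
    ∃ ψ : StrongDual 𝕜 E, ∀ f, 0 ≤ f → IsLUB ((fun φ : StrongDual 𝕜 E => φ f) '' D) (ψ f) := by
  have hord := J.isOrderedAddMonoid
  let V : E → Set ℝ := fun f => (fun φ : StrongDual 𝕜 E => RCLike.re (φ f)) '' D
  have hVne : ∀ f, (V f).Nonempty := fun f => hne.image _
  have hVb : ∀ f, 0 ≤ f → BddAbove (V f) := fun f hf => ⟨M * ‖f‖, by
    rintro _ ⟨φ, hφ, rfl⟩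
    exact hM φ hφ f hf⟩
  -- The supremum is computed pointwise on the cone. Directedness gives q x + q y ≤ q (x + y), since
  -- two functionals can be replaced by a common larger one.
  let q : E → ℝ := fun f => sSup (V f)
  have hle : ∀ f, 0 ≤ f → ∀ φ ∈ D, RCLike.re (φ f) ≤ q f := fun f hf φ hφ =>
    le_csSup (hVb f hf) ⟨φ, hφ, rfl⟩
  have hadd : ∀ x y, 0 ≤ x → 0 ≤ y → q (x + y) = q x + q y := by
    intro x y hx hy
    apply le_antisymm
    · refine csSup_le (hVne _) ?_
      rintro _ ⟨φ, hφ, rfl⟩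
      simp only [map_add]
      exact add_le_add (hle x hx φ hφ) (hle y hy φ hφ)
    · rw [← le_sub_iff_add_le]
      refine csSup_le (hVne _) ?_
      rintro _ ⟨φ, hφ, rfl⟩
      rw [le_sub_comm]
      refine csSup_le (hVne _) ?_
      rintro _ ⟨φ', hφ', rfl⟩
      simp only
      rw [le_sub_iff_add_le']
      obtain ⟨χ, hχ, h⟩ := hdir φ hφ φ' hφ'
      refine le_trans ?_ (hle (x + y) (add_nonneg hx hy) χ hχ)
      rw [map_add, map_add]
      exact add_le_add (RCLike.re_le_re (h x hx).1) (RCLike.re_le_re (h y hy).2)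
  have hsmul : ∀ (c : ℝ) x, 0 ≤ c → 0 ≤ x → q ((c : 𝕜) • x) = c * q x := by
    intro c x hc _
    change sSup (V ((c : 𝕜) • x)) = c • sSup (V x)
    rw [← Real.sSup_smul_of_nonneg hc]
    congr 1
    ext r
    simp [V, Set.mem_smul_set]
  obtain ⟨R, hR⟩ := J.exists_linearMap_of_additive_on_cone (fun f => ((q f : ℝ) : 𝕜))
    (fun x y hx hy => by simp only [hadd x y hx hy, RCLike.ofReal_add])
    (fun c x hc hx => by simp only [hsmul c x hc hx, RCLike.ofReal_mul, smul_eq_mul])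
  have hq0 : ∀ f, 0 ≤ f → 0 ≤ q f := fun f hf => by
    obtain ⟨φ, hφ⟩ := hne
    exact (RCLike.nonneg_iff.1 (hpos φ hφ f hf)).1.trans (hle f hf φ hφ)
  have hqM : ∀ f, 0 ≤ f → q f ≤ M * ‖f‖ := fun f hf => csSup_le (hVne f) (by
    rintro _ ⟨φ, hφ, rfl⟩
    exact hM φ hφ f hf)
  have hbd : ∀ e, ‖R e‖ ≤ 4 * |M| * ‖e‖ := fun e => by
    obtain ⟨a, b, c, d, ha, hb, hc, hd, he, ha', hb', hc', hd'⟩ := J.exists_decomposition e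
    have hx : ∀ x, 0 ≤ x → ‖x‖ ≤ ‖e‖ → ‖R x‖ ≤ |M| * ‖e‖ := fun x hx hx' => by
      rw [hR x hx, RCLike.norm_ofReal, abs_of_nonneg (hq0 x hx)]
      exact (hqM x hx).trans (by gcongr; exact le_abs_self M)
    have h1 : R e = R a - R b + (RCLike.I : 𝕜) • (R c - R d) := by
      conv_lhs => rw [he]
      simp
    have hI : ‖(RCLike.I : 𝕜)‖ ≤ 1 := by rw [RCLike.norm_I]; split_ifs <;> norm_num
    rw [h1]
    calc _ ≤ ‖R a‖ + ‖R b‖ + 1 * (‖R c‖ + ‖R d‖) := by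
          refine (norm_add_le _ _).trans (add_le_add (norm_sub_le _ _) ?_)
          rw [norm_smul]
          gcongr
          exact norm_sub_le _ _
      _ ≤ _ := by linarith [hx a ha ha', hx b hb hb', hx c hc hc', hx d hd hd']
  refine ⟨R.mkContinuous _ hbd, fun f hf => ?_⟩
  have hreal : ∀ φ ∈ D, φ f = ((RCLike.re (φ f) : ℝ) : 𝕜) := fun φ hφ => by
    have := RCLike.nonneg_iff.1 (hpos φ hφ f hf)
    apply RCLike.ext <;> simp [this.2]
  rw [LinearMap.mkContinuous_apply, hR f hf]
  constructor
  · rintro _ ⟨φ, hφ, rfl⟩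
    simp only
    rw [hreal φ hφ, RCLike.ofReal_le_ofReal]
    exact hle f hf φ hφ
  · intro z hz
    -- In the order of 𝕜, lying above a nonnegative number forces z to be real, so it can be
    -- compared with a real supremum.
    have hz' : 0 ≤ z := by
      obtain ⟨φ, hφ⟩ := hne
      exact (hpos φ hφ f hf).trans (hz ⟨φ, hφ, rfl⟩)
    rw [← RCLike.norm_of_nonneg' hz', RCLike.ofReal_le_ofReal]
    refine csSup_le (hVne f) ?_
    rintro _ ⟨φ, hφ, rfl⟩
    have := hz ⟨φ, hφ, rfl⟩
    simp only at this
    rwa [hreal φ hφ, ← RCLike.norm_of_nonneg' hz', RCLike.ofReal_le_ofReal] at this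

/-- If `G` is a band in `F*` and `F` is lattice isomorphic to an AL-space then operators with an
adjoint are dominated. -/
theorem IsKotheDualPair.exists_dominates_of_isDualBand
    (hG : BanachFunctionSpace.IsDualBand (LinearMap.range hFG.toDual))
    (hF : F.IsLatticeIsomorphicToALSpace) (T : Lp 𝕜 ∞ μ →ₗ[𝕜] G) (S : F →L[𝕜] Lp 𝕜 1 μ)
    (hS : IsAdjoint (linftyPairing μ (ContinuousLinearMap.mul 𝕜 𝕜)) hFG.pairing T
      (S : F →ₗ[𝕜] Lp 𝕜 1 μ)) :
    ∃ R : Lp 𝕜 ∞ μ →ₗ[𝕜] G, Dominates R T := by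
  obtain ⟨C, hC, hsum⟩ := hF.exists_sum_norm_le
  obtain ⟨C', hC', hpair⟩ := norm_linftyPairing_le (𝕜 := 𝕜) (μ := μ) (ContinuousLinearMap.mul 𝕜 𝕜)
  refine FunctionIdeal.exists_dominates_of_isLUB_glue (FunctionIdeal.lp μ ∞) G.ideal T
    fun h hh => ?_
  set v : {k : Lp 𝕜 ∞ μ // HasModulus.modulus k ≤ h} → G := fun k => T k with hv
  -- The band property concerns positive families. Keeping only positive gluings loses nothing: 0 is
  -- itself a gluing, so every gluing lies below a positive one.
  let W : Set G := {w | 0 ≤ w ∧ w ∈ Set.range (G.ideal.glue v)}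
  have h0 : G.ideal.glue v (SimpleFunc.const B
      ⟨0, (FunctionIdeal.lp μ ∞).modulus_zero_le hh⟩) = 0 := by
    rw [FunctionIdeal.glue_const, hv]
    simp only [map_zero]
    exact G.ideal.re_zero
  have hWne : W.Nonempty := ⟨0, le_rfl, _, h0⟩
  -- The AL property makes this bound independent of the number of pieces: the norms of the
  -- restrictions of f to the fibres of s add up to at most C‖f‖.
  have hbound : ∀ s, ∀ f : F, 0 ≤ f →
      RCLike.re (hFG.pairing (G.ideal.glue v s) f) ≤ C' * ‖h‖ * ‖S‖ * C * ‖f‖ := fun s f hf => by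
    rw [hFG.re_pairing_glue v s hf]
    calc _ ≤ ∑ i ∈ s.range, C' * ‖h‖ * ‖S‖ * ‖F.ideal.restrict (s.measurableSet_fiber i) f‖ := by
          refine Finset.sum_le_sum fun i _ => (RCLike.re_le_norm _).trans ?_
          rw [hv]
          simp only
          rw [hS]
          refine (hpair _ _).trans ?_
          have h1 := (FunctionIdeal.lp μ ∞).norm_le_of_modulus_le i.2
          have h2 := S.le_opNorm (F.ideal.restrict (s.measurableSet_fiber i) f)
          rw [mul_assoc (C' * ‖h‖)]
          exact mul_le_mul (mul_le_mul_of_nonneg_left h1 hC') h2 (norm_nonneg _) (by positivity)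
      _ ≤ _ := by
        rw [← Finset.mul_sum, mul_assoc (C' * ‖h‖ * ‖S‖)]
        refine mul_le_mul_of_nonneg_left ?_ (by positivity)
        exact hsum _ _ _ (fun i _ => F.ideal.restrict_nonneg _ hf) (F.ideal.sum_restrict s f)
  have hWdir : ∀ w ∈ W, ∀ w' ∈ W, ∃ r ∈ W, w ≤ r ∧ w' ≤ r := by
    rintro _ ⟨hw, s, rfl⟩ _ ⟨-, t, rfl⟩
    obtain ⟨r, h1, h2⟩ := G.ideal.glue_directed v s t
    exact ⟨_, ⟨hw.trans h1, r, rfl⟩, h1, h2⟩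
  let D : Set (StrongDual 𝕜 F) := hFG.toDual '' W
  have hDdir : ∀ φ ∈ D, ∀ ψ ∈ D, ∃ χ ∈ D, ∀ f, 0 ≤ f → φ f ≤ χ f ∧ ψ f ≤ χ f := by
    rintro _ ⟨w, hw, rfl⟩ _ ⟨w', hw', rfl⟩
    obtain ⟨r, hr, h1, h2⟩ := hWdir w hw w' hw'
    exact ⟨_, ⟨r, hr, rfl⟩, fun f hf => ⟨hFG.pairing_mono h1 hf, hFG.pairing_mono h2 hf⟩⟩
  have hDpos : ∀ φ ∈ D, ∀ f, 0 ≤ f → 0 ≤ φ f := by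
    rintro _ ⟨w, hw, rfl⟩ f hf
    exact hFG.pairing_nonneg hw.1 hf
  obtain ⟨ψ, hψ⟩ := F.ideal.exists_isLUB_dual D (hWne.image _) hDdir hDpos
    (C' * ‖h‖ * ‖S‖ * C) (by
      rintro _ ⟨w, ⟨-, s, rfl⟩, rfl⟩ f hf
      exact hbound s f hf)
  have hmem : ψ ∈ LinearMap.range hFG.toDual := by
    refine hG.sup_mem D ?_ (hWne.image _) ?_ ?_ ψ ?_ ?_
    · rintro _ ⟨w, -, rfl⟩
      exact ⟨w, rfl⟩
    · intro φ hφ φ' hφ'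
      obtain ⟨χ, hχ, h⟩ := hDdir φ hφ φ' hφ'
      exact ⟨χ, hχ, fun f hf => (h f hf).1, fun f hf => (h f hf).2⟩
    · exact fun φ hφ f hf => hDpos φ hφ f hf
    · exact fun φ hφ f hf => (hψ f hf).1 ⟨φ, hφ, rfl⟩
    · intro χ hχ f hf
      refine (hψ f hf).2 ?_
      rintro _ ⟨φ, hφ, rfl⟩
      exact hχ φ hφ f hf
  obtain ⟨g, rfl⟩ := hmem
  have hord := G.ideal.isOrderedAddMonoid
  have hle : ∀ g₁ g₂ : G, (∀ f : F, 0 ≤ f → hFG.pairing g₁ f ≤ hFG.pairing g₂ f) → g₁ ≤ g₂ :=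
    fun g₁ g₂ h => by
      rw [← sub_nonneg]
      refine hFG.nonneg_of_pairing_nonneg fun f hf => ?_
      rw [map_sub, LinearMap.sub_apply]
      exact sub_nonneg.2 (h f hf)
  refine ⟨g, ?_, fun g' hg' => ?_⟩
  · rintro _ ⟨s, rfl⟩
    obtain ⟨r, h1, h2⟩ := G.ideal.glue_directed v s (SimpleFunc.const B
      ⟨0, (FunctionIdeal.lp μ ∞).modulus_zero_le hh⟩)
    rw [h0] at h2
    exact h1.trans (hle _ _ fun f hf => (hψ f hf).1 ⟨_, ⟨_, ⟨h2, r, rfl⟩, rfl⟩, rfl⟩)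
  · refine hle _ _ fun f hf => (hψ f hf).2 ?_
    rintro _ ⟨_, ⟨w, hw, rfl⟩, rfl⟩
    exact hFG.pairing_mono (hg' hw.2) hf

/-- If an operator `L^∞ → G` is dominated, then so is its adjoint. -/
theorem IsKotheDualPair.exists_dominates_adjoint (T R : Lp 𝕜 ∞ μ →ₗ[𝕜] G) (hR : Dominates R T)
    (S : F →ₗ[𝕜] Lp 𝕜 1 μ)
    (hS : IsAdjoint (linftyPairing μ (ContinuousLinearMap.mul 𝕜 𝕜)) hFG.pairing T S) :
    ∃ Q : F →ₗ[𝕜] Lp 𝕜 1 μ, Dominates Q S := by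
  let J : FunctionIdeal (𝕜 := 𝕜) μ (Lp 𝕜 ∞ μ) := FunctionIdeal.lp μ ∞
  let K : FunctionIdeal (𝕜 := 𝕜) μ (Lp 𝕜 1 μ) := FunctionIdeal.lp μ 1
  have hone : 0 ≤ linftyOne 𝕜 μ := by
    rw [J.nonneg_iff_ae]
    filter_upwards [coeFn_linftyOne (𝕜 := 𝕜) (μ := μ)] with a h
    change 0 ≤ linftyOne 𝕜 μ a
    rw [h]; exact zero_le_one
  refine FunctionIdeal.exists_dominates_of_isLUB_glue F.ideal K S fun f hf => ?_
  set v : {k : F // HasModulus.modulus k ≤ f} → Lp 𝕜 1 μ := fun k => S k with hv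
  have hest : ∀ (k : F) (e : Lp 𝕜 ∞ μ), HasModulus.modulus k ≤ f → 0 ≤ e →
      RCLike.re (hFG.pairing (T e) k) ≤ RCLike.re (hFG.pairing (R e) f) := fun k e hk he => by
    have hRe := hR.1 e he
    have h1 := hR.2 e
    have he' : HasModulus.modulus e = e := J.ext (by
      filter_upwards [J.coeFn_modulus e, J.nonneg_iff_ae.1 he] with a h1 h2
      rw [h1, RCLike.norm_of_nonneg' h2])
    rw [he', G.ideal.modulus_le_iff hRe] at h1
    rw [F.ideal.modulus_le_iff hf] at hk
    refine (RCLike.re_le_norm _).trans ?_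
    have h2 : RCLike.re (hFG.pairing (R e) f) = ∫ b, ‖f.val b * (R e).val b‖ ∂ν := by
      rw [hFG.pairing_apply, ← integral_re (hFG.integrable f (R e))]
      refine integral_congr_ae ?_
      filter_upwards [G.ideal.nonneg_iff_ae.1 hRe, F.ideal.nonneg_iff_ae.1 hf] with b h1 h2
      have := RCLike.norm_of_nonneg' (mul_nonneg h2 h1)
      change RCLike.re (F.ideal.val f b * G.ideal.val (R e) b) =
        ‖F.ideal.val f b * G.ideal.val (R e) b‖
      rw [← this, RCLike.ofReal_re, this]
    rw [h2, hFG.pairing_apply]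
    refine (norm_integral_le_integral_norm _).trans
      (integral_mono_ae (hFG.integrable k (T e)).norm (hFG.integrable f (R e)).norm ?_)
    filter_upwards [h1, hk] with b h1 h2
    simp only [norm_mul]
    exact mul_le_mul h2 h1 (norm_nonneg _) (norm_nonneg _)
  -- ℓ is the real part of the integral. On the positive cone of L¹ it equals the norm, as required
  -- by `exists_isLUB_of_directedOn`.
  let ℓ : Lp 𝕜 1 μ → ℝ := fun u =>
    RCLike.re (linftyPairing μ (ContinuousLinearMap.mul 𝕜 𝕜) (linftyOne 𝕜 μ) u)
  have hℓ : ∀ u, ℓ u = RCLike.re (∫ a, u a ∂μ) := fun u => by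
    change RCLike.re (linftyPairing μ _ _ _) = _
    rw [linftyPairing_mul_apply]
    congr 1
    refine integral_congr_ae ?_
    filter_upwards [coeFn_linftyOne (𝕜 := 𝕜) (μ := μ)] with a h
    rw [h, mul_one]
  have hord := K.isOrderedAddMonoid
  refine K.exists_isLUB_of_directedOn ℓ (fun x y hxy => ?_) _ ⟨_, SimpleFunc.const A
    ⟨0, F.ideal.modulus_zero_le hf⟩, rfl⟩ ?_ ⟨RCLike.re (hFG.pairing (R (linftyOne 𝕜 μ)) f), ?_⟩
  · have h1 : ℓ y - ℓ x = ℓ (y - x) := by simp only [ℓ, map_sub]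
    rw [h1, hℓ, L1.norm_eq_integral_norm, ← integral_re (L1.integrable_coeFn _)]
    refine integral_congr_ae ?_
    filter_upwards [K.nonneg_iff_ae.1 (sub_nonneg.2 hxy)] with a h
    have := RCLike.norm_of_nonneg' h
    change ‖K.val (y - x) a‖ = RCLike.re (K.val (y - x) a)
    rw [← this, RCLike.ofReal_re, this]
  · rintro _ ⟨s, rfl⟩ _ ⟨t, rfl⟩
    obtain ⟨r, h1, h2⟩ := K.glue_directed v s t
    exact ⟨_, ⟨r, rfl⟩, h1, h2⟩
  · rintro _ ⟨_, ⟨s, rfl⟩, rfl⟩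
    -- The adjoint relation turns the integral of Sk over a fibre into the pairing of T(indicator of
    -- the fibre) with k. By `hest` each term is bounded by the same pairing with R and f, and the
    -- indicators add up to 1.
    have h1 : ℓ (K.glue v s) = ∑ i ∈ s.range,
        RCLike.re (hFG.pairing (T (J.restrict (s.measurableSet_fiber i) (linftyOne 𝕜 μ))) i) := by
      simp only [ℓ]
      rw [FunctionIdeal.glue, map_sum, map_sum]
      refine Finset.sum_congr rfl fun i _ => ?_
      rw [hS]
      change ℓ _ = _
      have hs := s.measurableSet_fiber i
      rw [hℓ, ← integral_re (L1.integrable_coeFn _)]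
      have h2 : linftyPairing μ (ContinuousLinearMap.mul 𝕜 𝕜) (J.restrict hs (linftyOne 𝕜 μ))
          (S i) = ∫ a, (K.restrict hs (S i) : Lp 𝕜 1 μ) a ∂μ := by
        rw [linftyPairing_mul_apply]
        refine integral_congr_ae ?_
        filter_upwards [coeFn_linftyIndicator (𝕜 := 𝕜) (μ := μ) hs,
          K.coeFn_restrict hs (S i)] with a h1 h2
        refine Eq.trans ?_ h2.symm
        change (S i) a * linftyIndicator 𝕜 μ hs a = _
        rw [h1]
        by_cases h : a ∈ s ⁻¹' {i}
        · rw [Set.indicator_of_mem h, Set.indicator_of_mem h, Pi.one_apply, mul_one]; rfl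
        · rw [Set.indicator_of_notMem h, Set.indicator_of_notMem h, mul_zero]
      rw [h2, ← integral_re (L1.integrable_coeFn _)]
      refine integral_congr_ae ?_
      filter_upwards [K.coeFn_re (K.restrict hs (S i))] with a h
      change RCLike.re (K.val _ a) = _
      rw [h, RCLike.ofReal_re]
      rfl
    rw [h1]
    calc _ ≤ ∑ i ∈ s.range, RCLike.re (hFG.pairing
          (R (J.restrict (s.measurableSet_fiber i) (linftyOne 𝕜 μ))) f) :=
          Finset.sum_le_sum fun i _ => hest _ _ i.2 (J.restrict_nonneg _ hone)
      _ = _ := by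
        rw [← map_sum, ← LinearMap.sum_apply, ← map_sum, ← map_sum, J.sum_restrict]

end Dominants

/-! ### The extension `T_Y` -/

section Separation

variable {𝕜 : Type*} [RCLike 𝕜]

/-- A strongly measurable function that vanishes a.e. under each functional of a separating family
vanishes a.e. -/
theorem ae_eq_zero_of_separating {B : Type*} [MeasurableSpace B] {ν : Measure B}
    {ι Y : Type*} [NormedAddCommGroup Y] [NormedSpace 𝕜 Y] (φ : ι → Y →L[𝕜] 𝕜)
    (hφ : ∀ y, (∀ i, φ i y = 0) → y = 0) (g : B → Y) (hg : StronglyMeasurable g)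
    (h : ∀ i, ∀ᵐ b ∂ν, φ i (g b) = 0) : ∀ᵐ b ∂ν, g b = 0 := by
  have hsep : TopologicalSpace.SeparableSpace (Set.range g) :=
    hg.isSeparable_range.separableSpace
  have hsec : SecondCountableTopology (Set.range g) :=
    UniformSpace.secondCountable_of_separable _
  -- The range of g is second countable, so countably many of the open sets {φ i ≠ 0} cover their
  -- whole union; only countably many null sets have to be discarded.
  obtain ⟨I, hI, hIU⟩ := TopologicalSpace.isOpen_iUnion_countable
    (fun i => {z : Set.range g | φ i z ≠ 0})
    (fun i => isOpen_ne_fun ((φ i).continuous.comp continuous_subtype_val) continuous_const)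
  filter_upwards [(ae_ball_iff hI).2 fun i _ => h i] with b hb
  by_contra hne
  obtain ⟨i, hi⟩ : ∃ i, φ i (g b) ≠ 0 := by
    by_contra! hcon
    exact hne (hφ _ hcon)
  have hmem : (⟨g b, b, rfl⟩ : Set.range g) ∈ ⋃ i ∈ I, {z : Set.range g | φ i z ≠ 0} := by
    rw [hIU]
    exact Set.mem_iUnion.2 ⟨i, hi⟩
  obtain ⟨j, hj, hj'⟩ := Set.mem_iUnion₂.1 hmem
  exact hj' (hb j hj)

/-- A pointwise bound on all functionals of norm at most one bounds the norm a.e. -/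
theorem ae_norm_le_of_forall_dual {B : Type*} [MeasurableSpace B] {ν : Measure B}
    {X : Type*} [NormedAddCommGroup X] [NormedSpace 𝕜 X] (g : B → X) (hg : StronglyMeasurable g)
    (ρ : B → ℝ) (h : ∀ φ : StrongDual 𝕜 X, ‖φ‖ ≤ 1 → ∀ᵐ b ∂ν, ‖φ (g b)‖ ≤ ρ b) :
    ∀ᵐ b ∂ν, ‖g b‖ ≤ ρ b := by
  obtain ⟨c, hc, hgc⟩ := hg.isSeparable_range
  -- Norming functionals at the points of a countable set whose closure contains the range suffice,
  -- with an arbitrarily small approximation error.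
  choose φ hφ1 hφ2 using fun x : X => exists_dual_vector'' 𝕜 x
  filter_upwards [(ae_ball_iff hc).2 fun x _ => h (φ x) (hφ1 x)] with b hb
  refine le_of_forall_pos_le_add fun ε hε => ?_
  obtain ⟨z, hz, hzd⟩ := Metric.mem_closure_iff.1 (hgc ⟨b, rfl⟩) (ε / 2) (by positivity)
  rw [dist_eq_norm] at hzd
  have h1 : ‖z‖ ≤ ‖φ z (g b)‖ + ‖g b - z‖ := by
    have h2 : φ z z = φ z (g b) - φ z (g b - z) := by rw [map_sub]; ring
    have h3 : ‖φ z z‖ = ‖z‖ := by rw [hφ2, RCLike.norm_ofReal, abs_of_nonneg (norm_nonneg _)]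
    rw [← h3, h2]
    refine (norm_sub_le _ _).trans ?_
    gcongr
    exact ((φ z).le_opNorm _).trans (mul_le_of_le_one_left (norm_nonneg _) (hφ1 z))
  have h4 : ‖g b‖ ≤ ‖z‖ + ‖g b - z‖ := by
    have := norm_add_le z (g b - z)
    rwa [add_sub_cancel] at this
  linarith [hb z hz]

end Separation

section Lifting

variable {𝕜 : Type*} [RCLike 𝕜] {A : Type*} [MeasurableSpace A] {μ : Measure A}
  {B : Type*} [MeasurableSpace B] {ν : Measure B} {F G : BanachFunctionSpace 𝕜 ν}
  {X Y : Type*} [NormedAddCommGroup X] [NormedSpace 𝕜 X]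
  [NormedAddCommGroup Y] [NormedSpace 𝕜 Y]

/-- `g` is a candidate for `T_Y e`, i.e. `⟨x, g⟩ = T ⟨x, e⟩` for all `x`. -/
def IsLift (T : Lp 𝕜 ∞ μ →ₗ[𝕜] G) (β : X →L[𝕜] Y →L[𝕜] 𝕜) (e : Lp Y ∞ μ) (g : B →ₘ[ν] Y) :
    Prop :=
  ∀ x, ∀ᵐ b ∂ν, β x (g b) = (T ((β x).compLp e)).val b

theorem coeFn_lpTmul {p : ℝ≥0∞} (h : Lp 𝕜 p μ) (y : Y) : ∀ᵐ a ∂μ, lpTmul h y a = h a • y :=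
  ContinuousLinearMap.coeFn_compLp _ _

theorem compLp_lpTmul (β : X →L[𝕜] Y →L[𝕜] 𝕜) (x : X) (h : Lp 𝕜 ∞ μ) (y : Y) :
    (β x).compLp (lpTmul h y) = β x y • h := by
  refine Lp.ext ?_
  filter_upwards [(β x).coeFn_compLp (lpTmul h y), coeFn_lpTmul h y,
    Lp.coeFn_smul (β x y) h] with a h1 h2 h3
  rw [h1, h2, h3, map_smul, Pi.smul_apply, smul_eq_mul, smul_eq_mul, mul_comm]

theorem isLift_tensor (T : Lp 𝕜 ∞ μ →ₗ[𝕜] G) (β : X →L[𝕜] Y →L[𝕜] 𝕜) (h : Lp 𝕜 ∞ μ) (y : Y) :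
    IsLift T β (lpTmul h y) ((T h).val.tensor y) := fun x => by
  filter_upwards [AEEqFun.coeFn_tensor (T h).val y, (T h).coeFn_smul (β x y)] with b h1 h2
  rw [compLp_lpTmul, map_smul, h1, h2, map_smul, smul_eq_mul, smul_eq_mul, mul_comm]

/-- Lifts can be summed. -/
theorem IsKotheDualPair.exists_isLift_of_series [CompleteSpace Y] (hFG : IsKotheDualPair F G)
    (T : Lp 𝕜 ∞ μ →ₗ[𝕜] G) (S : F →ₗ[𝕜] Lp 𝕜 1 μ)
    (hS : IsAdjoint (linftyPairing μ (ContinuousLinearMap.mul 𝕜 𝕜)) hFG.pairing T S)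
    (β : X →L[𝕜] Y →L[𝕜] 𝕜) (e : ℕ → Lp Y ∞ μ) (e' : Lp Y ∞ μ) (g : ℕ → B →ₘ[ν] Y)
    (hg : ∀ n, IsLift T β (e n) (g n)) (ρ : G)
    (hρ : ∀ N, ∀ᵐ b ∂ν, ∑ n ∈ Finset.range N, ‖g n b‖ ≤ ‖ρ.val b‖) (M : ℝ)
    (hM : ∀ N, ∀ᵐ a ∂μ, ‖∑ n ∈ Finset.range N, e n a‖ ≤ M)
    (hlim : ∀ᵐ a ∂μ, Tendsto (fun N => ∑ n ∈ Finset.range N, e n a) atTop (𝓝 (e' a))) :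
    ∃ g' : B →ₘ[ν] Y, (∀ᵐ b ∂ν, ‖g' b‖ ≤ ‖ρ.val b‖) ∧ IsLift T β e' g' := by
  have hsum : ∀ᵐ b ∂ν, Tendsto (fun N => ∑ n ∈ Finset.range N, g n b) atTop
      (𝓝 (∑' n, g n b)) := by
    filter_upwards [ae_all_iff.2 hρ] with b hb
    exact (Summable.of_norm (summable_of_sum_range_le (fun n => norm_nonneg _)
      hb)).hasSum.tendsto_sum_nat
  have hmeas : AEStronglyMeasurable (fun b => ∑' n, g n b) ν :=
    aestronglyMeasurable_of_tendsto_ae atTop (f := fun N b => ∑ n ∈ Finset.range N, g n b)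
      (fun N => Finset.aestronglyMeasurable_fun_sum _ fun n _ =>
        AEEqFun.aestronglyMeasurable (g n)) hsum
  have hmk := AEEqFun.coeFn_mk _ hmeas
  have hsum' : ∀ᵐ b ∂ν, Tendsto (fun N => ∑ n ∈ Finset.range N, g n b) atTop
      (𝓝 (AEEqFun.mk _ hmeas b)) := by
    filter_upwards [hsum, hmk] with b h1 h2
    rwa [h2]
  have hnorm : ∀ᵐ b ∂ν, ‖AEEqFun.mk _ hmeas b‖ ≤ ‖ρ.val b‖ := by
    filter_upwards [hsum', ae_all_iff.2 hρ] with b h1 h2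
    exact le_of_tendsto' h1.norm fun N => (norm_sum_le _ _).trans (h2 N)
  refine ⟨AEEqFun.mk _ hmeas, hnorm, fun x => ?_⟩
  -- Domination by ‖β x‖·ρ places the function ⟨x, g'⟩ in G, so it can be compared with T⟨x, e'⟩ by
  -- pairing with F.
  have hρx := ρ.coeFn_smul ((‖β x‖ : ℝ) : 𝕜)
  obtain ⟨γ, hγ⟩ := G.ideal.exists_ae_eq (fun b => β x (AEEqFun.mk _ hmeas b))
    ((β x).continuous.comp_aestronglyMeasurable (AEEqFun.aestronglyMeasurable _))
    (((‖β x‖ : ℝ) : 𝕜) • ρ) (by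
      filter_upwards [hnorm, hρx] with b h1 h2
      change _ ≤ ‖(((‖β x‖ : ℝ) : 𝕜) • ρ).val b‖
      rw [h2, norm_smul, RCLike.norm_ofReal, abs_of_nonneg (norm_nonneg _)]
      exact ((β x).le_opNorm _).trans (by gcongr))
  change ∀ᵐ b ∂ν, γ.val b = _ at hγ
  suffices γ = T ((β x).compLp e') by
    rw [← this]
    filter_upwards [hγ] with b h using h.symm
  -- T itself need not respect bounded a.e. convergence, but its adjoint moves the limit to A.
  -- Dominated convergence applies there with majorant ‖β x‖M|Sf|, and on B with majorant ‖β x‖|fρ|;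
  -- the partial sums agree by linearity.
  refine hFG.ext_right fun f => ?_
  rw [hS, linftyPairing_mul_apply, hFG.pairing_apply]
  have hlim1 : Tendsto (fun N => ∫ b, f.val b * ∑ n ∈ Finset.range N, β x (g n b) ∂ν) atTop
      (𝓝 (∫ b, f.val b * γ.val b ∂ν)) := by
    refine tendsto_integral_of_dominated_convergence
      (fun b => ‖β x‖ * ‖f.val b * ρ.val b‖) (fun N => ?_)
      ((hFG.integrable f ρ).norm.const_mul _) (fun N => ?_) ?_
    · exact (AEEqFun.aestronglyMeasurable _).mul (Finset.aestronglyMeasurable_fun_sum _ fun n _ =>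
        (β x).continuous.comp_aestronglyMeasurable (AEEqFun.aestronglyMeasurable (g n)))
    · filter_upwards [hρ N] with b h1
      rw [← map_sum, norm_mul, norm_mul, mul_left_comm]
      gcongr
      refine ((β x).le_opNorm _).trans ?_
      gcongr
      exact (norm_sum_le _ _).trans h1
    · filter_upwards [hsum', hγ] with b h1 h2
      rw [h2]
      simp_rw [← map_sum]
      exact (((β x).continuous.tendsto _).comp h1).const_mul _
  have hlim2 : Tendsto (fun N => ∫ a, (S f) a * β x (∑ n ∈ Finset.range N, e n a) ∂μ) atTop
      (𝓝 (∫ a, (S f) a * (β x).compLp e' a ∂μ)) := by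
    refine tendsto_integral_of_dominated_convergence
      (fun a => ‖(S f) a‖ * (‖β x‖ * M)) (fun N => ?_)
      ((L1.integrable_coeFn (S f)).norm.mul_const _) (fun N => ?_) ?_
    · exact (Lp.aestronglyMeasurable _).mul ((β x).continuous.comp_aestronglyMeasurable
        (Finset.aestronglyMeasurable_fun_sum _ fun n _ => Lp.aestronglyMeasurable (e n)))
    · filter_upwards [hM N] with a h1
      rw [norm_mul]
      gcongr
      exact ((β x).le_opNorm _).trans (by gcongr)
    · filter_upwards [hlim, (β x).coeFn_compLp e'] with a h1 h2
      rw [h2]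
      exact (((β x).continuous.tendsto _).comp h1).const_mul _
  refine tendsto_nhds_unique hlim1 (hlim2.congr fun N => ?_)
  have h1 : ∫ a, (S f) a * β x (∑ n ∈ Finset.range N, e n a) ∂μ =
      linftyPairing μ (ContinuousLinearMap.mul 𝕜 𝕜)
        (∑ n ∈ Finset.range N, (β x).compLp (e n)) (S f) := by
    rw [linftyPairing_mul_apply]
    refine integral_congr_ae ?_
    filter_upwards [Lp.coeFn_fun_finsetSum (Finset.range N) fun n => (β x).compLp (e n),
      ae_all_iff.2 fun n => (β x).coeFn_compLp (e n)] with a h1 h2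
    rw [h1, map_sum]
    simp_rw [h2]
  rw [h1, ← hS, map_sum, hFG.pairing_apply]
  refine integral_congr_ae ?_
  filter_upwards [G.ideal.coeFn_sum (Finset.range N) fun n => T ((β x).compLp (e n)),
    ae_all_iff.2 fun n => hg n x] with b h1 h2
  change _ * G.ideal.val _ b = _
  rw [h1]
  simp_rw [h2]
  rfl

/-- The functions in `L^∞(A; Y)` with countably many values. -/
def countablyValued (μ : Measure A) (Y : Type*) [NormedAddCommGroup Y] :
    AddSubgroup (Lp Y ∞ μ) where
  carrier := {e | ∃ (i : A → ℕ) (y : ℕ → Y), Measurable i ∧ ∀ᵐ a ∂μ, e a = y (i a)}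
  zero_mem' := ⟨fun _ => 0, fun _ => 0, measurable_const, Lp.coeFn_zero Y ∞ μ⟩
  add_mem' := by
    rintro e e' ⟨i, y, hi, h⟩ ⟨i', y', hi', h'⟩
    refine ⟨fun a => Nat.pair (i a) (i' a), fun n => y n.unpair.1 + y' n.unpair.2,
      Measurable.comp (g := fun p : ℕ × ℕ => Nat.pair p.1 p.2) (measurable_of_countable _)
        (hi.prodMk hi'), ?_⟩
    filter_upwards [h, h', Lp.coeFn_add e e'] with a h1 h2 h3
    rw [h3, Pi.add_apply, h1, h2, Nat.unpair_pair]
  neg_mem' := by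
    rintro e ⟨i, y, hi, h⟩
    refine ⟨i, fun n => -y n, hi, ?_⟩
    filter_upwards [h, Lp.coeFn_neg e] with a h1 h2
    rw [h2, Pi.neg_apply, h1]

/-- A point of A is sent to the first member of a countable dense family that is close to the value
there. Finitely many values would not suffice, since bounded sets in Y need not be totally bounded.
-/
theorem dense_countablyValued (e : Lp Y ∞ μ) :
    e ∈ closure (countablyValued μ Y : Set (Lp Y ∞ μ)) := by
  refine Metric.mem_closure_iff.2 fun ε hε => ?_
  obtain ⟨c, hc, hec⟩ := (Lp.stronglyMeasurable e).isSeparable_range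
  -- Inserting 0 makes the countable set nonempty, so that it can be enumerated.
  obtain ⟨y, hy⟩ := (hc.insert 0).exists_eq_range (Set.insert_nonempty 0 c)
  have hex : ∀ a, ∃ n, ‖e a - y n‖ < ε / 2 := fun a => by
    obtain ⟨z, hz, hzd⟩ := Metric.mem_closure_iff.1 (hec ⟨a, rfl⟩) (ε / 2) (by positivity)
    obtain ⟨n, rfl⟩ : z ∈ Set.range y := hy ▸ Set.mem_insert_of_mem 0 hz
    exact ⟨n, by rwa [dist_eq_norm] at hzd⟩
  classical
  have hm : ∀ n, MeasurableSet {a | ‖e a - y n‖ < ε / 2} := fun n =>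
    measurableSet_lt ((Lp.stronglyMeasurable e).sub stronglyMeasurable_const).norm.measurable
      measurable_const
  let i : A → ℕ := fun a => Nat.find (hex a)
  have hi : Measurable i := measurable_find hex hm
  have hie : ∀ a, ‖e a - y (i a)‖ < ε / 2 := fun a => Nat.find_spec (hex a)
  have hys : StronglyMeasurable fun a => y (i a) :=
    StronglyMeasurable.comp_measurable (f := y) (StronglyMeasurable.of_discrete) hi
  have hmem : MemLp (fun a => y (i a)) ∞ μ :=
    memLp_top_of_bound hys.aestronglyMeasurable (‖e‖ + ε / 2) (by
      filter_upwards [linfty_ae_norm_le e] with a ha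
      have := norm_sub_le (e a) (e a - y (i a))
      rw [sub_sub_cancel] at this
      linarith [hie a])
  refine ⟨hmem.toLp _, ⟨i, y, hi, hmem.coeFn_toLp⟩, ?_⟩
  rw [dist_eq_norm]
  refine lt_of_le_of_lt (linfty_norm_le_of_ae_bound (half_pos hε).le ?_) (half_lt_self hε)
  filter_upwards [hmem.coeFn_toLp, Lp.coeFn_sub e (hmem.toLp _)] with a h1 h2
  rw [h2, Pi.sub_apply, h1]
  exact (hie a).le

/-- For e = Σ 1_{Aₙ}yₙ with disjoint Aₙ the lift is Σ T1_{Aₙ} ⊗ yₙ. It converges absolutely a.e.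
because Σ ‖yₙ‖ |T1_{Aₙ}| ≤ Σ ‖yₙ‖ R1_{Aₙ}, and positivity bounds the partial sums by ‖e‖ R1. -/
theorem IsKotheDualPair.exists_isLift_of_mem_countablyValued [CompleteSpace Y]
    (hFG : IsKotheDualPair F G) (T R : Lp 𝕜 ∞ μ →ₗ[𝕜] G) (hR : Dominates R T)
    (S : F →ₗ[𝕜] Lp 𝕜 1 μ)
    (hS : IsAdjoint (linftyPairing μ (ContinuousLinearMap.mul 𝕜 𝕜)) hFG.pairing T S)
    (β : X →L[𝕜] Y →L[𝕜] 𝕜) {e : Lp Y ∞ μ} (he : e ∈ countablyValued μ Y) :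
    ∃ g : B →ₘ[ν] Y, (∀ᵐ b ∂ν, ‖g b‖ ≤ ‖e‖ * ‖(R (linftyOne 𝕜 μ)).val b‖) ∧ IsLift T β e g := by
  obtain ⟨i, y, hi, hey⟩ := he
  let J : FunctionIdeal (𝕜 := 𝕜) μ (Lp 𝕜 ∞ μ) := FunctionIdeal.lp μ ∞
  have hordJ := J.isOrderedAddMonoid
  have hordG := G.ideal.isOrderedAddMonoid
  have hA : ∀ n, MeasurableSet (i ⁻¹' {n}) := fun n => hi (measurableSet_singleton n)
  let χ : ℕ → Lp 𝕜 ∞ μ := fun n => linftyIndicator 𝕜 μ (hA n)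
  have hχ : ∀ᵐ a ∂μ, ∀ n, χ n a = if i a = n then 1 else 0 := ae_all_iff.2 fun n => by
    filter_upwards [coeFn_linftyIndicator (𝕜 := 𝕜) (μ := μ) (hA n)] with a h
    rw [h]
    by_cases h' : i a = n <;> simp [h']
  have hχ0 : ∀ n, 0 ≤ χ n := fun n => by
    rw [J.nonneg_iff_ae]
    filter_upwards [hχ] with a h
    change 0 ≤ χ n a
    rw [h n]
    split_ifs
    exacts [zero_le_one, le_rfl]
  have hsumχ : ∀ N, ∑ n ∈ Finset.range N, ((‖y n‖ : ℝ) : 𝕜) • χ n ≤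
      ((‖e‖ : ℝ) : 𝕜) • linftyOne 𝕜 μ := fun N => by
    rw [J.le_iff_ae]
    filter_upwards [J.coeFn_sum (Finset.range N) fun n => ((‖y n‖ : ℝ) : 𝕜) • χ n,
      ae_all_iff.2 fun n => J.coeFn_smul ((‖y n‖ : ℝ) : 𝕜) (χ n), hχ, hey, linfty_ae_norm_le e,
      J.coeFn_smul ((‖e‖ : ℝ) : 𝕜) (linftyOne 𝕜 μ), coeFn_linftyOne (𝕜 := 𝕜) (μ := μ)]
      with a h1 h2 h3 h4 h5 h6 h7
    change J.val (linftyOne 𝕜 μ) a = 1 at h7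
    change ∀ n, J.val (χ n) a = _ at h3
    rw [h1, h6, h7, mul_one]
    simp_rw [h2, h3, mul_ite, mul_one, mul_zero]
    rw [Finset.sum_ite_eq]
    rw [h4] at h5
    split_ifs
    · exact RCLike.ofReal_le_ofReal.2 h5
    · exact RCLike.ofReal_nonneg.2 (norm_nonneg _)
  have hTχ : ∀ᵐ b ∂ν, ∀ n, ‖(T (χ n)).val b‖ ≤ RCLike.re ((R (χ n)).val b) ∧
      0 ≤ (R (χ n)).val b := ae_all_iff.2 fun n => by
    have h1 := hR.2 (χ n)
    have h2 : HasModulus.modulus (χ n) = χ n := J.ext (by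
      filter_upwards [J.coeFn_modulus (χ n), J.nonneg_iff_ae.1 (hχ0 n)] with a h1 h2
      rw [h1, RCLike.norm_of_nonneg' h2])
    rw [h2, G.ideal.modulus_le_iff (hR.1 _ (hχ0 n))] at h1
    filter_upwards [h1, G.ideal.nonneg_iff_ae.1 (hR.1 _ (hχ0 n))] with b h1 h2
    refine ⟨h1.trans_eq ?_, h2⟩
    rw [← RCLike.ofReal_re (K := 𝕜) ‖G.ideal.val (R (χ n)) b‖, RCLike.norm_of_nonneg' h2]
    rfl
  suffices key : ∃ g : B →ₘ[ν] Y, (∀ᵐ b ∂ν, ‖g b‖ ≤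
      ‖(((‖e‖ : ℝ) : 𝕜) • R (linftyOne 𝕜 μ)).val b‖) ∧ IsLift T β e g by
    obtain ⟨g, hg, hg'⟩ := key
    refine ⟨g, ?_, hg'⟩
    filter_upwards [hg, (R (linftyOne 𝕜 μ)).coeFn_smul ((‖e‖ : ℝ) : 𝕜)] with b h1 h2
    rwa [h2, norm_smul, RCLike.norm_ofReal, abs_of_nonneg (norm_nonneg _)] at h1
  refine hFG.exists_isLift_of_series T S hS β (fun n => lpTmul (χ n) (y n)) e
    (fun n => (T (χ n)).val.tensor (y n)) (fun n => isLift_tensor T β (χ n) (y n))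
    (((‖e‖ : ℝ) : 𝕜) • R (linftyOne 𝕜 μ)) (fun N => ?_) ‖e‖ (fun N => ?_) ?_
  · have hle : R (∑ n ∈ Finset.range N, ((‖y n‖ : ℝ) : 𝕜) • χ n) ≤
        ((‖e‖ : ℝ) : 𝕜) • R (linftyOne 𝕜 μ) := by
      have := hR.1 _ (sub_nonneg.2 (hsumχ N))
      rw [map_sub, map_smul] at this
      exact sub_nonneg.1 this
    rw [map_sum, G.ideal.le_iff_ae] at hle
    filter_upwards [hle, G.ideal.coeFn_sum (Finset.range N) fun n => R (((‖y n‖ : ℝ) : 𝕜) • χ n),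
      ae_all_iff.2 fun n => G.ideal.coeFn_smul ((‖y n‖ : ℝ) : 𝕜) (R (χ n)), hTχ,
      ae_all_iff.2 fun n => AEEqFun.coeFn_tensor (T (χ n)).val (y n)] with b h1 h2 h3 h4 h5
    rw [h2] at h1
    have h6 : ∀ n, R (((‖y n‖ : ℝ) : 𝕜) • χ n) = ((‖y n‖ : ℝ) : 𝕜) • R (χ n) :=
      fun n => R.map_smul _ _
    simp_rw [h6, h3] at h1
    simp_rw [h5, norm_smul]
    refine le_trans ?_ ((RCLike.re_le_re h1).trans (RCLike.re_le_norm _))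
    rw [map_sum]
    refine Finset.sum_le_sum fun n _ => ?_
    rw [RCLike.re_ofReal_mul, mul_comm]
    exact mul_le_mul_of_nonneg_left (h4 n).1 (norm_nonneg _)
  · filter_upwards [hχ, hey, linfty_ae_norm_le e,
      ae_all_iff.2 fun n => coeFn_lpTmul (χ n) (y n)] with a h1 h2 h3 h4
    simp_rw [h4, h1, ite_smul, one_smul, zero_smul]
    rw [Finset.sum_ite_eq]
    split_ifs
    · rwa [← h2]
    · rw [norm_zero]; exact norm_nonneg _
  · filter_upwards [hχ, hey, ae_all_iff.2 fun n => coeFn_lpTmul (χ n) (y n)] with a h1 h2 h4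
    simp_rw [h4, h1, ite_smul, one_smul, zero_smul]
    refine tendsto_const_nhds.congr' ?_
    filter_upwards [eventually_gt_atTop (i a)] with N hN
    rw [Finset.sum_ite_eq, if_pos (Finset.mem_range.2 hN), h2]

/-- e is the sum of countably valued functions whose norms add up to at most ‖e‖ + ε, and the bounds
of their lifts add up accordingly. -/
theorem IsKotheDualPair.exists_isLift [CompleteSpace Y]
    (hFG : IsKotheDualPair F G) (T R : Lp 𝕜 ∞ μ →ₗ[𝕜] G) (hR : Dominates R T)
    (S : F →ₗ[𝕜] Lp 𝕜 1 μ)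
    (hS : IsAdjoint (linftyPairing μ (ContinuousLinearMap.mul 𝕜 𝕜)) hFG.pairing T S)
    (β : X →L[𝕜] Y →L[𝕜] 𝕜) (e : Lp Y ∞ μ) {ε : ℝ} (hε : 0 < ε) :
    ∃ g : B →ₘ[ν] Y, (∀ᵐ b ∂ν, ‖g b‖ ≤ (‖e‖ + ε) * ‖(R (linftyOne 𝕜 μ)).val b‖) ∧
      IsLift T β e g := by
  -- The tolerances ε/2/2ⁿ have sum ε; ‖v 0‖ exceeds ‖e‖ by at most the tolerance with n = 0.
  obtain ⟨v, hv, hvm, hv0, hvn⟩ := controlled_sum_of_mem_closure (dense_countablyValued e)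
    (b := fun n => ε / 2 / 2 ^ n) (fun n => by positivity)
  have hvsum : ∀ N, ∑ n ∈ Finset.range N, ‖v n‖ ≤ ‖e‖ + ε := fun N => by
    have h1 : ∀ n, ‖v n‖ ≤ (if n = 0 then ‖e‖ else 0) + ε / 2 / 2 ^ n := fun n => by
      split_ifs with h
      · subst h
        have := norm_sub_le e (-v 0 + e)
        rw [sub_add_cancel_right, neg_neg] at this
        linarith
      · rw [zero_add]
        exact (hvn n (Nat.pos_of_ne_zero h)).le
    refine (Finset.sum_le_sum fun n _ => h1 n).trans ?_
    rw [Finset.sum_add_distrib]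
    refine add_le_add ?_ (sum_le_hasSum _ (fun n _ => by positivity) (hasSum_geometric_two' ε))
    rw [Finset.sum_ite_eq']
    split_ifs
    exacts [le_rfl, norm_nonneg _]
  choose g hg hg' using fun n =>
    hFG.exists_isLift_of_mem_countablyValued T R hR S hS β (hvm n)
  have hnn : 0 ≤ ‖e‖ + ε := by positivity
  suffices key : ∃ g : B →ₘ[ν] Y, (∀ᵐ b ∂ν, ‖g b‖ ≤
      ‖(((‖e‖ + ε : ℝ) : 𝕜) • R (linftyOne 𝕜 μ)).val b‖) ∧ IsLift T β e g by
    obtain ⟨g', h1, h2⟩ := key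
    refine ⟨g', ?_, h2⟩
    filter_upwards [h1, (R (linftyOne 𝕜 μ)).coeFn_smul ((‖e‖ + ε : ℝ) : 𝕜)] with b h1 h2
    rwa [h2, norm_smul, RCLike.norm_ofReal, abs_of_nonneg hnn] at h1
  refine hFG.exists_isLift_of_series T S hS β v e g hg'
    (((‖e‖ + ε : ℝ) : 𝕜) • R (linftyOne 𝕜 μ)) (fun N => ?_) (‖e‖ + ε) (fun N => ?_) ?_
  · filter_upwards [ae_all_iff.2 hg, (R (linftyOne 𝕜 μ)).coeFn_smul ((‖e‖ + ε : ℝ) : 𝕜)]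
      with b h1 h2
    rw [h2, norm_smul, RCLike.norm_ofReal, abs_of_nonneg hnn]
    refine (Finset.sum_le_sum fun n _ => h1 n).trans ?_
    rw [← Finset.sum_mul]
    exact mul_le_mul_of_nonneg_right (hvsum N) (norm_nonneg _)
  · filter_upwards [ae_all_iff.2 fun n => linfty_ae_norm_le (v n)] with a h
    exact (norm_sum_le _ _).trans ((Finset.sum_le_sum fun n _ => h n).trans (hvsum N))
  · filter_upwards [ae_all_iff.2 fun N => Lp.coeFn_fun_finsetSum (Finset.range N) v,
      ae_all_iff.2 fun N => linfty_ae_norm_le (∑ n ∈ Finset.range N, v n - e),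
      ae_all_iff.2 fun N => Lp.coeFn_sub (∑ n ∈ Finset.range N, v n) e] with a h1 h2 h3
    rw [tendsto_iff_norm_sub_tendsto_zero]
    -- The controlled sums run over `Finset.range (n + 1)`, hence the shift of the index by one.
    have hv' : Tendsto (fun N => ∑ n ∈ Finset.range N, v n) atTop (𝓝 e) :=
      (tendsto_add_atTop_iff_nat 1).1 hv
    refine squeeze_zero (fun N => norm_nonneg _) (fun N => ?_)
      (tendsto_iff_norm_sub_tendsto_zero.1 hv')
    have := h2 N
    rwa [h3, Pi.sub_apply, h1] at this

/-- X separates the points of Y, and `ae_eq_zero_of_separating` handles the possibly uncountable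
family of exceptional null sets, one for each x. -/
theorem isLift_unique (T : Lp 𝕜 ∞ μ →ₗ[𝕜] G) {β : X →L[𝕜] Y →L[𝕜] 𝕜} (hβ : IsBanachDualPair β)
    {e : Lp Y ∞ μ} {g g' : B →ₘ[ν] Y} (h : IsLift T β e g) (h' : IsLift T β e g') : g = g' := by
  rw [← sub_eq_zero]
  refine AEEqFun.ext ?_
  have := ae_eq_zero_of_separating (ν := ν) (fun x => β x)
    (fun y hy => hβ.injective_right (by ext x; simpa using hy x)) (g - g' : B →ₘ[ν] Y)
    (AEEqFun.stronglyMeasurable _) (fun x => by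
      filter_upwards [h x, h' x, AEEqFun.coeFn_sub g g'] with b h1 h2 h3
      rw [h3, Pi.sub_apply, map_sub, h1, h2, sub_self])
  filter_upwards [this, AEEqFun.coeFn_zero (μ := ν) (β := Y)] with b h1 h2
  rw [h1, h2]; rfl

/-- The operator `T_Y`. -/
theorem IsKotheDualPair.exists_bochner_extension [CompleteSpace Y]
    (hFG : IsKotheDualPair F G) (T : Lp 𝕜 ∞ μ →ₗ[𝕜] G)
    (hdom : ∃ R : Lp 𝕜 ∞ μ →L[𝕜] G, Dominates (R : Lp 𝕜 ∞ μ →ₗ[𝕜] G) T)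
    (S : F →ₗ[𝕜] Lp 𝕜 1 μ)
    (hS : IsAdjoint (linftyPairing μ (ContinuousLinearMap.mul 𝕜 𝕜)) hFG.pairing T S)
    {β : X →L[𝕜] Y →L[𝕜] 𝕜} (hβ : IsBanachDualPair β) :
    ∃ T_Y : Lp Y ∞ μ →L[𝕜] G.Bochner Y, (∀ e, IsLift T β e (T_Y e).val) ∧
      ‖T_Y‖ ≤ dominatedNorm T := by
  -- By uniqueness the lift does not depend on the dominant used to build it, so its norm is bounded
  -- through every dominant, and the infimum over R may be taken.
  have hbd : ∀ (R : Lp 𝕜 ∞ μ →L[𝕜] G), Dominates (R : Lp 𝕜 ∞ μ →ₗ[𝕜] G) T →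
      ∀ (g : G.Bochner Y) (e : Lp Y ∞ μ), IsLift T β e g.val → ‖g‖ ≤ ‖R‖ * ‖e‖ := by
    intro R hR g e hg
    have hR1 : ‖R (linftyOne 𝕜 μ)‖ ≤ ‖R‖ :=
      (R.le_opNorm _).trans (mul_le_of_le_one_right (norm_nonneg _) norm_linftyOne_le)
    have h1 : ∀ ε : ℝ, 0 < ε → ‖g‖ ≤ (‖e‖ + ε) * ‖R (linftyOne 𝕜 μ)‖ := fun ε hε => by
      obtain ⟨g', h1, h2⟩ := hFG.exists_isLift T R hR S hS β e hε
      obtain rfl := isLift_unique T hβ hg h2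
      have hnn : 0 ≤ ‖e‖ + ε := by positivity
      have h3 : ‖g.pointwiseNorm‖ ≤ ‖((‖e‖ + ε : ℝ) : 𝕜) • R (linftyOne 𝕜 μ)‖ := by
        refine BanachFunctionSpace.norm_le_norm_of_ae _ _ ?_
        filter_upwards [h1, g.coeFn_pointwiseNorm,
          (R (linftyOne 𝕜 μ)).coeFn_smul ((‖e‖ + ε : ℝ) : 𝕜)] with b h1 h2 h3
        rw [h2, h3, norm_smul, RCLike.norm_ofReal, RCLike.norm_ofReal, abs_of_nonneg hnn,
          abs_of_nonneg (norm_nonneg _)]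
        exact h1
      rw [norm_smul, RCLike.norm_ofReal, abs_of_nonneg hnn] at h3
      exact h3
    have h2 : ‖g‖ ≤ ‖e‖ * ‖R (linftyOne 𝕜 μ)‖ := by
      have ht : Tendsto (fun ε : ℝ => (‖e‖ + ε) * ‖R (linftyOne 𝕜 μ)‖) (𝓝[>] 0)
          (𝓝 ((‖e‖ + 0) * ‖R (linftyOne 𝕜 μ)‖)) :=
        (Continuous.tendsto (by fun_prop) _).mono_left nhdsWithin_le_nhds
      rw [add_zero] at ht
      exact ge_of_tendsto ht (by
        filter_upwards [self_mem_nhdsWithin] with ε hε using h1 ε hε)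
    rw [mul_comm]
    exact h2.trans (by gcongr)
  have hex : ∀ e : Lp Y ∞ μ, ∃ g : G.Bochner Y, IsLift T β e g.val := fun e => by
    obtain ⟨R, hR⟩ := hdom
    obtain ⟨g, h1, h2⟩ := hFG.exists_isLift T R hR S hS β e one_pos
    have hmem : g ∈ G.bochnerSubmodule Y := by
      refine G.solid _ _ ((((‖e‖ + 1 : ℝ) : 𝕜) • R (linftyOne 𝕜 μ)).val_mem) ?_
      filter_upwards [h1, AEEqFun.coeFn_modulus 𝕜 g,
        (R (linftyOne 𝕜 μ)).coeFn_smul ((‖e‖ + 1 : ℝ) : 𝕜)] with b h1 h2 h3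
      rw [h2, h3, norm_smul, RCLike.norm_ofReal, RCLike.norm_ofReal,
        abs_of_nonneg (show 0 ≤ ‖e‖ + 1 by positivity), abs_of_nonneg (norm_nonneg _)]
      exact h1
    exact ⟨(⟨g, hmem⟩ : G.bochnerSubmodule Y), h2⟩
  have huniq : ∀ (e : Lp Y ∞ μ) (g g' : G.Bochner Y), IsLift T β e g.val → IsLift T β e g'.val →
      g = g' := fun e g g' h h' =>
    Subtype.ext (p := (· ∈ G.bochnerSubmodule Y)) (isLift_unique T hβ h h')
  choose τ hτ using hex
  let L : Lp Y ∞ μ →ₗ[𝕜] G.Bochner Y :=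
    { toFun := τ
      map_add' := fun e e' => huniq _ _ _ (hτ _) fun x => by
        filter_upwards [hτ e x, hτ e' x, (τ e).coeFn_add (τ e'),
          (T ((β x).compLp e)).coeFn_add (T ((β x).compLp e'))] with b h1 h2 h3 h4
        rw [show (β x).compLp (e + e') = (β x).compLp e + (β x).compLp e' from
          map_add ((β x).compLpL ∞ μ) e e', map_add, h4, h3, map_add, h1, h2]
      map_smul' := fun c e => huniq _ _ _ (hτ _) fun x => by
        filter_upwards [hτ e x, (τ e).coeFn_smul c, (T ((β x).compLp e)).coeFn_smul c]
          with b h1 h2 h3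
        rw [RingHom.id_apply, show (β x).compLp (c • e) = c • (β x).compLp e from
          map_smul ((β x).compLpL ∞ μ) c e, map_smul, h3, h2, map_smul, h1] }
  obtain ⟨R₀, hR₀⟩ := hdom
  let T_Y := L.mkContinuous ‖R₀‖ fun e => hbd R₀ hR₀ _ _ (hτ e)
  refine ⟨T_Y, hτ, ?_⟩
  refine le_csInf ⟨_, R₀, hR₀, rfl⟩ ?_
  rintro _ ⟨R, hR, rfl⟩
  exact T_Y.opNorm_le_bound (norm_nonneg _) fun e => hbd R hR _ _ (hτ e)

end Lifting

/-! ### The extension `S_X` -/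

section Tensor

variable {𝕜 : Type*} [RCLike 𝕜] {A : Type*} [MeasurableSpace A] {μ : Measure A}
  {B : Type*} [MeasurableSpace B] {ν : Measure B} {F G : BanachFunctionSpace 𝕜 ν}
  {X Y : Type*} [NormedAddCommGroup X] [NormedSpace 𝕜 X]
  [NormedAddCommGroup Y] [NormedSpace 𝕜 Y]

/-- Composition with a functional, as an operator `F(X) → F`. -/
def BanachFunctionSpace.Bochner.comp (φ : StrongDual 𝕜 X) (u : F.Bochner X) : F :=
  ofMem (AEEqFun.comp φ φ.continuous u.val) (by
    refine F.solid _ _ ((((‖φ‖ : ℝ) : 𝕜) • u.pointwiseNorm).val_mem) ?_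
    filter_upwards [AEEqFun.coeFn_comp φ φ.continuous u.val, u.coeFn_pointwiseNorm,
      u.pointwiseNorm.coeFn_smul ((‖φ‖ : ℝ) : 𝕜)] with b h1 h2 h3
    rw [h1]
    rw [h3, h2, _root_.norm_smul, RCLike.norm_ofReal, RCLike.norm_ofReal,
      abs_of_nonneg (_root_.norm_nonneg _), abs_of_nonneg (_root_.norm_nonneg _)]
    exact φ.le_opNorm _)

theorem BanachFunctionSpace.Bochner.coeFn_comp' (φ : StrongDual 𝕜 X) (u : F.Bochner X) :
    ∀ᵐ b ∂ν, (u.comp φ).val b = φ (u.val b) :=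
  AEEqFun.coeFn_comp φ φ.continuous u.val

theorem BanachFunctionSpace.Bochner.norm_comp_le (φ : StrongDual 𝕜 X) (u : F.Bochner X) :
    ‖u.comp φ‖ ≤ ‖φ‖ * ‖u‖ := by
  have : ‖u.comp φ‖ ≤ ‖((‖φ‖ : ℝ) : 𝕜) • u.pointwiseNorm‖ := by
    refine norm_le_norm_of_ae _ _ ?_
    filter_upwards [u.coeFn_comp' φ, u.coeFn_pointwiseNorm,
      u.pointwiseNorm.coeFn_smul ((‖φ‖ : ℝ) : 𝕜)] with b h1 h2 h3
    rw [h1, h3, h2, _root_.norm_smul, RCLike.norm_ofReal, RCLike.norm_ofReal,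
      abs_of_nonneg (_root_.norm_nonneg _), abs_of_nonneg (_root_.norm_nonneg _)]
    exact φ.le_opNorm _
  rwa [_root_.norm_smul, RCLike.norm_ofReal, abs_of_nonneg (_root_.norm_nonneg _)] at this

/-- Composition with a functional, as a bounded operator `F(X) → F`. -/
def BanachFunctionSpace.Bochner.compL (F : BanachFunctionSpace 𝕜 ν) (φ : StrongDual 𝕜 X) :
    F.Bochner X →L[𝕜] F :=
  LinearMap.mkContinuous
    { toFun := fun u => u.comp φ
      map_add' := fun u u' => F.ideal.ext (by
        filter_upwards [u.coeFn_comp' φ, u'.coeFn_comp' φ, (u + u').coeFn_comp' φ,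
          u.coeFn_add u', (u.comp φ).coeFn_add (u'.comp φ)] with b h1 h2 h3 h4 h5
        change ((u + u').comp φ).val b = (u.comp φ + u'.comp φ).val b
        rw [h5, h3, h4, h1, h2, map_add])
      map_smul' := fun c u => F.ideal.ext (by
        filter_upwards [u.coeFn_comp' φ, (c • u).coeFn_comp' φ,
          u.coeFn_smul c, (u.comp φ).coeFn_smul c] with b h1 h2 h3 h4
        change ((c • u).comp φ).val b = (c • u.comp φ).val b
        rw [h4, h2, h3, h1, map_smul]) } ‖φ‖ (fun u => u.norm_comp_le φ)

theorem BanachFunctionSpace.Bochner.coeFn_compL (φ : StrongDual 𝕜 X) (u : F.Bochner X) :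
    ∀ᵐ b ∂ν, (Bochner.compL F φ u).val b = φ (u.val b) :=
  u.coeFn_comp' φ

theorem BanachFunctionSpace.coeFn_tmul (f : F) (x : X) :
    ∀ᵐ b ∂ν, (tmul f x).val b = f.val b • x :=
  AEEqFun.coeFn_tensor f.val x

theorem BanachFunctionSpace.Bochner.compL_tmul (φ : StrongDual 𝕜 X) (f : F) (x : X) :
    Bochner.compL F φ (tmul f x) = φ x • f := F.ideal.ext (by
  filter_upwards [(tmul f x).coeFn_compL φ, coeFn_tmul f x, f.coeFn_smul (φ x)] with b h1 h2 h3
  change (Bochner.compL F φ (tmul f x)).val b = (φ x • f).val b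
  rw [h1, h2, h3, map_smul, smul_eq_mul, smul_eq_mul, mul_comm])

/-- For ‖φ‖ ≤ 1, |φ∘u| ≤ ‖u‖_X gives |φ∘v| ≤ R‖u‖_X a.e. Separability of the range of v turns this
into ‖v‖_X ≤ R‖u‖_X a.e. -/
theorem norm_le_of_compLp_eq (S R : F →L[𝕜] Lp 𝕜 1 μ)
    (hR : Dominates (R : F →ₗ[𝕜] Lp 𝕜 1 μ) (S : F →ₗ[𝕜] Lp 𝕜 1 μ)) (u : F.Bochner X)
    (v : Lp X 1 μ) (h : ∀ φ : StrongDual 𝕜 X,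
      φ.compLp v = S (BanachFunctionSpace.Bochner.compL F φ u)) : ‖v‖ ≤ ‖R‖ * ‖u‖ := by
  let K : FunctionIdeal (𝕜 := 𝕜) μ (Lp 𝕜 1 μ) := FunctionIdeal.lp μ 1
  have hordF := F.ideal.isOrderedAddMonoid
  have hordK := K.isOrderedAddMonoid
  have hpn : 0 ≤ u.pointwiseNorm := by
    rw [F.ideal.nonneg_iff_ae]
    filter_upwards [u.coeFn_pointwiseNorm] with b h
    change 0 ≤ u.pointwiseNorm.val b
    rw [h]; exact RCLike.ofReal_nonneg.2 (norm_nonneg _)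
  have hRpn : 0 ≤ R u.pointwiseNorm := hR.1 _ hpn
  have key : ∀ᵐ a ∂μ, ‖v a‖ ≤ ‖K.val (R u.pointwiseNorm) a‖ := by
    refine ae_norm_le_of_forall_dual (𝕜 := 𝕜) _ (Lp.stronglyMeasurable v) _ fun φ hφ => ?_
    have h1 : HasModulus.modulus (BanachFunctionSpace.Bochner.compL F φ u) ≤ u.pointwiseNorm := by
      rw [F.ideal.modulus_le_iff hpn]
      filter_upwards [u.coeFn_compL φ, u.coeFn_pointwiseNorm] with b h1 h2
      change ‖(BanachFunctionSpace.Bochner.compL F φ u).val b‖ ≤ ‖u.pointwiseNorm.val b‖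
      rw [h1, h2, RCLike.norm_ofReal, abs_of_nonneg (norm_nonneg _)]
      exact (φ.le_opNorm _).trans (mul_le_of_le_one_left (norm_nonneg _) hφ)
    have h2 : HasModulus.modulus (S (BanachFunctionSpace.Bochner.compL F φ u)) ≤
        R u.pointwiseNorm := by
      refine (hR.2 _).trans ?_
      have := hR.1 _ (sub_nonneg.2 h1)
      rw [map_sub] at this
      exact sub_nonneg.1 this
    rw [K.modulus_le_iff hRpn, ← h φ] at h2
    filter_upwards [h2, φ.coeFn_compLp v] with a h1 h2
    rw [← h2]
    exact h1
  exact (Lp.norm_le_norm_of_ae_le key).trans (R.le_opNorm u.pointwiseNorm)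

theorem BanachFunctionSpace.exists_seq_tendsto (u : F.tensorClosure X) :
    ∃ w : ℕ → F.tensorClosure X, Tendsto w atTop (𝓝 u) ∧ ∀ n, (w n : F.Bochner X) ∈
      Submodule.span 𝕜 {φ | ∃ (f : F) (x : X), φ = tmul f x} := by
  obtain ⟨w, hw, hwu⟩ := mem_closure_iff_seq_limit.1 u.2
  exact ⟨fun n => ⟨w n, Submodule.le_topologicalClosure _ (hw n)⟩,
    tendsto_subtype_rng.2 hwu, hw⟩

theorem BanachFunctionSpace.tensorClosure_ext {M : Type*} [NormedAddCommGroup M] [NormedSpace 𝕜 M]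
    {L L' : F.tensorClosure X →L[𝕜] M}
    (h : ∀ f x, L (tmulClosure f x) = L' (tmulClosure f x)) : L = L' := by
  ext u
  obtain ⟨w, hw, hws⟩ := exists_seq_tendsto u
  have hspan : ∀ z ∈ Submodule.span 𝕜 {φ : F.Bochner X | ∃ (f : F) (x : X), φ = tmul f x},
      ∃ h : z ∈ F.tensorClosure X, L ⟨z, h⟩ = L' ⟨z, h⟩ := fun z hz => by
    induction hz using Submodule.span_induction with
    | mem z hz =>
      obtain ⟨f, x, rfl⟩ := hz
      exact ⟨(tmulClosure f x).2, h f x⟩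
    | zero => exact ⟨Submodule.zero_mem _, by
        rw [show (⟨0, Submodule.zero_mem _⟩ : F.tensorClosure X) = 0 from rfl, map_zero, map_zero]⟩
    | add z z' _ _ h h' =>
      obtain ⟨hz, h⟩ := h
      obtain ⟨hz', h'⟩ := h'
      refine ⟨Submodule.add_mem _ hz hz', ?_⟩
      have := congrArg₂ (· + ·) h h'
      simp only [← map_add] at this
      exact this
    | smul c z _ h =>
      obtain ⟨hz, h⟩ := h
      refine ⟨Submodule.smul_mem _ c hz, ?_⟩
      have := congrArg (c • ·) h
      simp only [← map_smul] at this
      exact this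
  refine tendsto_nhds_unique ((L.continuous.tendsto u).comp hw)
    (((L'.continuous.tendsto u).comp hw).congr fun n => ?_)
  obtain ⟨h1, h2⟩ := hspan _ (hws n)
  exact h2.symm

/-- The operator `S_X`. -/
theorem exists_tensor_extension [CompleteSpace X] (S : F →L[𝕜] Lp 𝕜 1 μ)
    (hdom : ∃ R : F →L[𝕜] Lp 𝕜 1 μ,
      Dominates (R : F →ₗ[𝕜] Lp 𝕜 1 μ) (S : F →ₗ[𝕜] Lp 𝕜 1 μ)) :
    ∃ S_X : F.tensorClosure X →L[𝕜] Lp X 1 μ,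
      (∀ f x, S_X (BanachFunctionSpace.tmulClosure f x) = lpTmul (S f) x) ∧
      ‖S_X‖ ≤ dominatedNorm (S : F →ₗ[𝕜] Lp 𝕜 1 μ) := by
  -- S_X is specified by its scalar images φ∘v = S(φ∘u), which avoids representing u as a sum of
  -- tensors. The bound makes this linear relation single-valued, and it passes to limits.
  let rel : F.Bochner X → Lp X 1 μ → Prop := fun u v => ∀ φ : StrongDual 𝕜 X,
    φ.compLp v = S (BanachFunctionSpace.Bochner.compL F φ u)
  have radd : ∀ u v u' v', rel u v → rel u' v' → rel (u + u') (v + v') :=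
    fun u v u' v' h h' φ => by
      rw [map_add, map_add, ← h φ, ← h' φ]
      exact map_add (φ.compLpL 1 μ) v v'
  have rsmul : ∀ (c : 𝕜) u v, rel u v → rel (c • u) (c • v) := fun c u v h φ => by
    rw [map_smul, map_smul, ← h φ]
    exact map_smul (φ.compLpL 1 μ) c v
  have rsub : ∀ u v u' v', rel u v → rel u' v' → rel (u - u') (v - v') :=
    fun u v u' v' h h' φ => by
      rw [map_sub, map_sub, ← h φ, ← h' φ]
      exact map_sub (φ.compLpL 1 μ) v v'
  have rtmul : ∀ (f : F) (x : X), rel (BanachFunctionSpace.tmul f x) (lpTmul (S f) x) :=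
    fun f x φ => by
      rw [BanachFunctionSpace.Bochner.compL_tmul, map_smul]
      refine Lp.ext ?_
      filter_upwards [φ.coeFn_compLp (lpTmul (S f) x), coeFn_lpTmul (S f) x,
        Lp.coeFn_smul (φ x) (S f)] with a h1 h2 h3
      rw [h1, h2, h3, map_smul, Pi.smul_apply, smul_eq_mul, smul_eq_mul, mul_comm]
  have rbound : ∀ R : F →L[𝕜] Lp 𝕜 1 μ,
      Dominates (R : F →ₗ[𝕜] Lp 𝕜 1 μ) (S : F →ₗ[𝕜] Lp 𝕜 1 μ) → ∀ u v, rel u v →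
      ‖v‖ ≤ ‖R‖ * ‖u‖ := fun R hR u v h => norm_le_of_compLp_eq S R hR u v h
  obtain ⟨R₀, hR₀⟩ := hdom
  have runiq : ∀ u v v', rel u v → rel u v' → v = v' := fun u v v' h h' => by
    have := rbound R₀ hR₀ _ _ (rsub _ _ _ _ h h')
    rw [sub_self, norm_zero, mul_zero] at this
    exact sub_eq_zero.1 (norm_le_zero_iff.1 this)
  have rspan : ∀ z ∈ Submodule.span 𝕜 {φ : F.Bochner X | ∃ (f : F) (x : X),
      φ = BanachFunctionSpace.tmul f x}, ∃ v, rel z v := fun z hz => by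
    induction hz using Submodule.span_induction with
    | mem z hz =>
      obtain ⟨f, x, rfl⟩ := hz
      exact ⟨_, rtmul f x⟩
    | zero => exact ⟨0, fun φ => by
        rw [map_zero, map_zero]; exact map_zero (φ.compLpL 1 μ)⟩
    | add z z' _ _ h h' =>
      obtain ⟨v, hv⟩ := h
      obtain ⟨v', hv'⟩ := h'
      exact ⟨_, radd _ _ _ _ hv hv'⟩
    | smul c z _ h =>
      obtain ⟨v, hv⟩ := h
      exact ⟨_, rsmul c _ _ hv⟩
  have rex : ∀ u : F.tensorClosure X, ∃ v, rel u v := fun u => by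
    obtain ⟨w, hw, hws⟩ := BanachFunctionSpace.exists_seq_tendsto u
    have hw' : Tendsto (fun n => (w n : F.Bochner X)) atTop (𝓝 u) := tendsto_subtype_rng.1 hw
    choose v hv using fun n => rspan _ (hws n)
    have hcauchy : CauchySeq v := by
      have hcw := hw'.cauchySeq
      rw [Metric.cauchySeq_iff] at hcw ⊢
      intro ε hε
      obtain ⟨N, hN⟩ := hcw (ε / (‖R₀‖ + 1)) (by positivity)
      refine ⟨N, fun m hm n hn => ?_⟩
      have h1 := hN m hm n hn
      rw [dist_eq_norm] at h1 ⊢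
      rw [lt_div_iff₀ (by positivity)] at h1
      refine (rbound R₀ hR₀ _ _ (rsub _ _ _ _ (hv m) (hv n))).trans_lt (lt_of_le_of_lt ?_ h1)
      nlinarith [norm_nonneg ((w m : F.Bochner X) - w n)]
    obtain ⟨v', hv'⟩ := cauchySeq_tendsto_of_complete hcauchy
    refine ⟨v', fun φ => ?_⟩
    have h1 := (((φ.compLpL 1 μ).continuous.tendsto v').comp hv')
    have h2 := ((S.comp (BanachFunctionSpace.Bochner.compL F φ)).continuous.tendsto _).comp hw'
    exact tendsto_nhds_unique h1 (h2.congr fun n => (hv n φ).symm)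
  choose σ hσ using rex
  let L : F.tensorClosure X →ₗ[𝕜] Lp X 1 μ :=
    { toFun := σ
      map_add' := fun u u' => runiq _ _ _ (hσ _) (radd _ _ _ _ (hσ u) (hσ u'))
      map_smul' := fun c u => runiq _ _ _ (hσ _) (rsmul c _ _ (hσ u)) }
  let S_X := L.mkContinuous ‖R₀‖ fun u => rbound R₀ hR₀ _ _ (hσ u)
  refine ⟨S_X, fun f x => runiq _ _ _ (hσ _) (rtmul f x), le_csInf ⟨_, R₀, hR₀, rfl⟩ ?_⟩
  rintro _ ⟨R, hR, rfl⟩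
  exact S_X.opNorm_le_bound (norm_nonneg _) fun u => rbound R hR _ _ (hσ u)

/-! ### Duality between the two extensions -/

variable (hFG : IsKotheDualPair F G)

theorem IsKotheDualPair.bochnerPairing_apply (β : X →L[𝕜] Y →L[𝕜] 𝕜) (g : G.Bochner Y)
    (u : F.Bochner X) : hFG.bochnerPairing β g u = ∫ b, β (u.val b) (g.val b) ∂ν := rfl

include hFG in
theorem IsKotheDualPair.exists_norm_bochnerPairing_le (β : X →L[𝕜] Y →L[𝕜] 𝕜)
    (g : G.Bochner Y) : ∃ C, ∀ u : F.Bochner X, ‖hFG.bochnerPairing β g u‖ ≤ C * ‖u‖ := by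
  obtain ⟨C, hC, h⟩ := hFG.exists_bound
  refine ⟨‖β‖ * (C * ‖g‖), fun u => ?_⟩
  have h1 : ‖hFG.bochnerPairing β g u‖ ≤
      ∫ b, ‖β‖ * RCLike.re (u.pointwiseNorm.val b * g.pointwiseNorm.val b) ∂ν := by
    rw [hFG.bochnerPairing_apply]
    refine (norm_integral_le_integral_norm _).trans (integral_mono_ae
      (hFG.integrable_bochner β g u).norm
      ((hFG.integrable u.pointwiseNorm g.pointwiseNorm).re.const_mul _) ?_)
    filter_upwards [u.coeFn_pointwiseNorm, g.coeFn_pointwiseNorm] with b h1 h2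
    simp only [h1, h2]
    rw [← RCLike.ofReal_mul, RCLike.ofReal_re, ← mul_assoc]
    exact β.le_opNorm₂ _ _
  refine h1.trans ?_
  rw [integral_const_mul, integral_re (hFG.integrable _ _), ← hFG.pairing_apply, mul_assoc]
  refine mul_le_mul_of_nonneg_left ((RCLike.re_le_norm _).trans (h _ _)) (ContinuousLinearMap.opNorm_nonneg β)

theorem IsKotheDualPair.bochnerPairing_tmul (β : X →L[𝕜] Y →L[𝕜] 𝕜) (g : G.Bochner Y) (f : F)
    (x : X) : hFG.bochnerPairing β g (BanachFunctionSpace.tmul f x) =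
      hFG.pairing (BanachFunctionSpace.Bochner.compL G (β x) g) f := by
  rw [hFG.bochnerPairing_apply, hFG.pairing_apply]
  refine integral_congr_ae ?_
  filter_upwards [g.coeFn_compL (β x), BanachFunctionSpace.coeFn_tmul f x] with b h1 h2
  rw [h1, h2, map_smul, _root_.smul_apply, smul_eq_mul]

theorem linftyPairing_lpTmul_right (β : X →L[𝕜] Y →L[𝕜] 𝕜) (e : Lp Y ∞ μ) (u : Lp 𝕜 1 μ) (x : X) :
    linftyPairing μ β e (lpTmul u x) =
      linftyPairing μ (ContinuousLinearMap.mul 𝕜 𝕜) ((β x).compLp e) u := by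
  rw [linftyPairing_apply, linftyPairing_mul_apply]
  refine integral_congr_ae ?_
  filter_upwards [(β x).coeFn_compLp e, coeFn_lpTmul u x] with a h1 h2
  rw [h1, h2, map_smul, _root_.smul_apply, smul_eq_mul]

theorem linftyPairing_lpTmul_left (β : X →L[𝕜] Y →L[𝕜] 𝕜) (h : Lp 𝕜 ∞ μ) (y : Y) (v : Lp X 1 μ) :
    linftyPairing μ β (lpTmul h y) v =
      linftyPairing μ (ContinuousLinearMap.mul 𝕜 𝕜) h ((β.flip y).compLp v) := by
  rw [linftyPairing_apply, linftyPairing_mul_apply]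
  refine integral_congr_ae ?_
  filter_upwards [(β.flip y).coeFn_compLp v, coeFn_lpTmul h y] with a h1 h2
  rw [h1, h2, map_smul, ContinuousLinearMap.flip_apply, smul_eq_mul, mul_comm]

/-- Varying k identifies the scalar functions ⟨v, y⟩ and ⟨v', y⟩ in L¹ for each y, and Y separates
the points of X. -/
theorem lp_one_ext_of_linftyPairing {β : X →L[𝕜] Y →L[𝕜] 𝕜} (hβ : IsBanachDualPair β)
    {v v' : Lp X 1 μ}
    (h : ∀ (k : Lp 𝕜 ∞ μ) (y : Y), linftyPairing μ β (lpTmul k y) v =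
      linftyPairing μ β (lpTmul k y) v') : v = v' := by
  rw [← sub_eq_zero]
  refine Lp.eq_zero_iff_ae_eq_zero.2 (ae_eq_zero_of_separating (fun y => β.flip y)
    (fun x hx => hβ.injective_left (by ext y; simpa using hx y)) _ (Lp.stronglyMeasurable _)
    fun y => ?_)
  have h0 : (β.flip y).compLp (v - v') = 0 :=
    eq_zero_of_forall_linftyPairing_eq_zero _ fun k => by
      rw [← linftyPairing_lpTmul_left, map_sub, h, sub_self]
  filter_upwards [(β.flip y).coeFn_compLp (v - v'), Lp.coeFn_zero 𝕜 1 μ] with a h1 h2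
  rw [← h1, h0, h2]; rfl

/-- Both sides are norm continuous in the element of F ⊗~ X, so it is enough to compare them on f ⊗
x; there the identity is ⟨x, T_Y e⟩ = T⟨x, e⟩ paired with f. -/
theorem IsKotheDualPair.isAdjoint_extension {T : Lp 𝕜 ∞ μ →ₗ[𝕜] G} {S : F →L[𝕜] Lp 𝕜 1 μ}
    (hS : IsAdjoint (linftyPairing μ (ContinuousLinearMap.mul 𝕜 𝕜)) hFG.pairing T
      (S : F →ₗ[𝕜] Lp 𝕜 1 μ)) (β : X →L[𝕜] Y →L[𝕜] 𝕜) (T_Y : Lp Y ∞ μ →ₗ[𝕜] G.Bochner Y)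
    (hT : ∀ e, IsLift T β e (T_Y e).val) (S_X : F.tensorClosure X →L[𝕜] Lp X 1 μ)
    (hSX : ∀ f x, S_X (BanachFunctionSpace.tmulClosure f x) = lpTmul (S f) x) :
    IsAdjoint (linftyPairing μ β) (hFG.tensorPairing β) T_Y
      (S_X : F.tensorClosure X →ₗ[𝕜] Lp X 1 μ) := fun e u => by
  obtain ⟨C, hC⟩ := hFG.exists_norm_bochnerPairing_le β (T_Y e)
  obtain ⟨C', -, hC'⟩ := norm_linftyPairing_le (μ := μ) β
  let L := (hFG.tensorPairing β (T_Y e)).mkContinuous C fun u => hC u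
  let L' := ((linftyPairing μ β e).mkContinuous (C' * ‖e‖) (hC' e)).comp S_X
  have : L = L' := BanachFunctionSpace.tensorClosure_ext fun f x => by
    change hFG.bochnerPairing β (T_Y e) (BanachFunctionSpace.tmul f x) =
      linftyPairing μ β e (S_X (BanachFunctionSpace.tmulClosure f x))
    rw [hSX, hFG.bochnerPairing_tmul, linftyPairing_lpTmul_right]
    refine Eq.trans ?_ (hS _ _)
    congr 2
    refine G.ideal.ext ?_
    filter_upwards [hT e x, (T_Y e).coeFn_compL (β x)] with b h1 h2
    exact h2.trans h1
  exact DFunLike.congr_fun this u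

/-- This yields uniqueness of T_Y. Weak continuity represents e ↦ ⟨T'e, f ⊗ x⟩ by some v in L¹(A;
X), and testing on tensors h ⊗ y forces v = Sf ⊗ x. Then ⟨x, T'e⟩ = T⟨x, e⟩ holds for every e. -/
theorem IsKotheDualPair.isLift_of_isWeaklyContinuous {T : Lp 𝕜 ∞ μ →ₗ[𝕜] G}
    {S : F →L[𝕜] Lp 𝕜 1 μ}
    (hS : IsAdjoint (linftyPairing μ (ContinuousLinearMap.mul 𝕜 𝕜)) hFG.pairing T
      (S : F →ₗ[𝕜] Lp 𝕜 1 μ)) {β : X →L[𝕜] Y →L[𝕜] 𝕜} (hβ : IsBanachDualPair β)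
    (T' : Lp Y ∞ μ →ₗ[𝕜] G.Bochner Y)
    (hT' : ∀ h y, T' (lpTmul h y) = BanachFunctionSpace.tmul (T h) y)
    (hcont : IsWeaklyContinuous (linftyPairing μ β) (hFG.tensorPairing β) T') (e : Lp Y ∞ μ) :
    IsLift T β e (T' e).val := fun x => by
  have key : BanachFunctionSpace.Bochner.compL G (β x) (T' e) = T ((β x).compLp e) :=
    hFG.ext_right fun f => by
      obtain ⟨v, hv⟩ := hcont.exists_eq (BanachFunctionSpace.tmulClosure f x)
      replace hv : ∀ e, hFG.bochnerPairing β (T' e) (BanachFunctionSpace.tmul f x) =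
        linftyPairing μ β e v := hv
      have hvS : v = lpTmul (S f) x := lp_one_ext_of_linftyPairing hβ fun k y => by
        rw [← hv, hT', hFG.bochnerPairing_tmul, BanachFunctionSpace.Bochner.compL_tmul,
          linftyPairing_lpTmul_right, compLp_lpTmul, map_smul, map_smul]
        change β x y • hFG.pairing (T k) f = β x y • _
        rw [hS]; rfl
      rw [← hFG.bochnerPairing_tmul, hv, hvS, linftyPairing_lpTmul_right, hS]; rfl
  filter_upwards [(T' e).coeFn_compL (β x)] with b h
  rw [← h, key]

end Tensor

end

/-! ### Assembly of the main theorem -/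

theorem mainTheorem7 {𝕜 : Type*} [RCLike 𝕜]
    {A : Type*} [MeasurableSpace A] (μ : Measure A) (hμ : μ.IsSemiFinite)
    {B : Type*} [MeasurableSpace B] (ν : Measure B)
    (F G : BanachFunctionSpace 𝕜 ν) (hFG : IsKotheDualPair F G)
    (T : Lp 𝕜 ∞ μ →ₗ[𝕜] G)
    (hT : IsWeaklyContinuous (linftyPairing μ (ContinuousLinearMap.mul 𝕜 𝕜)) hFG.pairing T)
    (hcase : (G.IsDedekindComplete ∧ G.HasStrongOrderUnit) ∨
      (BanachFunctionSpace.IsDualBand (LinearMap.range hFG.toDual) ∧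
        F.IsLatticeIsomorphicToALSpace)) :
    IsRegularOp T ∧ (∃ R : Lp 𝕜 ∞ μ →L[𝕜] G, Dominates (R : Lp 𝕜 ∞ μ →ₗ[𝕜] G) T) ∧
    ∃ S : F →L[𝕜] Lp 𝕜 1 μ,
      IsAdjoint (linftyPairing μ (ContinuousLinearMap.mul 𝕜 𝕜)) hFG.pairing T
        (S : F →ₗ[𝕜] Lp 𝕜 1 μ) ∧
      IsRegularOp (S : F →ₗ[𝕜] Lp 𝕜 1 μ) ∧
      (∃ R : F →L[𝕜] Lp 𝕜 1 μ, Dominates (R : F →ₗ[𝕜] Lp 𝕜 1 μ) (S : F →ₗ[𝕜] Lp 𝕜 1 μ)) ∧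
      ∀ (X Y : Type*) [NormedAddCommGroup X] [NormedSpace 𝕜 X] [CompleteSpace X]
        [NormedAddCommGroup Y] [NormedSpace 𝕜 Y] [CompleteSpace Y]
        (β : X →L[𝕜] Y →L[𝕜] 𝕜), IsBanachDualPair β →
        ∃ T_Y : Lp Y ∞ μ →L[𝕜] G.Bochner Y,
          -- `T_Y` extends `T ⊗ I_Y` and is weakly continuous
          (∀ h y, T_Y (lpTmul h y) = BanachFunctionSpace.tmul (T h) y) ∧
          IsWeaklyContinuous (linftyPairing μ β) (hFG.tensorPairing β)
            (T_Y : Lp Y ∞ μ →ₗ[𝕜] G.Bochner Y) ∧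
          -- and it is the only such operator
          (∀ T' : Lp Y ∞ μ →ₗ[𝕜] G.Bochner Y,
            (∀ h y, T' (lpTmul h y) = BanachFunctionSpace.tmul (T h) y) →
            IsWeaklyContinuous (linftyPairing μ β) (hFG.tensorPairing β) T' →
            T' = T_Y) ∧
          -- `⟨x, T_Y e⟩ = T ⟨x, e⟩`
          (∀ (e : Lp Y ∞ μ) (x : X),
            ∀ᵐ b ∂ν, β x ((T_Y e).val b) = (T ((β x).compLp e)).val b) ∧
          ‖T_Y‖ ≤ dominatedNorm T ∧
          ∃ S_X : F.tensorClosure X →L[𝕜] Lp X 1 μ,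
            IsAdjoint (linftyPairing μ β) (hFG.tensorPairing β)
              (T_Y : Lp Y ∞ μ →ₗ[𝕜] G.Bochner Y) (S_X : F.tensorClosure X →ₗ[𝕜] Lp X 1 μ) ∧
            -- `S_X` is the unique bounded extension of `S ⊗ I_X`
            (∀ f x, S_X (BanachFunctionSpace.tmulClosure f x) = lpTmul (S f) x) ∧
            (∀ S' : F.tensorClosure X →L[𝕜] Lp X 1 μ,
              (∀ f x, S' (BanachFunctionSpace.tmulClosure f x) = lpTmul (S f) x) → S' = S_X) ∧
            ‖S_X‖ ≤ dominatedNorm (S : F →ₗ[𝕜] Lp 𝕜 1 μ) := by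
  obtain ⟨S, hS⟩ := hFG.exists_adjoint hT
  obtain ⟨R, hR⟩ : ∃ R : Lp 𝕜 ∞ μ →ₗ[𝕜] G, Dominates R T := by
    rcases hcase with ⟨h1, h2⟩ | ⟨h1, h2⟩
    · exact exists_dominates_of_hasStrongOrderUnit h1 h2 ⟨T, hFG.continuous_of_isAdjoint hS⟩
    · exact hFG.exists_dominates_of_isDualBand h1 h2 T S hS
  obtain ⟨Q, hQ⟩ := hFG.exists_dominates_adjoint T R hR S hS
  have hRc : ∃ R : Lp 𝕜 ∞ μ →L[𝕜] G, Dominates (R : Lp 𝕜 ∞ μ →ₗ[𝕜] G) T := by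
    -- The dominants produced so far are only linear; positivity makes them bounded, so that
    -- `dominatedNorm` is an infimum over a nonempty set.
    obtain ⟨R', rfl⟩ := (FunctionIdeal.lp μ ∞).exists_continuousLinearMap_of_isPositiveOp
      G.ideal R hR.1
    exact ⟨R', hR⟩
  have hQc : ∃ Q : F →L[𝕜] Lp 𝕜 1 μ,
      Dominates (Q : F →ₗ[𝕜] Lp 𝕜 1 μ) (S : F →ₗ[𝕜] Lp 𝕜 1 μ) := by
    obtain ⟨Q', rfl⟩ := F.ideal.exists_continuousLinearMap_of_isPositiveOp
      (FunctionIdeal.lp μ 1) Q hQ.1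
    exact ⟨Q', hQ⟩
  refine ⟨(FunctionIdeal.lp μ ∞).isRegularOp_of_dominates G.ideal R T hR, hRc, S, hS,
    F.ideal.isRegularOp_of_dominates (FunctionIdeal.lp μ 1) Q S hQ, hQc, ?_⟩
  intro X Y _ _ _ _ _ _ β hβ
  obtain ⟨T_Y, hlift, hnorm⟩ := hFG.exists_bochner_extension T hRc (S : F →ₗ[𝕜] Lp 𝕜 1 μ) hS hβ
  obtain ⟨S_X, hSX, hSnorm⟩ := exists_tensor_extension (X := X) S hQc
  have hadj := hFG.isAdjoint_extension hS β (T_Y : Lp Y ∞ μ →ₗ[𝕜] G.Bochner Y) hlift S_X hSX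
  refine ⟨T_Y, fun h y => Subtype.ext (p := (· ∈ G.bochnerSubmodule Y))
      (isLift_unique T hβ (hlift _) (isLift_tensor T β h y)), hadj.isWeaklyContinuous,
    fun T' hT' hcont => LinearMap.ext fun e => Subtype.ext (p := (· ∈ G.bochnerSubmodule Y))
      (isLift_unique T hβ (hFG.isLift_of_isWeaklyContinuous hS hβ T' hT' hcont e) (hlift e)),
    hlift, hnorm, S_X, hadj, hSX,
    fun S' hS' => BanachFunctionSpace.tensorClosure_ext fun f x => by rw [hS', hSX], hSnorm⟩
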